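/- Let $k$ be a field and let $\Gamma$ be $\mathbb{Z}$ or $\mathbb{Z}/2$. A ($\Gamma$-)graded pre-category $\mathcal{C}$ over $k$ consists of a set of objects $Ob(\mathcal{C})$; for each $n\ge 1$ a set $\mathcal{C}_{tr}^n\subset Ob(\mathcal{C})^n$ of transversal sequences, closed under passing to nonempty subsequences, with $\mathcal{C}_{tr}^1=Ob(\mathcal{C})$; a $\Gamma$-graded $k$-vector space $\mathrm{Hom}(X,Y)$ for each $(X,Y)\in\mathcal{C}_{tr}^2$; and, for each $(X,Y,Z)\in\mathcal{C}_{tr}^3$, a bilinear degree-preserving composition $\mathrm{Hom}(X,Y)\times\mathrm{Hom}(Y,Z)\to\mathrm{Hom}(X,Z)$, associative for sequences in $\mathcal{C}_{tr}^4$. A quasi-isomorphism is an $f\in\mathrm{Hom}^0(X_1,X_2)$, $(X_1,X_2)\in \mathcal{C}_{tr}^2$, such that, whenever $(X_0,X_1,X_2)$ and $(X_1,X_2,X_3)$ are transversal, composition with $f$ gives bijections $\mathrm{Hom}(X_0,X_1)\to\mathrm{Hom}(X_0,X_2)$ and $\mathrm{Hom}(X_2,X_3)\to\mathrm{Hom}(X_1,X_3)$.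 It is required that for every finite family of transversal sequences $S_i$ and every object $X$ there are quasi-isomorphisms $X_-\to X$ and $X\to X_+$ such that all sequences $(X_-,S_i,X_+)$ are transversal. A functor $F:\mathcal{C}\to\mathcal{D}$ of graded pre-categories is a map on objects that preserves transversal sequences, together with degree-preserving linear maps $\mathrm{Hom}_{\mathcal{C}}(X,Y)\to\mathrm{Hom}_{\mathcal{D}}(F(X),F(Y))$ for transversal pairs $(X,Y)$, compatible with the compositions and sending quasi-isomorphisms to quasi-isomorphisms. It is fully faithful if these linear maps are bijective, and an equivalence if, moreover, each object of $\mathcal{D}$ is connected by a chain of quasi-isomorphisms (in either direction) to some $F(X)$. Let $\mathcal{C}_{full}$ be the graded $k$-linear category with the objects of $\mathcal{C}$ that is obtained from $\mathcal{C}$ by formally inverting the quasi-isomorphisms. For $i\ge 0$ and $j\in\Gamma$ put $$CC^{i,j}(\mathcal{C})=\prod_{(X_0,\dots,X_i)\in\mathcal{C}_{tr}^{i+1}}\mathrm{Hom}^j\Big(\bigotimes_{1\le l\le i}\mathrm{Hom}_{\mathcal{C}}(X_{l-1},X_l),\ \mathrm{Hom}_{\mathcal{C}_{full}}(X_0,X_i)\Big),$$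 with the differential $\partial:CC^{n,p}(\mathcal{C})\to CC^{n+1,p}(\mathcal{C})$, $$\partial(\phi)(a_{n+1},\dots,a_1)=\sum_{i=1}^n(-1)^{n-i}\phi(a_{n+1},\dots,a_{i+1}a_i,\dots,a_1)+(-1)^n\phi(a_{n+1},\dots,a_2)a_1+(-1)^{p\deg(a_{n+1})+1}a_{n+1}\phi(a_n,\dots,a_1),$$ and let $HH^{i,j}(\mathcal{C})$ be its cohomology at $CC^{i,j}(\mathcal{C})$. A fully faithful functor $F:\mathcal{C}\to\mathcal{D}$ induces bijections $F_{full}:\mathrm{Hom}_{\mathcal{C}_{full}}(X,Y)\to\mathrm{Hom}_{\mathcal{D}_{full}}(F(X),F(Y))$, and hence a morphism of complexes $F^*:CC^{\bullet,\bullet}(\mathcal{D})\to CC^{\bullet,\bullet}(\mathcal{C})$, $(F^*\phi)(a_i,\dots,a_1)=F_{full}^{-1}\big(\phi(F(a_i),\dots,F(a_1))\big)$. **Main Lemma.** Let $F:\mathcal{C}\to\mathcal{D}$ be an equivalence of graded pre-categories. Then the morphism of complexes $F^*:CC^{\bullet,\bullet}(\mathcal{D})\to CC^{\bullet,\bullet}(\mathcal{C})$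 induces isomorphisms $F^*:HH^{i,j}(\mathcal{D})\to HH^{i,j}(\mathcal{C})$ for all $i\ge 0$ and $j\in\Gamma$. -/

import Mathlib

/-- A grading group with a parity homomorphism, through which the Koszul signs are defined. The
grading groups `ℤ` and `ℤ/2` are the standard cases. -/
class Parity (G : Type*) [AddCommGroup G] where
  parity : G →+ ZMod 2

instance : Parity ℤ := ⟨Int.castAddHom (ZMod 2)⟩

instance : Parity (ZMod 2) := ⟨AddMonoidHom.id (ZMod 2)⟩

/-- The sign `(-1) ^ (p * g)`. -/
def koszulSign {G : Type*} [AddCommGroup G] [Parity G] (p g : G) : ℤ :=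
  (-1) ^ (Parity.parity p * Parity.parity g).val

theorem koszulSign_add {G : Type*} [AddCommGroup G] [Parity G] (p g h : G) :
    koszulSign p (g + h) = koszulSign p g * koszulSign p h := by
  unfold koszulSign
  rw [map_add]
  generalize (Parity.parity p : ZMod 2) = a
  generalize (Parity.parity g : ZMod 2) = b
  generalize (Parity.parity h : ZMod 2) = c
  revert a b c
  decide

theorem koszulSign_zero {G : Type*} [AddCommGroup G] [Parity G] (p : G) :
    koszulSign p 0 = 1 := by
  simp [koszulSign]

universe u v w t

/-- The data of a (non-unital) graded pre-category: a non-unital `A_∞`-pre-category all of whose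
operations other than `m_2` vanish (so that the `A_∞`-relations say that `m_2` is associative on
transversal sequences). The values of `Hom` on non-transversal pairs and of `comp` on
non-transversal triples are irrelevant: they are never used. -/
structure NonunitalGradedPrecat (k : Type w) [Field k] (G : Type t) [AddCommGroup G]
    [DecidableEq G] where
  /-- objects -/
  Ob : Type u
  /-- transversal sequences; by convention, the empty sequence is one of them -/
  Tr : List Ob → Prop
  tr_nil : Tr []
  tr_singleton : ∀ X, Tr [X]
  tr_sublist : ∀ {S T : List Ob}, S.Sublist T → Tr T → Tr S
  /-- morphisms -/
  Hom : Ob → Ob → Type v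
  [homAddCommGroup : ∀ X Y, AddCommGroup (Hom X Y)]
  [homModule : ∀ X Y, Module k (Hom X Y)]
  /-- the homogeneous components of the graded morphism spaces -/
  gr : ∀ X Y, G → Submodule k (Hom X Y)
  isInternal : ∀ X Y, DirectSum.IsInternal (gr X Y)
  /-- composition `m_2`, in diagrammatic order: `comp f g` is `f` followed by `g` -/
  comp : ∀ {X Y Z : Ob}, Hom X Y →ₗ[k] Hom Y Z →ₗ[k] Hom X Z
  comp_mem : ∀ {X Y Z : Ob}, Tr [X, Y, Z] → ∀ {a b : G} {f : Hom X Y} {g : Hom Y Z},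
    f ∈ gr X Y a → g ∈ gr Y Z b → comp f g ∈ gr X Z (a + b)
  assoc : ∀ {X Y Z W : Ob}, Tr [X, Y, Z, W] → ∀ (f : Hom X Y) (g : Hom Y Z) (h : Hom Z W),
    comp (comp f g) h = comp f (comp g h)

attribute [instance] NonunitalGradedPrecat.homAddCommGroup NonunitalGradedPrecat.homModule

/-- Quasi-isomorphisms (the differential `m_1` is zero, so that quasi-isomorphisms of graded spaces
are bijections). -/
structure NonunitalGradedPrecat.IsQuasiIso {k : Type w} [Field k] {G : Type t} [AddCommGroup G]
    [DecidableEq G] (C : NonunitalGradedPrecat.{u, v, w, t} k G) {X Y : C.Ob} (f : C.Hom X Y) :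
    Prop where
  tr : C.Tr [X, Y]
  mem : f ∈ C.gr X Y 0
  bijective : ∀ Z W : C.Ob, C.Tr [Z, X, Y] → C.Tr [X, Y, W] →
    Function.Bijective (fun g : C.Hom Z X => C.comp g f) ∧
    Function.Bijective (fun g : C.Hom Y W => C.comp f g)

/-- A graded pre-category: the extension property holds. -/
structure GradedPrecat (k : Type w) [Field k] (G : Type t) [AddCommGroup G] [DecidableEq G] extends
    NonunitalGradedPrecat.{u, v, w, t} k G where
  extension : ∀ S : List (List Ob), (∀ L ∈ S, L ≠ [] ∧ Tr L) → ∀ X : Ob,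
    ∃ (X₁ X₂ : Ob) (f₁ : Hom X₁ X) (f₂ : Hom X X₂),
      toNonunitalGradedPrecat.IsQuasiIso f₁ ∧ toNonunitalGradedPrecat.IsQuasiIso f₂ ∧
      ∀ L ∈ S, Tr (X₁ :: (L ++ [X₂]))

section

variable {k : Type w} [Field k] {G : Type t} [AddCommGroup G] [DecidableEq G]

namespace NonunitalGradedPrecat

variable (C : NonunitalGradedPrecat.{u, v, w, t} k G)

/-- Formal expressions in the morphisms of `C` and formal inverses of its quasi-isomorphisms. -/
inductive Expr : C.Ob → C.Ob → Type (max u v w)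
  | of {X Y : C.Ob} (h : C.Tr [X, Y]) (f : C.Hom X Y) : Expr X Y
  | inv {X Y : C.Ob} (s : C.Hom X Y) (hs : C.IsQuasiIso s) : Expr Y X
  | id (X : C.Ob) : Expr X X
  | comp {X Y Z : C.Ob} (a : Expr X Y) (b : Expr Y Z) : Expr X Z
  | zero (X Y : C.Ob) : Expr X Y
  | add {X Y : C.Ob} (a b : Expr X Y) : Expr X Y
  | smul {X Y : C.Ob} (r : k) (a : Expr X Y) : Expr X Y

/-- The relations: the laws of a `k`-linear category, linearity of `of`, compatibility of `of` with
the compositions that exist in `C`, and invertibility of quasi-isomorphisms. -/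
inductive Rel : ∀ {X Y : C.Ob}, C.Expr X Y → C.Expr X Y → Prop
  | add_comm {X Y : C.Ob} (a b : C.Expr X Y) : Rel (.add a b) (.add b a)
  | add_assoc {X Y : C.Ob} (a b c : C.Expr X Y) : Rel (.add (.add a b) c) (.add a (.add b c))
  | zero_add {X Y : C.Ob} (a : C.Expr X Y) : Rel (.add (.zero X Y) a) a
  | neg_add {X Y : C.Ob} (a : C.Expr X Y) : Rel (.add (.smul (-1) a) a) (.zero X Y)
  | smul_add {X Y : C.Ob} (r : k) (a b : C.Expr X Y) :
      Rel (.smul r (.add a b)) (.add (.smul r a) (.smul r b))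
  | add_smul {X Y : C.Ob} (r s : k) (a : C.Expr X Y) :
      Rel (.smul (r + s) a) (.add (.smul r a) (.smul s a))
  | mul_smul {X Y : C.Ob} (r s : k) (a : C.Expr X Y) :
      Rel (.smul (r * s) a) (.smul r (.smul s a))
  | one_smul {X Y : C.Ob} (a : C.Expr X Y) : Rel (.smul 1 a) a
  | id_comp {X Y : C.Ob} (a : C.Expr X Y) : Rel (.comp (.id X) a) a
  | comp_id {X Y : C.Ob} (a : C.Expr X Y) : Rel (.comp a (.id Y)) a
  | assoc {X Y Z W : C.Ob} (a : C.Expr X Y) (b : C.Expr Y Z) (c : C.Expr Z W) :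
      Rel (.comp (.comp a b) c) (.comp a (.comp b c))
  | add_comp {X Y Z : C.Ob} (a b : C.Expr X Y) (c : C.Expr Y Z) :
      Rel (.comp (.add a b) c) (.add (.comp a c) (.comp b c))
  | comp_add {X Y Z : C.Ob} (a : C.Expr X Y) (b c : C.Expr Y Z) :
      Rel (.comp a (.add b c)) (.add (.comp a b) (.comp a c))
  | smul_comp {X Y Z : C.Ob} (r : k) (a : C.Expr X Y) (b : C.Expr Y Z) :
      Rel (.comp (.smul r a) b) (.smul r (.comp a b))
  | comp_smul {X Y Z : C.Ob} (r : k) (a : C.Expr X Y) (b : C.Expr Y Z) :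
      Rel (.comp a (.smul r b)) (.smul r (.comp a b))
  | of_add {X Y : C.Ob} (h : C.Tr [X, Y]) (f g : C.Hom X Y) :
      Rel (.of h (f + g)) (.add (.of h f) (.of h g))
  | of_smul {X Y : C.Ob} (h : C.Tr [X, Y]) (r : k) (f : C.Hom X Y) :
      Rel (.of h (r • f)) (.smul r (.of h f))
  | of_comp {X Y Z : C.Ob} (h : C.Tr [X, Y, Z]) (h₁ : C.Tr [X, Y]) (h₂ : C.Tr [Y, Z])
      (h₃ : C.Tr [X, Z]) (f : C.Hom X Y) (g : C.Hom Y Z) :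
      Rel (.of h₃ (C.comp f g)) (.comp (.of h₁ f) (.of h₂ g))
  | of_inv {X Y : C.Ob} (s : C.Hom X Y) (hs : C.IsQuasiIso s) :
      Rel (.comp (.of hs.tr s) (.inv s hs)) (.id X)
  | inv_of {X Y : C.Ob} (s : C.Hom X Y) (hs : C.IsQuasiIso s) :
      Rel (.comp (.inv s hs) (.of hs.tr s)) (.id Y)
  | congr_comp_left {X Y Z : C.Ob} {a a' : C.Expr X Y} (b : C.Expr Y Z) :
      Rel a a' → Rel (.comp a b) (.comp a' b)
  | congr_comp_right {X Y Z : C.Ob} (a : C.Expr X Y) {b b' : C.Expr Y Z} :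
      Rel b b' → Rel (.comp a b) (.comp a b')
  | congr_add_left {X Y : C.Ob} {a a' : C.Expr X Y} (b : C.Expr X Y) :
      Rel a a' → Rel (.add a b) (.add a' b)
  | congr_add_right {X Y : C.Ob} (a : C.Expr X Y) {b b' : C.Expr X Y} :
      Rel b b' → Rel (.add a b) (.add a b')
  | congr_smul {X Y : C.Ob} (r : k) {a a' : C.Expr X Y} :
      Rel a a' → Rel (.smul r a) (.smul r a')

/-- Homogeneous expressions, where formal inverses of quasi-isomorphisms have degree zero. -/
inductive IsHomog : ∀ {X Y : C.Ob}, C.Expr X Y → G → Prop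
  | of {X Y : C.Ob} (h : C.Tr [X, Y]) {f : C.Hom X Y} {g : G} : f ∈ C.gr X Y g → IsHomog (.of h f) g
  | inv {X Y : C.Ob} (s : C.Hom X Y) (hs : C.IsQuasiIso s) : IsHomog (.inv s hs) 0
  | id (X : C.Ob) : IsHomog (.id X) 0
  | comp {X Y Z : C.Ob} {a : C.Expr X Y} {b : C.Expr Y Z} {g h : G} :
      IsHomog a g → IsHomog b h → IsHomog (.comp a b) (g + h)
  | zero (X Y : C.Ob) (g : G) : IsHomog (.zero X Y) g
  | add {X Y : C.Ob} {a b : C.Expr X Y} {g : G} : IsHomog a g → IsHomog b g → IsHomog (.add a b) g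
  | smul {X Y : C.Ob} (r : k) {a : C.Expr X Y} {g : G} : IsHomog a g → IsHomog (.smul r a) g

/-- The morphism space from `X` to `Y` in the graded category `C_full` that is obtained from `C` by
formally inverting the quasi-isomorphisms. -/
def Full (X Y : C.Ob) : Type (max u v w) := Quot (C.Rel (X := X) (Y := Y))

namespace Full

variable {C}

/-- The class of an expression. -/
def mk {X Y : C.Ob} (a : C.Expr X Y) : C.Full X Y := Quot.mk _ a

instance (X Y : C.Ob) : Zero (C.Full X Y) := ⟨mk (.zero X Y)⟩

instance (X Y : C.Ob) : Add (C.Full X Y) :=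
  ⟨Quot.map₂ .add (fun a _ _ h => .congr_add_right a h) (fun _ _ b h => .congr_add_left b h)⟩

instance (X Y : C.Ob) : SMul k (C.Full X Y) :=
  ⟨fun r => Quot.map (.smul r) (fun _ _ h => .congr_smul r h)⟩

instance (X Y : C.Ob) : Neg (C.Full X Y) := ⟨fun a => (-1 : k) • a⟩

instance addCommGroup (X Y : C.Ob) : AddCommGroup (C.Full X Y) :=
  { AddGroup.ofLeftAxioms (G := C.Full X Y)
      (by rintro ⟨a⟩ ⟨b⟩ ⟨c⟩; exact Quot.sound (.add_assoc a b c))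
      (by rintro ⟨a⟩; exact Quot.sound (.zero_add a))
      (by rintro ⟨a⟩; exact Quot.sound (.neg_add a)) with
    add_comm := by rintro ⟨a⟩ ⟨b⟩; exact Quot.sound (.add_comm a b) }

instance module (X Y : C.Ob) : Module k (C.Full X Y) :=
  Module.ofMinimalAxioms
    (by rintro r ⟨a⟩ ⟨b⟩; exact Quot.sound (.smul_add r a b))
    (by rintro r s ⟨a⟩; exact Quot.sound (.add_smul r s a))
    (by rintro r s ⟨a⟩; exact Quot.sound (.mul_smul r s a))
    (by rintro ⟨a⟩; exact Quot.sound (.one_smul a))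

/-- Composition in `C_full`, in diagrammatic order. -/
def comp {X Y Z : C.Ob} : C.Full X Y →ₗ[k] C.Full Y Z →ₗ[k] C.Full X Z :=
  LinearMap.mk₂ k
    (Quot.map₂ .comp (fun a _ _ h => .congr_comp_right a h) (fun _ _ b h => .congr_comp_left b h))
    (by rintro ⟨a⟩ ⟨b⟩ ⟨c⟩; exact Quot.sound (.add_comp a b c))
    (by rintro r ⟨a⟩ ⟨b⟩; exact Quot.sound (.smul_comp r a b))
    (by rintro ⟨a⟩ ⟨b⟩ ⟨c⟩; exact Quot.sound (.comp_add a b c))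
    (by rintro r ⟨a⟩ ⟨b⟩; exact Quot.sound (.comp_smul r a b))

/-- Identities of `C_full`. -/
def id (X : C.Ob) : C.Full X X := mk (.id X)

/-- The functor from `C` to `C_full` on morphisms. -/
def of {X Y : C.Ob} (h : C.Tr [X, Y]) : C.Hom X Y →ₗ[k] C.Full X Y where
  toFun f := mk (.of h f)
  map_add' f g := Quot.sound (.of_add h f g)
  map_smul' r f := Quot.sound (.of_smul h r f)

/-- The inverse of a quasi-isomorphism in `C_full`. -/
def inv {X Y : C.Ob} (s : C.Hom X Y) (hs : C.IsQuasiIso s) : C.Full Y X := mk (.inv s hs)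

theorem id_comp {X Y : C.Ob} (a : C.Full X Y) : comp (id X) a = a := by
  obtain ⟨a⟩ := a; exact Quot.sound (.id_comp a)

theorem comp_id {X Y : C.Ob} (a : C.Full X Y) : comp a (id Y) = a := by
  obtain ⟨a⟩ := a; exact Quot.sound (.comp_id a)

theorem assoc {X Y Z W : C.Ob} (a : C.Full X Y) (b : C.Full Y Z) (c : C.Full Z W) :
    comp (comp a b) c = comp a (comp b c) := by
  obtain ⟨a⟩ := a; obtain ⟨b⟩ := b; obtain ⟨c⟩ := c; exact Quot.sound (.assoc a b c)

theorem of_comp {X Y Z : C.Ob} (h : C.Tr [X, Y, Z]) (h₁ : C.Tr [X, Y]) (h₂ : C.Tr [Y, Z])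
    (h₃ : C.Tr [X, Z]) (f : C.Hom X Y) (g : C.Hom Y Z) :
    of h₃ (C.comp f g) = comp (of h₁ f) (of h₂ g) :=
  Quot.sound (.of_comp h h₁ h₂ h₃ f g)

theorem of_inv {X Y : C.Ob} (s : C.Hom X Y) (hs : C.IsQuasiIso s) :
    comp (of hs.tr s) (inv s hs) = id X := Quot.sound (.of_inv s hs)

theorem inv_of {X Y : C.Ob} (s : C.Hom X Y) (hs : C.IsQuasiIso s) :
    comp (inv s hs) (of hs.tr s) = id Y := Quot.sound (.inv_of s hs)

/-- Composites of three morphisms. -/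
def comp₃ {X Y Z W : C.Ob} (a : C.Full X Y) (b : C.Full Y Z) (c : C.Full Z W) : C.Full X W :=
  comp a (comp b c)

theorem comp₃_left {X Y Z W : C.Ob} (r s : k) (a a' : C.Full X Y) (b : C.Full Y Z)
    (c : C.Full Z W) :
    comp₃ (r • a + s • a') b c = r • comp₃ a b c + s • comp₃ a' b c := by
  simp [comp₃]

theorem comp₃_mid {X Y Z W : C.Ob} (r s : k) (a : C.Full X Y) (b b' : C.Full Y Z)
    (c : C.Full Z W) :
    comp₃ a (r • b + s • b') c = r • comp₃ a b c + s • comp₃ a b' c := by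
  simp [comp₃]

theorem comp₃_add_mid {X Y Z W : C.Ob} (a : C.Full X Y) (b b' : C.Full Y Z) (c : C.Full Z W) :
    comp₃ a (b + b') c = comp₃ a b c + comp₃ a b' c := by
  simp [comp₃]

theorem comp₃_smul_mid {X Y Z W : C.Ob} (r : k) (a : C.Full X Y) (b : C.Full Y Z)
    (c : C.Full Z W) : comp₃ a (r • b) c = r • comp₃ a b c := by
  simp [comp₃]

theorem comp₃_right {X Y Z W : C.Ob} (r s : k) (a : C.Full X Y) (b : C.Full Y Z)
    (c c' : C.Full Z W) :
    comp₃ a b (r • c + s • c') = r • comp₃ a b c + s • comp₃ a b c' := by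
  simp [comp₃]

theorem comp₃_comp₃ {X' X Y Z W W' : C.Ob} (a' : C.Full X' X) (a : C.Full X Y) (b : C.Full Y Z)
    (c : C.Full Z W) (c' : C.Full W W') :
    comp₃ a' (comp₃ a b c) c' = comp₃ (comp a' a) b (comp c c') := by
  simp only [comp₃, assoc]

/-- The homogeneous components of the morphism spaces of `C_full`. -/
def gr (X Y : C.Ob) (g : G) : Submodule k (C.Full X Y) where
  carrier := {x | ∃ a : C.Expr X Y, C.IsHomog a g ∧ mk a = x}
  add_mem' := by
    rintro _ _ ⟨a, ha, rfl⟩ ⟨b, hb, rfl⟩; exact ⟨_, .add ha hb, rfl⟩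
  zero_mem' := ⟨_, .zero X Y g, rfl⟩
  smul_mem' := by
    rintro r _ ⟨a, ha, rfl⟩; exact ⟨_, .smul r ha, rfl⟩

theorem comp_mem {X Y Z : C.Ob} {g h : G} {a : C.Full X Y} {b : C.Full Y Z} (ha : a ∈ gr X Y g)
    (hb : b ∈ gr Y Z h) : comp a b ∈ gr X Z (g + h) := by
  obtain ⟨a, ha, rfl⟩ := ha
  obtain ⟨b, hb, rfl⟩ := hb
  exact ⟨_, .comp ha hb, rfl⟩

theorem of_mem {X Y : C.Ob} (h : C.Tr [X, Y]) {g : G} {f : C.Hom X Y} (hf : f ∈ C.gr X Y g) :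
    of h f ∈ gr X Y g := ⟨_, .of h hf, rfl⟩

theorem id_mem (X : C.Ob) : id X ∈ gr X X (0 : G) := ⟨_, .id X, rfl⟩

end Full

end NonunitalGradedPrecat

namespace NonunitalGradedPrecat

/-- Transversal sequences `(X_0, …, X_n)`. -/
structure TrSeq (C : NonunitalGradedPrecat.{u, v, w, t} k G) (n : ℕ) where
  /-- the objects of the sequence -/
  obj : Fin (n + 1) → C.Ob
  tr : C.Tr (List.ofFn obj)

namespace TrSeq

variable {C : NonunitalGradedPrecat.{u, v, w, t} k G} {m n : ℕ}

/-- The subsequence of a transversal sequence along a strictly increasing map of indices. -/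
def comap (f : Fin (m + 1) ↪o Fin (n + 1)) (X : C.TrSeq n) : C.TrSeq m where
  obj i := X.obj (f i)
  tr := by
    refine C.tr_sublist ?_ X.tr
    rw [List.sublist_iff_exists_fin_orderEmbedding_get_eq]
    refine ⟨(Fin.castOrderIso (List.length_ofFn)).toOrderEmbedding.trans
      (f.trans (Fin.castOrderIso (List.length_ofFn).symm).toOrderEmbedding), ?_⟩
    intro i
    simp [-List.ofFn_succ]
    rfl

theorem tr_two (X : C.TrSeq n) {i j : Fin (n + 1)} (h : i < j) : C.Tr [X.obj i, X.obj j] := by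
  have := (X.comap (m := 1) (OrderEmbedding.ofStrictMono ![i, j] (by
    rw [Fin.strictMono_iff_lt_succ]; simpa [Fin.forall_fin_succ] using h))).tr
  simpa [List.ofFn_succ, comap] using this

theorem tr_three (X : C.TrSeq n) {i j l : Fin (n + 1)} (h : i < j) (h' : j < l) :
    C.Tr [X.obj i, X.obj j, X.obj l] := by
  have := (X.comap (m := 2) (OrderEmbedding.ofStrictMono ![i, j, l] (by
    rw [Fin.strictMono_iff_lt_succ]; simpa [Fin.forall_fin_succ] using ⟨h, h'⟩))).tr
  simpa [List.ofFn_succ, comap] using this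

theorem tr_four (X : C.TrSeq n) {i j l o : Fin (n + 1)} (h : i < j) (h' : j < l) (h'' : l < o) :
    C.Tr [X.obj i, X.obj j, X.obj l, X.obj o] := by
  have := (X.comap (m := 3) (OrderEmbedding.ofStrictMono ![i, j, l, o] (by
    rw [Fin.strictMono_iff_lt_succ]; simpa [Fin.forall_fin_succ] using ⟨h, h', h''⟩))).tr
  simpa [List.ofFn_succ, comap] using this

/-- Strings of composable morphisms `a_l : X_l → X_{l+1}`, `0 ≤ l < n`. -/
abbrev Str (X : C.TrSeq n) : Type v := ∀ l : Fin n, C.Hom (X.obj l.castSucc) (X.obj l.succ)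

/-- The composite `X_i → X_j`, `i < j`, of consecutive morphisms of a string. -/
def seg (X : C.TrSeq n) (a : X.Str) (i : Fin (n + 1)) :
    ∀ j : Fin (n + 1), i < j → C.Hom (X.obj i) (X.obj j) :=
  Fin.induction (fun h => absurd h (Fin.not_lt_zero _)) (fun l ih hl =>
    if h : i < l.castSucc then C.comp (ih h) (a l)
    else (le_antisymm (Fin.le_castSucc_iff.2 hl) (not_lt.1 h)) ▸ a l)

/-- The composite `X_i → X_j`, `i ≤ j`, of consecutive morphisms of a string, taken in `C_full`;
it is the identity for `i = j` (and zero, which is irrelevant, for `i > j`). -/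
def prod (X : C.TrSeq n) (a : X.Str) (i j : Fin (n + 1)) : C.Full (X.obj i) (X.obj j) :=
  if h : i < j then Full.of (X.tr_two h) (X.seg a i j h)
  else if e : i = j then e ▸ Full.id (X.obj i)
  else 0

/-- The string on a subsequence obtained from a given string by composing. -/
def comapStr (f : Fin (m + 1) ↪o Fin (n + 1)) (X : C.TrSeq n) (a : X.Str) : (X.comap f).Str :=
  fun l => X.seg a (f l.castSucc) (f l.succ) (f.lt_iff_lt.2 l.castSucc_lt_succ)

theorem seg_succ_of_lt (X : C.TrSeq n) (a : X.Str) (i : Fin (n + 1)) (l : Fin n)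
    (h : i < l.castSucc) :
    X.seg a i l.succ (h.trans l.castSucc_lt_succ) = C.comp (X.seg a i l.castSucc h) (a l) := by
  unfold seg
  rw [Fin.induction_succ]
  exact dif_pos h

theorem seg_castSucc_succ (X : C.TrSeq n) (a : X.Str) (l : Fin n) :
    X.seg a l.castSucc l.succ l.castSucc_lt_succ = a l := by
  unfold seg
  rw [Fin.induction_succ]
  exact dif_neg (lt_irrefl _)

/-- Induction for segments. -/
theorem seg_induction {P : ∀ i j : Fin (n + 1), i < j → Prop}
    (h₁ : ∀ l : Fin n, P l.castSucc l.succ l.castSucc_lt_succ)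
    (h₂ : ∀ (i : Fin (n + 1)) (l : Fin n) (h : i < l.castSucc), P i l.castSucc h →
      P i l.succ (h.trans l.castSucc_lt_succ)) (i j : Fin (n + 1)) (h : i < j) : P i j h := by
  induction j using Fin.induction with
  | zero => exact absurd h (Fin.not_lt_zero _)
  | succ l ih =>
    by_cases hl : i < l.castSucc
    · exact h₂ i l hl (ih hl)
    · obtain rfl := le_antisymm (Fin.le_castSucc_iff.2 h) (not_lt.1 hl)
      exact h₁ l

theorem comp_seg (X : C.TrSeq n) (a : X.Str) (i j l : Fin (n + 1)) (h : i < j) (h' : j < l) :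
    C.comp (X.seg a i j h) (X.seg a j l h') = X.seg a i l (h.trans h') := by
  revert i
  refine seg_induction (P := fun j l h' => ∀ i (h : i < j),
    C.comp (X.seg a i j h) (X.seg a j l h') = X.seg a i l (h.trans h')) ?_ ?_ j l h'
  · intro l i h
    rw [seg_castSucc_succ, seg_succ_of_lt]
  · intro j l hj ih i h
    rw [seg_succ_of_lt X a j l hj, seg_succ_of_lt X a i l (h.trans hj), ← ih i h,
      C.assoc (X.tr_four h hj l.castSucc_lt_succ)]

theorem prod_of_lt (X : C.TrSeq n) (a : X.Str) {i j : Fin (n + 1)} (h : i < j) :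
    X.prod a i j = Full.of (X.tr_two h) (X.seg a i j h) := dif_pos h

theorem prod_self (X : C.TrSeq n) (a : X.Str) (i : Fin (n + 1)) :
    X.prod a i i = Full.id (X.obj i) := by
  simp [prod]

theorem comp_prod (X : C.TrSeq n) (a : X.Str) {i j l : Fin (n + 1)} (h : i ≤ j) (h' : j ≤ l) :
    Full.comp (X.prod a i j) (X.prod a j l) = X.prod a i l := by
  obtain rfl | h := h.eq_or_lt
  · rw [prod_self, Full.id_comp]
  obtain rfl | h' := h'.eq_or_lt
  · rw [prod_self, Full.comp_id]
  rw [prod_of_lt _ _ h, prod_of_lt _ _ h', prod_of_lt _ _ (h.trans h'), ← comp_seg _ _ _ _ _ h h',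
    Full.of_comp (X.tr_three h h')]

theorem seg_comapStr (f : Fin (m + 1) ↪o Fin (n + 1)) (X : C.TrSeq n) (a : X.Str)
    (i j : Fin (m + 1)) (h : i < j) :
    (X.comap f).seg (X.comapStr f a) i j h = X.seg a (f i) (f j) (f.lt_iff_lt.2 h) := by
  refine seg_induction (P := fun i j h => (X.comap f).seg (X.comapStr f a) i j h =
    X.seg a (f i) (f j) (f.lt_iff_lt.2 h)) ?_ ?_ i j h
  · intro l
    rw [seg_castSucc_succ]; rfl
  · intro i l h ih
    rw [seg_succ_of_lt _ _ _ _ h, ih]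
    exact comp_seg X a _ _ _ _ _

theorem prod_comapStr (f : Fin (m + 1) ↪o Fin (n + 1)) (X : C.TrSeq n) (a : X.Str)
    (i j : Fin (m + 1)) (h : i ≤ j) :
    (X.comap f).prod (X.comapStr f a) i j = X.prod a (f i) (f j) := by
  obtain rfl | h := h.eq_or_lt
  · rw [prod_self, prod_self]; rfl
  · rw [prod_of_lt _ _ h, prod_of_lt _ _ (f.lt_iff_lt.2 h), seg_comapStr]; rfl

theorem comapStr_trans {o : ℕ} (f : Fin (o + 1) ↪o Fin (m + 1)) (g : Fin (m + 1) ↪o Fin (n + 1))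
    (X : C.TrSeq n) (a : X.Str) :
    (X.comap g).comapStr f (X.comapStr g a) = X.comapStr (f.trans g) a := by
  funext l
  exact seg_comapStr g X a _ _ _


/-- The strings `a`, `b`, `c` agree away from `l`, and `a_l = r b_l + s c_l`. -/
structure IsComb {X : C.TrSeq n} (l : Fin n) (r s : k) (a b c : X.Str) : Prop where
  left : ∀ l', l' ≠ l → a l' = b l'
  right : ∀ l', l' ≠ l → a l' = c l'
  comb : a l = r • b l + s • c l

theorem seg_congr (X : C.TrSeq n) (a b : X.Str) (i j : Fin (n + 1)) (h : i < j) :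
    (∀ l : Fin n, i ≤ l.castSucc → l.succ ≤ j → a l = b l) → X.seg a i j h = X.seg b i j h := by
  refine seg_induction (P := fun i j h => (∀ l : Fin n, i ≤ l.castSucc → l.succ ≤ j → a l = b l) →
    X.seg a i j h = X.seg b i j h) ?_ ?_ i j h
  · intro l H
    rw [seg_castSucc_succ, seg_castSucc_succ, H l le_rfl le_rfl]
  · intro i l h ih H
    rw [seg_succ_of_lt _ _ _ _ h, seg_succ_of_lt _ _ _ _ h, H l h.le le_rfl,
      ih fun l' h₁ h₂ => H l' h₁ (h₂.trans l.castSucc_lt_succ.le)]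

theorem prod_congr (X : C.TrSeq n) (a b : X.Str) (i j : Fin (n + 1))
    (H : ∀ l : Fin n, i ≤ l.castSucc → l.succ ≤ j → a l = b l) : X.prod a i j = X.prod b i j := by
  unfold prod
  split_ifs with h
  · rw [seg_congr X a b i j h H]
  · rfl
  · rfl

theorem IsComb.seg {X : C.TrSeq n} {l : Fin n} {r s : k} {a b c : X.Str} (H : IsComb l r s a b c)
    (i j : Fin (n + 1)) (h : i < j) : i ≤ l.castSucc → l.succ ≤ j →
    X.seg a i j h = r • X.seg b i j h + s • X.seg c i j h := by
  refine seg_induction (P := fun i j h => i ≤ l.castSucc → l.succ ≤ j →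
    X.seg a i j h = r • X.seg b i j h + s • X.seg c i j h) ?_ ?_ i j h
  · intro l' h₁ h₂
    obtain rfl : l' = l := by
      simp only [Fin.le_def, Fin.val_succ, Fin.val_castSucc] at h₁ h₂; ext; omega
    simp only [seg_castSucc_succ, H.comb]
  · intro i l' h ih h₁ h₂
    rw [seg_succ_of_lt _ _ _ _ h, seg_succ_of_lt _ _ _ _ h, seg_succ_of_lt _ _ _ _ h]
    by_cases hl : l' = l
    · subst hl
      have e₁ : X.seg a i l'.castSucc h = X.seg b i l'.castSucc h :=
        seg_congr _ _ _ _ _ _ fun m _ hm => H.left m fun e => by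
          subst e; simp [Fin.le_def] at hm
      have e₂ : X.seg a i l'.castSucc h = X.seg c i l'.castSucc h :=
        seg_congr _ _ _ _ _ _ fun m _ hm => H.right m fun e => by
          subst e; simp [Fin.le_def] at hm
      rw [← e₁, ← e₂, H.comb, map_add, map_smul, map_smul]
    · rw [ih h₁ (by
        have := fun h => hl (Fin.ext h)
        simp only [Fin.le_def, Fin.val_succ, Fin.val_castSucc] at h₂ ⊢; omega),
        ← H.left l' hl, ← H.right l' hl, map_add, map_smul, map_smul, LinearMap.add_apply,
        LinearMap.smul_apply, LinearMap.smul_apply]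

theorem IsComb.prod {X : C.TrSeq n} {l : Fin n} {r s : k} {a b c : X.Str} (H : IsComb l r s a b c)
    (i j : Fin (n + 1)) (h₁ : i ≤ l.castSucc) (h₂ : l.succ ≤ j) :
    X.prod a i j = r • X.prod b i j + s • X.prod c i j := by
  have h : i < j := h₁.trans_lt (l.castSucc_lt_succ.trans_le h₂)
  rw [prod_of_lt _ _ h, prod_of_lt _ _ h, prod_of_lt _ _ h, H.seg i j h h₁ h₂, map_add, map_smul,
    map_smul]

theorem IsComb.apply {X : C.TrSeq n} {l : Fin n} {r s : k} {a b c : X.Str}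
    (H : IsComb l r s a b c) {V : Type*} [AddCommGroup V] [Module k V]
    (φ : MultilinearMap k (fun l : Fin n => C.Hom (X.obj l.castSucc) (X.obj l.succ)) V) :
    φ a = r • φ b + s • φ c := by
  have e₁ : a = Function.update b l (r • b l + s • c l) := by
    funext m
    by_cases hm : m = l
    · subst hm; simp [H.comb]
    · simp [hm, H.left m hm]
  have e₂ : Function.update b l (c l) = c := by
    funext m
    by_cases hm : m = l
    · subst hm; simp
    · simp [hm, ← H.left m hm, H.right m hm]
  rw [e₁, φ.map_update_add, φ.map_update_smul, φ.map_update_smul, e₂, Function.update_eq_self]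

theorem IsComb.comapStr {X : C.TrSeq n} {l : Fin n} {r s : k} {a b c : X.Str}
    (H : IsComb l r s a b c) (f : Fin (m + 1) ↪o Fin (n + 1)) (l' : Fin m)
    (h₁ : f l'.castSucc ≤ l.castSucc) (h₂ : l.succ ≤ f l'.succ) :
    IsComb l' r s (X.comapStr f a) (X.comapStr f b) (X.comapStr f c) := by
  have key : ∀ q : Fin m, q ≠ l' → ∀ o : Fin n, f q.castSucc ≤ o.castSucc → o.succ ≤ f q.succ →
      o ≠ l := by
    rintro q hq o h₃ h₄ rfl
    obtain h | h := lt_or_gt_of_ne hq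
    · have := f.monotone (Fin.succ_le_castSucc_iff.2 h)
      simp only [Fin.le_def, Fin.val_succ, Fin.val_castSucc] at *; omega
    · have := f.monotone (Fin.succ_le_castSucc_iff.2 h)
      simp only [Fin.le_def, Fin.val_succ, Fin.val_castSucc] at *; omega
  exact ⟨fun q hq => seg_congr _ _ _ _ _ _ fun o h₃ h₄ => H.left o (key q hq o h₃ h₄),
    fun q hq => seg_congr _ _ _ _ _ _ fun o h₃ h₄ => H.right o (key q hq o h₃ h₄),
    H.seg _ _ _ h₁ h₂⟩

theorem exists_between (f : Fin (m + 1) ↪o Fin (n + 1)) (l : Fin n) (h₁ : f 0 ≤ l.castSucc)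
    (h₂ : l.succ ≤ f (Fin.last m)) :
    ∃ l' : Fin m, f l'.castSucc ≤ l.castSucc ∧ l.succ ≤ f l'.succ := by
  by_contra! H
  have : ∀ j : Fin (m + 1), f j ≤ l.castSucc := by
    intro j
    induction j using Fin.induction with
    | zero => exact h₁
    | succ j ih => exact Fin.le_castSucc_iff.2 (H j ih)
  exact absurd (h₂.trans (this _)) (not_le.2 l.castSucc_lt_succ)

end TrSeq

variable {C : NonunitalGradedPrecat.{u, v, w, t} k G}

/-- The linear map `f ↦ (-1) ^ (p * deg f) f`. -/
noncomputable def twist [Parity G] (p : G) (X Y : C.Ob) : C.Hom X Y →ₗ[k] C.Hom X Y :=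
  DirectSum.toModule k G (C.Hom X Y) (fun g => koszulSign p g • (C.gr X Y g).subtype) ∘ₗ
    (LinearEquiv.ofBijective (DirectSum.coeLinearMap (C.gr X Y)) (C.isInternal X Y)).symm.toLinearMap

theorem twist_of_mem [Parity G] (p : G) {X Y : C.Ob} {g : G} {f : C.Hom X Y}
    (hf : f ∈ C.gr X Y g) : twist p X Y f = koszulSign p g • f := by
  have : (LinearEquiv.ofBijective (DirectSum.coeLinearMap (C.gr X Y)) (C.isInternal X Y)).symm f =
      DirectSum.lof k G (fun g => C.gr X Y g) g ⟨f, hf⟩ := by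
    rw [LinearEquiv.symm_apply_eq]
    exact (DirectSum.coeLinearMap_lof (C.gr X Y) g ⟨f, hf⟩).symm
  rw [twist, LinearMap.comp_apply, LinearEquiv.coe_coe, this, DirectSum.toModule_lof]
  rfl

theorem hom_induction {X Y : C.Ob} {P : C.Hom X Y → Prop} (h₀ : P 0)
    (h₁ : ∀ g, ∀ f ∈ C.gr X Y g, P f) (h₂ : ∀ f f', P f → P f' → P (f + f')) (f : C.Hom X Y) :
    P f := by
  have hf : f ∈ ⨆ g, C.gr X Y g := by
    rw [(C.isInternal X Y).submodule_iSup_eq_top]; trivial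
  exact Submodule.iSup_induction (motive := P) _ hf h₁ h₀ h₂

theorem twist_comp [Parity G] (p : G) {X Y Z : C.Ob} (h : C.Tr [X, Y, Z]) (f : C.Hom X Y)
    (f' : C.Hom Y Z) :
    twist p X Z (C.comp f f') = C.comp (twist p X Y f) (twist p Y Z f') := by
  induction f using hom_induction with
  | h₀ => simp
  | h₂ f₁ f₂ h₁ h₂ => simp [h₁, h₂]
  | h₁ g f hf =>
    induction f' using hom_induction with
    | h₀ => simp
    | h₂ f₁ f₂ h₁ h₂ => simp only [map_add, h₁, h₂]
    | h₁ g' f' hf' =>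
      rw [twist_of_mem p (C.comp_mem h hf hf'), twist_of_mem p hf, twist_of_mem p hf',
        koszulSign_add]
      simp [mul_smul]

namespace TrSeq

variable {m n : ℕ}

/-- The map `f ↦ (-1) ^ (p * deg f) f`, applied to all morphisms of a string. -/
noncomputable def twistStr [Parity G] (p : G) (X : C.TrSeq n) (a : X.Str) : X.Str := fun l => twist p _ _ (a l)

theorem seg_twistStr [Parity G] (p : G) (X : C.TrSeq n) (a : X.Str) (i j : Fin (n + 1))
    (h : i < j) : X.seg (X.twistStr p a) i j h = twist p _ _ (X.seg a i j h) := by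
  refine seg_induction (P := fun i j h =>
    X.seg (X.twistStr p a) i j h = twist p _ _ (X.seg a i j h)) ?_ ?_ i j h
  · intro l
    rw [seg_castSucc_succ, seg_castSucc_succ]; rfl
  · intro i l h ih
    rw [seg_succ_of_lt _ _ _ _ h, seg_succ_of_lt _ _ _ _ h, ih,
      twist_comp p (X.tr_three h l.castSucc_lt_succ)]
    rfl

theorem comapStr_twistStr [Parity G] (p : G) (f : Fin (m + 1) ↪o Fin (n + 1)) (X : C.TrSeq n)
    (a : X.Str) : (X.comap f).twistStr p (X.comapStr f a) = X.comapStr f (X.twistStr p a) := by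
  funext l
  exact (seg_twistStr p X a _ _ _).symm

theorem IsComb.twistStr [Parity G] {X : C.TrSeq n} {l : Fin n} {r s : k} {a b c : X.Str}
    (H : IsComb l r s a b c) (p : G) :
    IsComb l r s (X.twistStr p a) (X.twistStr p b) (X.twistStr p c) :=
  ⟨fun q hq => by simp [TrSeq.twistStr, H.left q hq], fun q hq => by simp [TrSeq.twistStr,
    ← H.right q hq], by simp [TrSeq.twistStr, H.comb]⟩

end TrSeq

variable (C) in
/-- All cochains of length `n`: for each transversal sequence, a multilinear map
`Hom_C(X_0, X_1) × … × Hom_C(X_{n-1}, X_n) → Hom_{C_full}(X_0, X_n)`. -/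
abbrev Coch (n : ℕ) : Type (max u v w) := ∀ X : C.TrSeq n,
  MultilinearMap k (fun l : Fin n => C.Hom (X.obj l.castSucc) (X.obj l.succ))
    (C.Full (X.obj 0) (X.obj (Fin.last n)))

variable (C) in
/-- The bigraded Hochschild cochains `CC^{n,p}(C)`: the cochains of length `n` that are homogeneous
of degree `p`. -/
def CC (n : ℕ) (p : G) : Submodule k (C.Coch n) where
  carrier := {φ | ∀ (X : C.TrSeq n) (a : X.Str) (d : Fin n → G),
    (∀ l, a l ∈ C.gr (X.obj l.castSucc) (X.obj l.succ) (d l)) →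
      φ X a ∈ Full.gr (X.obj 0) (X.obj (Fin.last n)) (p + ∑ l, d l)}
  add_mem' h h' X a d ha := add_mem (h X a d ha) (h' X a d ha)
  zero_mem' _ _ _ _ := zero_mem _
  smul_mem' r _ h X a d ha := Submodule.smul_mem _ r (h X a d ha)

/-- The value of the cochain `transport p f φ` on a string. -/
noncomputable def transportFun [Parity G] (p : G) {m n : ℕ} (f : Fin (m + 1) ↪o Fin (n + 1)) (φ : C.Coch m)
    (X : C.TrSeq n) (a : X.Str) : C.Full (X.obj 0) (X.obj (Fin.last n)) :=
  Full.comp₃ (X.prod a 0 (f 0)) (φ (X.comap f) (X.comapStr f a))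
    (X.prod (X.twistStr p a) (f (Fin.last m)) (Fin.last n))

theorem transportFun_comb [Parity G] (p : G) {m n : ℕ} (f : Fin (m + 1) ↪o Fin (n + 1))
    (φ : C.Coch m) (X : C.TrSeq n) {l : Fin n} {r s : k} {a b c : X.Str}
    (H : TrSeq.IsComb l r s a b c) :
    transportFun p f φ X a = r • transportFun p f φ X b + s • transportFun p f φ X c := by
  have hf : f 0 ≤ f (Fin.last m) := f.monotone (Fin.zero_le _)
  have H' := H.twistStr p
  unfold transportFun
  by_cases h₁ : f 0 ≤ l.castSucc
  · have e₁ : X.prod a 0 (f 0) = X.prod b 0 (f 0) := TrSeq.prod_congr _ _ _ _ _ fun o _ ho =>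
      H.left o fun e => by subst e; exact absurd (ho.trans h₁) (not_le.2 o.castSucc_lt_succ)
    have e₂ : X.prod a 0 (f 0) = X.prod c 0 (f 0) := TrSeq.prod_congr _ _ _ _ _ fun o _ ho =>
      H.right o fun e => by subst e; exact absurd (ho.trans h₁) (not_le.2 o.castSucc_lt_succ)
    rw [← e₁, ← e₂]
    by_cases h₂ : l.succ ≤ f (Fin.last m)
    · obtain ⟨l', h₃, h₄⟩ := TrSeq.exists_between f l h₁ h₂
      have e₃ : X.prod (X.twistStr p a) (f (Fin.last m)) (Fin.last n) =
          X.prod (X.twistStr p b) (f (Fin.last m)) (Fin.last n) :=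
        TrSeq.prod_congr _ _ _ _ _ fun o ho _ =>
          H'.left o fun e => by subst e; exact absurd (h₂.trans ho) (not_le.2 o.castSucc_lt_succ)
      have e₄ : X.prod (X.twistStr p a) (f (Fin.last m)) (Fin.last n) =
          X.prod (X.twistStr p c) (f (Fin.last m)) (Fin.last n) :=
        TrSeq.prod_congr _ _ _ _ _ fun o ho _ =>
          H'.right o fun e => by subst e; exact absurd (h₂.trans ho) (not_le.2 o.castSucc_lt_succ)
      rw [← e₃, ← e₄, (H.comapStr f l' h₃ h₄).apply (φ (X.comap f))]
      exact Full.comp₃_mid ..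
    · have h₂' : f (Fin.last m) ≤ l.castSucc := Fin.le_castSucc_iff.2 (not_le.1 h₂)
      have e₃ : X.comapStr f a = X.comapStr f b := by
        funext q
        refine TrSeq.seg_congr _ _ _ _ _ _ fun o _ ho => H.left o fun e => ?_
        subst e
        exact h₂ (ho.trans (f.monotone (Fin.le_last _)))
      have e₄ : X.comapStr f a = X.comapStr f c := by
        funext q
        refine TrSeq.seg_congr _ _ _ _ _ _ fun o _ ho => H.right o fun e => ?_
        subst e
        exact h₂ (ho.trans (f.monotone (Fin.le_last _)))
      rw [← e₃, ← e₄, H'.prod _ _ h₂' (Fin.le_last _)]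
      exact Full.comp₃_right ..
  · have h₁' : l.succ ≤ f 0 := by
      rw [Fin.le_def, Fin.val_succ]; rw [Fin.le_def, Fin.val_castSucc] at h₁; omega
    have e₁ : X.comapStr f a = X.comapStr f b := by
      funext q
      refine TrSeq.seg_congr _ _ _ _ _ _ fun o ho _ => H.left o fun e => ?_
      subst e
      exact h₁ ((f.monotone (Fin.zero_le _)).trans ho)
    have e₂ : X.comapStr f a = X.comapStr f c := by
      funext q
      refine TrSeq.seg_congr _ _ _ _ _ _ fun o ho _ => H.right o fun e => ?_
      subst e
      exact h₁ ((f.monotone (Fin.zero_le _)).trans ho)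
    have e₃ : X.prod (X.twistStr p a) (f (Fin.last m)) (Fin.last n) =
        X.prod (X.twistStr p b) (f (Fin.last m)) (Fin.last n) :=
      TrSeq.prod_congr _ _ _ _ _ fun o ho _ =>
        H'.left o fun e => by subst e; exact h₁ (hf.trans ho)
    have e₄ : X.prod (X.twistStr p a) (f (Fin.last m)) (Fin.last n) =
        X.prod (X.twistStr p c) (f (Fin.last m)) (Fin.last n) :=
      TrSeq.prod_congr _ _ _ _ _ fun o ho _ =>
        H'.right o fun e => by subst e; exact h₁ (hf.trans ho)
    rw [← e₁, ← e₂, ← e₃, ← e₄, H.prod _ _ (Fin.zero_le _) h₁']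
    exact Full.comp₃_left ..

/-- For a strictly increasing map of indices `f`, the map on cochains that sends `φ`, of degree `p`,
to `(a_n, …, a_1) ↦ ± a_n ⋯ a_{f(m)+1} φ(a_{f(m)} ⋯ a_{f(m-1)+1}, …, a_{f(1)} ⋯ a_{f(0)+1})
a_{f(0)} ⋯ a_1`, with the sign `(-1) ^ (p * (deg a_n + ⋯ + deg a_{f(m)+1}))`. -/
noncomputable def transport [Parity G] (p : G) {m n : ℕ} (f : Fin (m + 1) ↪o Fin (n + 1)) :
    C.Coch m →ₗ[k] C.Coch n where
  toFun φ X :=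
    { toFun := transportFun p f φ X
      map_update_add' := fun a l x y => by
        have := transportFun_comb p f φ X (l := l) (r := 1) (s := 1)
          (a := Function.update a l (x + y)) (b := Function.update a l x)
          (c := Function.update a l y) ⟨fun q hq => by simp [hq], fun q hq => by simp [hq], by simp⟩
        simpa using this
      map_update_smul' := fun a l r x => by
        have := transportFun_comb p f φ X (l := l) (r := r) (s := 0)
          (a := Function.update a l (r • x)) (b := Function.update a l x)
          (c := Function.update a l x) ⟨fun q hq => by simp [hq], fun q hq => by simp [hq], by simp⟩
        simpa using this }
  map_add' φ ψ := by
    funext X; ext a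
    exact Full.comp₃_add_mid ..
  map_smul' r φ := by
    funext X; ext a
    exact Full.comp₃_smul_mid ..

theorem transport_trans [Parity G] (p : G) {o m n : ℕ} (f : Fin (o + 1) ↪o Fin (m + 1))
    (g : Fin (m + 1) ↪o Fin (n + 1)) (φ : C.Coch o) :
    transport p g (transport p f φ) = transport p (f.trans g) φ := by
  funext X
  ext a
  have h₁ : (X.comap g).prod (X.comapStr g a) 0 (f 0) = X.prod a (g 0) (g (f 0)) :=
    TrSeq.prod_comapStr _ _ _ _ _ (Fin.zero_le _)
  have h₂ : (X.comap g).prod ((X.comap g).twistStr p (X.comapStr g a)) (f (Fin.last o))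
      (Fin.last m) = X.prod (X.twistStr p a) (g (f (Fin.last o))) (g (Fin.last m)) := by
    rw [TrSeq.comapStr_twistStr]
    exact TrSeq.prod_comapStr _ _ _ _ _ (Fin.le_last _)
  have h₃ : Full.comp (X.prod (X.twistStr p a) (g (f (Fin.last o))) (g (Fin.last m)))
      (X.prod (X.twistStr p a) (g (Fin.last m)) (Fin.last n)) =
      X.prod (X.twistStr p a) (g (f (Fin.last o))) (Fin.last n) :=
    TrSeq.comp_prod _ _ (g.monotone (Fin.le_last _)) (Fin.le_last _)
  have h₄ : Full.comp (X.prod a 0 (g 0)) (X.prod a (g 0) (g (f 0))) = X.prod a 0 (g (f 0)) :=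
    TrSeq.comp_prod _ _ (Fin.zero_le _) (g.monotone (Fin.zero_le _))
  change Full.comp₃ (X.prod a 0 (g 0)) (Full.comp₃ ((X.comap g).prod (X.comapStr g a) 0 (f 0))
    (φ ((X.comap g).comap f) ((X.comap g).comapStr f (X.comapStr g a)))
    ((X.comap g).prod ((X.comap g).twistStr p (X.comapStr g a)) (f (Fin.last o)) (Fin.last m)))
    (X.prod (X.twistStr p a) (g (Fin.last m)) (Fin.last n)) =
    Full.comp₃ (X.prod a 0 (g (f 0))) (φ (X.comap (f.trans g)) (X.comapStr (f.trans g) a))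
      (X.prod (X.twistStr p a) (g (f (Fin.last o))) (Fin.last n))
  rw [h₁, h₂, ← h₃, ← h₄, TrSeq.comapStr_trans]
  exact Full.comp₃_comp₃ ..
end NonunitalGradedPrecat

namespace NonunitalGradedPrecat

variable {C : NonunitalGradedPrecat.{u, v, w, t} k G}

namespace TrSeq

variable {m n : ℕ}

theorem seg_mem (X : C.TrSeq n) (a : X.Str) (e : Fin (n + 1) → G)
    (ha : ∀ l : Fin n, a l ∈ C.gr (X.obj l.castSucc) (X.obj l.succ) (e l.succ - e l.castSucc))
    (i j : Fin (n + 1)) (h : i < j) : X.seg a i j h ∈ C.gr (X.obj i) (X.obj j) (e j - e i) := by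
  refine seg_induction (P := fun i j h => X.seg a i j h ∈ C.gr (X.obj i) (X.obj j) (e j - e i))
    ?_ ?_ i j h
  · intro l
    rw [seg_castSucc_succ]
    exact ha l
  · intro i l h ih
    rw [seg_succ_of_lt _ _ _ _ h]
    have := C.comp_mem (X.tr_three h l.castSucc_lt_succ) ih (ha l)
    rwa [add_comm, sub_add_sub_cancel] at this

theorem prod_mem (X : C.TrSeq n) (a : X.Str) (e : Fin (n + 1) → G)
    (ha : ∀ l : Fin n, a l ∈ C.gr (X.obj l.castSucc) (X.obj l.succ) (e l.succ - e l.castSucc))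
    (i j : Fin (n + 1)) (h : i ≤ j) : X.prod a i j ∈ Full.gr (X.obj i) (X.obj j) (e j - e i) := by
  obtain rfl | h := h.eq_or_lt
  · rw [prod_self, sub_self]
    exact Full.id_mem _
  · rw [prod_of_lt _ _ h]
    exact Full.of_mem _ (seg_mem X a e ha i j h)

end TrSeq

theorem sum_fin_sub (n : ℕ) (e : Fin (n + 1) → G) :
    ∑ l : Fin n, (e l.succ - e l.castSucc) = e (Fin.last n) - e 0 := by
  induction n with
  | zero => simp
  | succ n ih =>
    rw [Fin.sum_univ_castSucc]
    have := ih (fun l => e l.castSucc)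
    simp only [Fin.castSucc_zero] at this
    have h : ∑ l : Fin n, (e l.castSucc.succ - e l.castSucc.castSucc) =
      e (Fin.last n).castSucc - e 0 := this
    rw [h, ← Fin.succ_last]
    abel

theorem exists_partialSum {n : ℕ} (d : Fin n → G) :
    ∃ e : Fin (n + 1) → G, ∀ l : Fin n, d l = e l.succ - e l.castSucc := by
  refine ⟨Fin.induction 0 (fun l x => x + d l), fun l => ?_⟩
  beta_reduce
  rw [Fin.induction_succ]
  simp

theorem mem_CC_iff {n : ℕ} {p : G} {φ : C.Coch n} : φ ∈ CC C n p ↔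
    ∀ (X : C.TrSeq n) (a : X.Str) (e : Fin (n + 1) → G),
      (∀ l, a l ∈ C.gr (X.obj l.castSucc) (X.obj l.succ) (e l.succ - e l.castSucc)) →
      φ X a ∈ Full.gr (X.obj 0) (X.obj (Fin.last n)) (p + (e (Fin.last n) - e 0)) := by
  constructor
  · intro h X a e ha
    have := h X a (fun l => e l.succ - e l.castSucc) ha
    rwa [sum_fin_sub] at this
  · intro h X a d ha
    obtain ⟨e, he⟩ := exists_partialSum d
    have := h X a e (fun l => he l ▸ ha l)
    rw [← sum_fin_sub] at this
    simpa only [he] using this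

theorem twist_mem [Parity G] (p : G) {X Y : C.Ob} {g : G} {f : C.Hom X Y} (hf : f ∈ C.gr X Y g) :
    twist p X Y f ∈ C.gr X Y g := by
  rw [twist_of_mem p hf]
  exact zsmul_mem hf _

theorem transport_mem [Parity G] {p : G} {m n : ℕ} (f : Fin (m + 1) ↪o Fin (n + 1)) {φ : C.Coch m}
    (h : φ ∈ CC C m p) : transport p f φ ∈ CC C n p := by
  rw [mem_CC_iff] at h ⊢
  intro X a e ha
  have h₁ := TrSeq.prod_mem X a e ha 0 (f 0) (Fin.zero_le _)
  have h₂ := h (X.comap f) (X.comapStr f a) (fun i => e (f i))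
    (fun l => TrSeq.seg_mem X a e ha _ _ _)
  have h₃ := TrSeq.prod_mem X (X.twistStr p a) e (fun l => twist_mem p (ha l)) (f (Fin.last m))
    (Fin.last n) (Fin.le_last _)
  have := Full.comp_mem h₁ (Full.comp_mem h₂ h₃)
  have e₁ : e (f 0) - e 0 + (p + (e (f (Fin.last m)) - e (f 0)) +
      (e (Fin.last n) - e (f (Fin.last m)))) = p + (e (Fin.last n) - e 0) := by abel
  rw [e₁] at this
  exact this

/-- The Hochschild differential on cochains of length `n` and degree `p`. The summand of index `i`,
for `1 ≤ i ≤ n`, is `(-1)^{n-i} φ(a_{n+1}, …, a_{i+1} a_i, …, a_1)`; the summand of index `0` is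
`(-1)^n φ(a_{n+1}, …, a_2) a_1`, and that of index `n + 1` is
`(-1)^{p deg(a_{n+1}) + 1} a_{n+1} φ(a_n, …, a_1)`. -/
noncomputable def hochschildD [Parity G] (p : G) (n : ℕ) : C.Coch n →ₗ[k] C.Coch (n + 1) :=
  ∑ i : Fin (n + 2), (-1 : ℤ) ^ (n + (i : ℕ)) • transport p (Fin.succAboveOrderEmb i)

theorem hochschildD_mem [Parity G] {p : G} {n : ℕ} {φ : C.Coch n} (h : φ ∈ CC C n p) :
    hochschildD p n φ ∈ CC C (n + 1) p := by
  rw [hochschildD, LinearMap.sum_apply]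
  exact sum_mem fun i _ => zsmul_mem (transport_mem _ h) _

theorem hochschildD_hochschildD [Parity G] (p : G) (n : ℕ) (φ : C.Coch n) :
    hochschildD p (n + 1) (hochschildD p n φ) = 0 := by
  have key : ∀ (i : Fin (n + 2)) (j : Fin (n + 2)), i ≤ j →
      (Fin.succAboveOrderEmb i).trans (Fin.succAboveOrderEmb j.succ) =
      (Fin.succAboveOrderEmb j).trans (Fin.succAboveOrderEmb i.castSucc) := by
    intro i j hij
    ext l
    simp only [RelEmbedding.coe_trans, Function.comp_apply, Fin.succAboveOrderEmb_apply,
      Fin.succAbove, Fin.lt_def, Fin.le_def] at *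
    split_ifs <;> simp_all <;> omega
  simp only [hochschildD, LinearMap.sum_apply, LinearMap.smul_apply, map_sum, map_zsmul,
    transport_trans, Finset.smul_sum, ← Finset.sum_product']
  let P := Fin (n + 2) × Fin (n + 3)
  let S : Finset P := {ij : P | (ij.2 : ℕ) ≤ (ij.1 : ℕ)}
  rw [Finset.univ_product_univ, ← Finset.sum_add_sum_compl S, ← eq_neg_iff_add_eq_zero,
    ← Finset.sum_neg_distrib]
  let φ' : ∀ ij : P, ij ∈ S → P := fun ij hij =>
    (Fin.castLT ij.2 (lt_of_le_of_lt (Finset.mem_filter.mp hij).right (Fin.is_lt ij.1)), ij.1.succ)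
  apply Finset.sum_bij φ'
  · intro ij hij
    simp_rw [S, φ', Finset.compl_filter, Finset.mem_filter_univ, Fin.val_succ,
      Fin.val_castLT] at hij ⊢
    lia
  · rintro ⟨i, j⟩ hij ⟨i', j'⟩ hij' h
    have h₁ : (j : ℕ) = j' := congrArg (fun x : P => (x.1 : ℕ)) h
    have h₂ : i = i' := Fin.succ_injective _ (congrArg (fun x : P => x.2) h)
    exact Prod.ext h₂ (Fin.ext h₁)
  · rintro ⟨i, j⟩ hij'
    simp_rw [S, Finset.compl_filter, Finset.mem_filter_univ, not_le] at hij'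
    refine ⟨(j.pred ?_, i.castSucc), ?_, ?_⟩
    · rintro rfl
      simp only [Fin.val_zero, not_lt_zero] at hij'
    · simpa [S] using! Nat.le_sub_one_of_lt hij'
    · simp only [φ', Fin.castLT_castSucc, Fin.succ_pred]
  · rintro ⟨i, j⟩ hij
    have hji : (j : ℕ) ≤ i := by simpa [S] using! hij
    simp only [φ', Fin.val_succ, Fin.val_castLT]
    rw [key _ _ (by rw [Fin.le_def]; exact hji), Fin.castSucc_castLT, smul_smul, smul_smul,
      ← neg_smul]
    congr 1
    ring

variable (C) in
/-- The Hochschild complex `CC^{•,p}(C)`. -/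
noncomputable def hochschildComplex [Parity G] (p : G) : CochainComplex (ModuleCat.{max u v w} k) ℕ :=
  CochainComplex.of (fun n => ModuleCat.of k (CC C n p))
    (fun n => ModuleCat.ofHom ((hochschildD p n).restrict fun _ h => hochschildD_mem h))
    (fun n => by
      ext φ : 2
      exact Subtype.ext (hochschildD_hochschildD p n φ.1))

theorem hochschildComplex_d [Parity G] (p : G) (n : ℕ) :
    (hochschildComplex C p).d n (n + 1) =
      ModuleCat.ofHom ((hochschildD p n).restrict fun _ h => hochschildD_mem h) :=
  CochainComplex.of_d (fun n => ModuleCat.of k (CC C n p))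
    (fun n => ModuleCat.ofHom ((hochschildD p n).restrict fun _ h => hochschildD_mem h)) n

end NonunitalGradedPrecat

theorem mem_of_map_mem {ι : Type*} [DecidableEq ι] {M N : Type*} [AddCommGroup M] [Module k M] [AddCommGroup N] [Module k N]
    {A : ι → Submodule k M} {B : ι → Submodule k N} (hA : DirectSum.IsInternal A)
    (hB : DirectSum.IsInternal B) (T : M →ₗ[k] N) (hT : Function.Injective T)
    (hm : ∀ g, ∀ x ∈ A g, T x ∈ B g) {g : ι} {y : M} (hy : T y ∈ B g) : y ∈ A g := by
  let := hA.chooseDecomposition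
  let := hB.chooseDecomposition
  have key : ∀ x : M, T (DirectSum.decompose A x g) = DirectSum.decompose B (T x) g := by
    intro x
    induction x using DirectSum.Decomposition.inductionOn A with
    | zero => simp
    | @homogeneous i x =>
      by_cases h : i = g
      · subst h
        rw [DirectSum.decompose_of_mem_same A x.2, DirectSum.decompose_of_mem_same B (hm _ _ x.2)]
      · rw [DirectSum.decompose_of_mem_ne A x.2 h, DirectSum.decompose_of_mem_ne B (hm _ _ x.2) h,
          map_zero]
    | add x y hx hy => simp [hx, hy]
  have h := key y
  rw [DirectSum.decompose_of_mem_same B hy] at h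
  rw [← hT h]
  exact (DirectSum.decompose A y g).2

namespace GradedPrecat

open NonunitalGradedPrecat

variable {C : GradedPrecat.{u, v, w, t} k G}

/-- A property holds for all objects that are sufficiently transversal on the left. -/
def Ev (C : GradedPrecat.{u, v, w, t} k G) (P : C.Ob → Prop) : Prop :=
  ∃ S : List (List C.Ob), (∀ L ∈ S, L ≠ [] ∧ C.Tr L) ∧ ∀ Z, (∀ L ∈ S, C.Tr (Z :: L)) → P Z

theorem Ev.of_forall {P : C.Ob → Prop} (h : ∀ Z, P Z) : C.Ev P := ⟨[], by simp, fun Z _ => h Z⟩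

theorem Ev.and {P Q : C.Ob → Prop} (hP : C.Ev P) (hQ : C.Ev Q) : C.Ev fun Z => P Z ∧ Q Z := by
  obtain ⟨S, hS, h⟩ := hP
  obtain ⟨T, hT, h'⟩ := hQ
  refine ⟨S ++ T, fun L hL => ?_, fun Z hZ => ⟨h Z fun L hL => hZ L (by simp [hL]),
    h' Z fun L hL => hZ L (by simp [hL])⟩⟩
  obtain hL | hL := List.mem_append.1 hL
  exacts [hS L hL, hT L hL]

theorem Ev.mono {P Q : C.Ob → Prop} (hP : C.Ev P) (h : ∀ Z, P Z → Q Z) : C.Ev Q := by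
  obtain ⟨S, hS, h'⟩ := hP
  exact ⟨S, hS, fun Z hZ => h Z (h' Z hZ)⟩

theorem Ev.tr {L : List C.Ob} (h : C.Tr L) (h' : L ≠ []) : C.Ev fun Z => C.Tr (Z :: L) :=
  ⟨[L], by simpa using ⟨h', h⟩, fun Z hZ => by simpa using hZ⟩

theorem Ev.exists {P : C.Ob → Prop} (hP : C.Ev P) (X : C.Ob) :
    ∃ (Z : C.Ob) (s : C.Hom Z X), C.IsQuasiIso s ∧ P Z := by
  obtain ⟨S, hS, h⟩ := hP
  obtain ⟨Z, Z', s, s', hs, hs', hZ⟩ := C.extension S hS X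
  exact ⟨Z, s, hs, h Z fun L hL => C.tr_sublist (by simp) (hZ L hL)⟩

theorem bijective_left {X Y Z : C.Ob} {s : C.Hom X Y} (hs : C.IsQuasiIso s) (h : C.Tr [Z, X, Y]) :
    Function.Bijective (fun g : C.Hom Z X => C.comp g s) := by
  obtain ⟨A, B, _, _, _, _, H⟩ := C.extension [[X, Y]] (by simpa using hs.tr) X
  exact (hs.bijective Z B h (C.tr_sublist (by simp) (H [X, Y] (by simp)))).1

theorem bijective_right {X Y Z : C.Ob} {s : C.Hom X Y} (hs : C.IsQuasiIso s)
    (h : C.Tr [X, Y, Z]) : Function.Bijective (fun g : C.Hom Y Z => C.comp s g) := by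
  obtain ⟨A, B, _, _, _, _, H⟩ := C.extension [[X, Y]] (by simpa using hs.tr) X
  exact (hs.bijective A Z (C.tr_sublist (T := A :: ([X, Y] ++ [B])) (by simp) (H [X, Y] (by simp))) h).2

open Classical in
/-- The action of a formal expression on the morphisms from a fixed, sufficiently transversal
object. -/
noncomputable def act (Z : C.Ob) : ∀ {X Y : C.Ob}, C.Expr X Y → C.Hom Z X →ₗ[k] C.Hom Z Y
  | _, _, .of _ f => C.comp.flip f
  | X, Y, .inv s _ =>
    if h : Function.Bijective (C.comp.flip s : C.Hom Z Y →ₗ[k] C.Hom Z X) then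
      (LinearEquiv.ofBijective _ h).symm.toLinearMap else 0
  | _, _, .id _ => LinearMap.id
  | _, _, .comp a b => act Z b ∘ₗ act Z a
  | _, _, .zero _ _ => 0
  | _, _, .add a b => act Z a + act Z b
  | _, _, .smul r a => r • act Z a

theorem act_inv_comp {Z X Y : C.Ob} {s : C.Hom X Y} (hs : C.IsQuasiIso s) (h : C.Tr [Z, X, Y])
    (y : C.Hom Z Y) : C.comp (act Z (.inv s hs) y) s = y := by
  have hb : Function.Bijective (C.comp.flip s : C.Hom Z X →ₗ[k] C.Hom Z Y) := bijective_left hs h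
  rw [act, dif_pos hb]
  exact (LinearEquiv.ofBijective _ hb).apply_symm_apply y

theorem ev_act_eq {X Y : C.Ob} {a b : C.Expr X Y} (h : C.Rel a b) :
    C.Ev fun Z => act Z a = act Z b := by
  induction h with
  | add_comm => exact .of_forall fun Z => by simp only [act, add_comm]
  | add_assoc => exact .of_forall fun Z => by simp only [act, add_assoc]
  | zero_add => exact .of_forall fun Z => by simp only [act, zero_add]
  | neg_add => exact .of_forall fun Z => by simp [act]
  | smul_add => exact .of_forall fun Z => by simp only [act, smul_add]
  | add_smul => exact .of_forall fun Z => by simp only [act, add_smul]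
  | mul_smul => exact .of_forall fun Z => by simp only [act, mul_smul]
  | one_smul => exact .of_forall fun Z => by simp only [act, one_smul]
  | id_comp => exact .of_forall fun Z => by simp only [act, LinearMap.comp_id]
  | comp_id => exact .of_forall fun Z => by simp only [act, LinearMap.id_comp]
  | assoc => exact .of_forall fun Z => by simp only [act, LinearMap.comp_assoc]
  | add_comp => exact .of_forall fun Z => by simp only [act, LinearMap.comp_add]
  | comp_add => exact .of_forall fun Z => by simp only [act, LinearMap.add_comp]
  | smul_comp => exact .of_forall fun Z => by simp only [act, LinearMap.comp_smul]
  | comp_smul => exact .of_forall fun Z => by simp only [act, LinearMap.smul_comp]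
  | of_add => exact .of_forall fun Z => by simp only [act, map_add]
  | of_smul => exact .of_forall fun Z => by simp only [act, map_smul]
  | of_comp h h₁ h₂ h₃ f g =>
    refine (Ev.tr h (by simp)).mono fun Z hZ => ?_
    ext x
    simp only [act, LinearMap.flip_apply, LinearMap.comp_apply]
    exact (C.assoc hZ x f g).symm
  | of_inv s hs =>
    refine (Ev.tr hs.tr (by simp)).mono fun Z hZ => ?_
    ext x
    exact (bijective_left hs hZ).1 (act_inv_comp hs hZ _)
  | inv_of s hs =>
    refine (Ev.tr hs.tr (by simp)).mono fun Z hZ => ?_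
    ext x
    exact act_inv_comp hs hZ _
  | congr_comp_left b _ ih => exact ih.mono fun Z h => by simp only [act, h]
  | congr_comp_right a _ ih => exact ih.mono fun Z h => by simp only [act, h]
  | congr_add_left b _ ih => exact ih.mono fun Z h => by simp only [act, h]
  | congr_add_right a _ ih => exact ih.mono fun Z h => by simp only [act, h]
  | congr_smul r _ ih => exact ih.mono fun Z h => by simp only [act, h]

theorem ev_act_eq_of_mk {X Y : C.Ob} {a b : C.Expr X Y} (h : Full.mk a = Full.mk b) :
    C.Ev fun Z => act Z a = act Z b := by
  have := Quot.eqvGen_exact h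
  induction this with
  | rel _ _ hr => exact ev_act_eq hr
  | refl => exact .of_forall fun _ => rfl
  | symm _ _ _ ih => exact (ih (Quot.eqvGen_sound ‹_›)).mono fun _ h => h.symm
  | trans _ _ _ _ _ ih ih' =>
    exact ((ih (Quot.eqvGen_sound ‹_›)).and (ih' (Quot.eqvGen_sound ‹_›))).mono
      fun _ h => h.1.trans h.2

theorem ev_comp_mk {X Y : C.Ob} (a : C.Expr X Y) :
    C.Ev fun Z => ∀ (h : C.Tr [Z, X]) (h' : C.Tr [Z, Y]) (x : C.Hom Z X),
      Full.comp (Full.of h x) (Full.mk a) = Full.of h' (act Z a x) := by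
  induction a with
  | of hf f =>
    refine (Ev.tr hf (by simp)).mono fun Z hZ h h' x => ?_
    exact (Full.of_comp hZ h hf h' x f).symm
  | inv s hs =>
    refine (Ev.tr hs.tr (by simp)).mono fun Z hZ h h' x => ?_
    have e := Full.of_comp hZ h' hs.tr h (act Z (.inv s hs) x) s
    rw [act_inv_comp hs hZ] at e
    rw [e, Full.assoc]
    change Full.comp _ (Full.comp _ (Full.inv s hs)) = _
    rw [Full.of_inv, Full.comp_id]
  | id X => exact .of_forall fun Z h h' x => Full.comp_id _
  | @comp X Y W a b iha ihb =>
    refine ((iha.and ihb).and (Ev.tr (C.tr_singleton Y) (by simp))).mono ?_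
    rintro Z ⟨⟨ha, hb⟩, hY⟩ h h' x
    change Full.comp _ (Full.comp (Full.mk a) (Full.mk b)) = _
    rw [← Full.assoc, ha h hY, hb hY h']
    rfl
  | zero X Y =>
    refine .of_forall fun Z h h' x => ?_
    change Full.comp _ 0 = Full.of h' 0
    rw [map_zero, map_zero]
  | add a b iha ihb =>
    refine (iha.and ihb).mono ?_
    rintro Z ⟨ha, hb⟩ h h' x
    change Full.comp _ (Full.mk a + Full.mk b) = Full.of h' (act Z a x + act Z b x)
    rw [map_add, map_add, ha h h', hb h h']
  | smul r a ih =>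
    refine ih.mono fun Z ha h h' x => ?_
    change Full.comp _ (r • Full.mk a) = Full.of h' (r • act Z a x)
    rw [map_smul, map_smul, ha h h']

theorem mem_of_comp_left_mem {X Y Z : C.Ob} {s : C.Hom X Y} (hs : C.IsQuasiIso s)
    (h : C.Tr [Z, X, Y]) {x : C.Hom Z X} {g : G} (hx : C.comp x s ∈ C.gr Z Y g) :
    x ∈ C.gr Z X g :=
  mem_of_map_mem (C.isInternal Z X) (C.isInternal Z Y) (C.comp.flip s) (bijective_left hs h).1
    (fun g y hy => by simpa using C.comp_mem h hy hs.mem) hx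

theorem mem_of_comp_right_mem {X Y Z : C.Ob} {s : C.Hom X Y} (hs : C.IsQuasiIso s)
    (h : C.Tr [X, Y, Z]) {x : C.Hom Y Z} {g : G} (hx : C.comp s x ∈ C.gr X Z g) :
    x ∈ C.gr Y Z g :=
  mem_of_map_mem (C.isInternal Y Z) (C.isInternal X Z) (C.comp s) (bijective_right hs h).1
    (fun g y hy => by simpa using C.comp_mem h hs.mem hy) hx

theorem ev_act_mem {X Y : C.Ob} {a : C.Expr X Y} {g : G} (ha : C.IsHomog a g) :
    C.Ev fun Z => ∀ (g' : G), ∀ x ∈ C.gr Z X g', act Z a x ∈ C.gr Z Y (g' + g) := by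
  induction ha with
  | of h hf => exact (Ev.tr h (by simp)).mono fun Z hZ g' x hx => C.comp_mem hZ hx hf
  | inv s hs =>
    refine (Ev.tr hs.tr (by simp)).mono fun Z hZ g' x hx => mem_of_comp_left_mem hs hZ ?_
    rwa [act_inv_comp hs hZ, add_zero]
  | id X => exact .of_forall fun Z g' x hx => by simpa [act] using hx
  | comp _ _ iha ihb =>
    refine (iha.and ihb).mono ?_
    rintro Z ⟨ha, hb⟩ g' x hx
    rw [← add_assoc]
    exact hb _ _ (ha _ _ hx)
  | zero => exact .of_forall fun Z g' x hx => zero_mem _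
  | add _ _ iha ihb =>
    refine (iha.and ihb).mono ?_
    rintro Z ⟨ha, hb⟩ g' x hx
    exact add_mem (ha _ _ hx) (hb _ _ hx)
  | smul r _ ih => exact ih.mono fun Z ha g' x hx => Submodule.smul_mem _ _ (ha _ _ hx)

theorem of_bijective {X Y : C.Ob} (h : C.Tr [X, Y]) :
    Function.Bijective (Full.of h : C.Hom X Y →ₗ[k] C.Full X Y) := by
  constructor
  · intro f f' e
    obtain ⟨Z, s, hs, he, hZ⟩ := ((ev_act_eq_of_mk e).and (Ev.tr h (by simp))).exists X
    exact (bijective_right hs hZ).1 (LinearMap.congr_fun he s)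
  · rintro ⟨a⟩
    obtain ⟨Z, s, hs, he, hZ⟩ := ((ev_comp_mk a).and (Ev.tr h (by simp))).exists X
    have hZY : C.Tr [Z, Y] := C.tr_sublist (by simp) hZ
    obtain ⟨f, hf⟩ := (bijective_right hs hZ).2 (act Z a s)
    refine ⟨f, ?_⟩
    have e := he hs.tr hZY s
    rw [← hf, Full.of_comp hZ hs.tr h hZY] at e
    have e' := congrArg (Full.comp (Full.inv s hs)) e
    rw [← Full.assoc, ← Full.assoc, Full.inv_of, Full.id_comp, Full.id_comp] at e'
    exact e'.symm

theorem mem_of_of_mem {X Y : C.Ob} (h : C.Tr [X, Y]) {f : C.Hom X Y} {g : G}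
    (hf : Full.of h f ∈ Full.gr X Y g) : f ∈ C.gr X Y g := by
  obtain ⟨a, ha, e⟩ := hf
  obtain ⟨Z, s, hs, ⟨he, hm⟩, hZ⟩ :=
    (((ev_act_eq_of_mk (b := .of h f) e).and (ev_act_mem ha)).and (Ev.tr h (by simp))).exists X
  refine mem_of_comp_right_mem hs hZ ?_
  have := hm 0 s hs.mem
  rw [he, zero_add] at this
  exact this

end GradedPrecat

/-- Functors between graded pre-categories. As for the structure of a pre-category, the values of
`map` on non-transversal pairs are irrelevant. -/
structure GradedPrecat.PrecatFunctor (C D : GradedPrecat.{u, v, w, t} k G) where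
  /-- the map on objects -/
  obj : C.Ob → D.Ob
  tr : ∀ {S : List C.Ob}, C.Tr S → D.Tr (S.map obj)
  /-- the maps on morphisms -/
  map : ∀ {X Y : C.Ob}, C.Hom X Y →ₗ[k] D.Hom (obj X) (obj Y)
  map_mem : ∀ {X Y : C.Ob}, C.Tr [X, Y] → ∀ {g : G} {f : C.Hom X Y}, f ∈ C.gr X Y g →
    map f ∈ D.gr (obj X) (obj Y) g
  map_comp : ∀ {X Y Z : C.Ob}, C.Tr [X, Y, Z] → ∀ (f : C.Hom X Y) (g : C.Hom Y Z),
    map (C.comp f g) = D.comp (map f) (map g)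
  map_isQuasiIso : ∀ {X Y : C.Ob} {s : C.Hom X Y}, C.IsQuasiIso s → D.IsQuasiIso (map s)

namespace GradedPrecat.PrecatFunctor

open NonunitalGradedPrecat

variable {C D : GradedPrecat.{u, v, w, t} k G} (F : PrecatFunctor C D)

/-- A functor is fully faithful if it is bijective on the morphisms of transversal pairs. -/
def IsFullyFaithful : Prop :=
  ∀ X Y : C.Ob, C.Tr [X, Y] → Function.Bijective (F.map : C.Hom X Y →ₗ[k] _)

/-- A functor is an equivalence if it is fully faithful and each object `Y` of `D` is
quasi-isomorphic to some `F(X)`, that is, related to it by a chain of quasi-isomorphisms. -/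
structure IsEquivalence : Prop where
  isFullyFaithful : F.IsFullyFaithful
  exists_quasiIso : ∀ Y : D.Ob, ∃ X : C.Ob,
    Relation.EqvGen (fun A B : D.Ob => ∃ s : D.Hom A B, D.IsQuasiIso s) (F.obj X) Y

/-- The action of a functor on formal expressions. -/
def mapExpr : ∀ {X Y : C.Ob}, C.Expr X Y → D.Expr (F.obj X) (F.obj Y)
  | _, _, .of h f => .of (F.tr h) (F.map f)
  | _, _, .inv s hs => .inv (F.map s) (F.map_isQuasiIso hs)
  | _, _, .id X => .id (F.obj X)
  | _, _, .comp a b => .comp (mapExpr a) (mapExpr b)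
  | _, _, .zero X Y => .zero (F.obj X) (F.obj Y)
  | _, _, .add a b => .add (mapExpr a) (mapExpr b)
  | _, _, .smul r a => .smul r (mapExpr a)

theorem mapExpr_rel {X Y : C.Ob} {a b : C.Expr X Y} (h : C.Rel a b) :
    D.Rel (F.mapExpr a) (F.mapExpr b) := by
  induction h with
  | add_comm => exact .add_comm ..
  | add_assoc => exact .add_assoc ..
  | zero_add => exact .zero_add ..
  | neg_add => exact .neg_add ..
  | smul_add => exact .smul_add ..
  | add_smul => exact .add_smul ..
  | mul_smul => exact .mul_smul ..
  | one_smul => exact .one_smul ..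
  | id_comp => exact .id_comp ..
  | comp_id => exact .comp_id ..
  | assoc => exact .assoc ..
  | add_comp => exact .add_comp ..
  | comp_add => exact .comp_add ..
  | smul_comp => exact .smul_comp ..
  | comp_smul => exact .comp_smul ..
  | of_add h f g => rw [mapExpr, map_add]; exact .of_add ..
  | of_smul h r f => rw [mapExpr, map_smul]; exact .of_smul ..
  | of_comp h h₁ h₂ h₃ f g =>
    rw [mapExpr]
    simp only [F.map_comp h]
    exact .of_comp (F.tr h) ..
  | of_inv => exact .of_inv ..
  | inv_of => exact .inv_of ..
  | congr_comp_left b _ ih => exact .congr_comp_left _ ih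
  | congr_comp_right a _ ih => exact .congr_comp_right _ ih
  | congr_add_left b _ ih => exact .congr_add_left _ ih
  | congr_add_right a _ ih => exact .congr_add_right _ ih
  | congr_smul r _ ih => exact .congr_smul _ ih

/-- The induced functor `F_full : C_full → D_full` on morphisms. -/
def mapFull {X Y : C.Ob} : C.Full X Y →ₗ[k] D.Full (F.obj X) (F.obj Y) where
  toFun := Quot.map F.mapExpr (fun _ _ h => F.mapExpr_rel h)
  map_add' := by rintro ⟨a⟩ ⟨b⟩; rfl
  map_smul' := by rintro r ⟨a⟩; rfl

theorem mapFull_of {X Y : C.Ob} (h : C.Tr [X, Y]) (f : C.Hom X Y) :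
    F.mapFull (Full.of h f) = Full.of (F.tr h) (F.map f) := rfl

theorem mapFull_id (X : C.Ob) : F.mapFull (Full.id X) = Full.id (F.obj X) := rfl

theorem mapFull_comp {X Y Z : C.Ob} (a : C.Full X Y) (b : C.Full Y Z) :
    F.mapFull (Full.comp a b) = Full.comp (F.mapFull a) (F.mapFull b) := by
  obtain ⟨a⟩ := a; obtain ⟨b⟩ := b; rfl

theorem mapFull_comp₃ {X Y Z W : C.Ob} (a : C.Full X Y) (b : C.Full Y Z) (c : C.Full Z W) :
    F.mapFull (Full.comp₃ a b c) =
      Full.comp₃ (F.mapFull a) (F.mapFull b) (F.mapFull c) := by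
  simp only [Full.comp₃, mapFull_comp]

variable {F}

theorem exists_of_comp {X Y : C.Ob} (u : C.Full X Y) : ∃ (Z : C.Ob) (s : C.Hom Z X)
    (hs : C.IsQuasiIso s) (h : C.Tr [Z, Y]) (f : C.Hom Z Y),
    Full.comp (Full.of hs.tr s) u = Full.of h f := by
  obtain ⟨Z, s, hs, hZ⟩ := (Ev.tr (C.tr_singleton Y) (by simp)).exists X
  obtain ⟨f, hf⟩ := (of_bijective hZ).2 (Full.comp (Full.of hs.tr s) u)
  exact ⟨Z, s, hs, hZ, f, hf.symm⟩

theorem mapFull_bijective (hF : F.IsFullyFaithful) (X Y : C.Ob) :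
    Function.Bijective (F.mapFull : C.Full X Y →ₗ[k] _) := by
  constructor
  · rw [injective_iff_map_eq_zero]
    intro u hu
    obtain ⟨Z, s, hs, h, f, e⟩ := exists_of_comp u
    have e₁ := congrArg F.mapFull e
    rw [mapFull_comp, hu, map_zero, mapFull_of] at e₁
    have e₂ : F.map f = 0 := (of_bijective (F.tr h)).1 (by rw [map_zero]; exact e₁.symm)
    have e₃ : f = 0 := (hF Z Y h).1 (by rw [e₂, map_zero])
    rw [e₃, map_zero] at e
    have e₄ := congrArg (Full.comp (Full.inv s hs)) e
    rwa [← Full.assoc, Full.inv_of, Full.id_comp, map_zero] at e₄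
  · intro v
    obtain ⟨Z, s, hs, h⟩ := (Ev.tr (C.tr_singleton Y) (by simp)).exists X
    obtain ⟨f', hf'⟩ := (of_bijective (F.tr h)).2
      (Full.comp (Full.of (F.map_isQuasiIso hs).tr (F.map s)) v)
    obtain ⟨f, rfl⟩ := (hF Z Y h).2 f'
    refine ⟨Full.comp (Full.inv s hs) (Full.of h f), ?_⟩
    rw [mapFull_comp, mapFull_of]
    refine (congrArg _ hf').trans ?_
    change Full.comp (Full.inv (F.map s) (F.map_isQuasiIso hs)) _ = _
    rw [← Full.assoc, Full.inv_of, Full.id_comp]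

theorem mem_of_mapFull_mem (hF : F.IsFullyFaithful) {X Y : C.Ob} {u : C.Full X Y} {g : G}
    (hu : F.mapFull u ∈ Full.gr (F.obj X) (F.obj Y) g) : u ∈ Full.gr X Y g := by
  obtain ⟨Z, s, hs, h, f, e⟩ := exists_of_comp u
  have hs' := F.map_isQuasiIso hs
  have e₁ := congrArg F.mapFull e
  rw [mapFull_comp, mapFull_of, mapFull_of] at e₁
  have h₁ : Full.of (F.tr h) (F.map f) ∈ Full.gr (F.obj Z) (F.obj Y) g := by
    rw [← e₁]
    simpa using Full.comp_mem (Full.of_mem hs'.tr hs'.mem) hu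
  have h₂ : f ∈ C.gr Z Y g := mem_of_map_mem (C.isInternal Z Y) (D.isInternal _ _) F.map
    (hF Z Y h).1 (fun g y hy => F.map_mem h hy) (mem_of_of_mem _ h₁)
  have e₂ := congrArg (Full.comp (Full.inv s hs)) e
  rw [← Full.assoc, Full.inv_of, Full.id_comp] at e₂
  rw [e₂]
  simpa using Full.comp_mem (⟨_, .inv s hs, rfl⟩ : Full.inv s hs ∈ Full.gr X Z 0)
    (Full.of_mem h h₂)

/-- The isomorphism `Hom_{C_full}(X, Y) → Hom_{D_full}(F(X), F(Y))` that is induced by a fully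
faithful functor. -/
noncomputable def fullEquiv (hF : F.IsFullyFaithful) (X Y : C.Ob) :
    C.Full X Y ≃ₗ[k] D.Full (F.obj X) (F.obj Y) :=
  LinearEquiv.ofBijective F.mapFull (mapFull_bijective hF X Y)

variable (F) in
/-- The image of a transversal sequence. -/
def mapSeq {n : ℕ} (X : C.TrSeq n) : D.TrSeq n where
  obj i := F.obj (X.obj i)
  tr := by
    have := F.tr X.tr
    rwa [List.map_ofFn] at this

variable (F) in
/-- The image of a string of composable morphisms. -/
def mapStr {n : ℕ} (X : C.TrSeq n) (a : X.Str) : (F.mapSeq X).Str := fun l => F.map (a l)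

theorem seg_mapStr {n : ℕ} (X : C.TrSeq n) (a : X.Str) (i j : Fin (n + 1)) (h : i < j) :
    (F.mapSeq X).seg (F.mapStr X a) i j h = F.map (X.seg a i j h) := by
  refine TrSeq.seg_induction (P := fun i j h =>
    (F.mapSeq X).seg (F.mapStr X a) i j h = F.map (X.seg a i j h)) ?_ ?_ i j h
  · intro l
    rw [TrSeq.seg_castSucc_succ, TrSeq.seg_castSucc_succ]; rfl
  · intro i l h ih
    rw [TrSeq.seg_succ_of_lt _ _ _ _ h, TrSeq.seg_succ_of_lt _ _ _ _ h, ih]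
    exact (F.map_comp (X.tr_three h l.castSucc_lt_succ) _ _).symm

theorem prod_mapStr {n : ℕ} (X : C.TrSeq n) (a : X.Str) (i j : Fin (n + 1)) (h : i ≤ j) :
    (F.mapSeq X).prod (F.mapStr X a) i j = F.mapFull (X.prod a i j) := by
  obtain rfl | h := h.eq_or_lt
  · rw [TrSeq.prod_self, TrSeq.prod_self]; rfl
  · rw [TrSeq.prod_of_lt _ _ h, TrSeq.prod_of_lt _ _ h, seg_mapStr]; rfl

theorem comapStr_mapStr {m n : ℕ} (f : Fin (m + 1) ↪o Fin (n + 1)) (X : C.TrSeq n) (a : X.Str) :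
    (F.mapSeq X).comapStr f (F.mapStr X a) = F.mapStr (X.comap f) (X.comapStr f a) := by
  funext l
  exact seg_mapStr X a _ _ _

theorem twist_map [Parity G] (p : G) {X Y : C.Ob} (h : C.Tr [X, Y]) (f : C.Hom X Y) :
    twist p _ _ (F.map f) = F.map (twist p X Y f) := by
  induction f using hom_induction with
  | h₀ => simp
  | h₂ f₁ f₂ h₁ h₂ => simp only [map_add, h₁, h₂]
  | h₁ g f hf => rw [twist_of_mem p hf, twist_of_mem p (F.map_mem h hf), map_zsmul]

theorem twistStr_mapStr [Parity G] (p : G) {n : ℕ} (X : C.TrSeq n) (a : X.Str) :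
    (F.mapSeq X).twistStr p (F.mapStr X a) = F.mapStr X (X.twistStr p a) := by
  funext l
  exact twist_map p (X.tr_two l.castSucc_lt_succ) (a l)

/-- The pullback `F^*` on cochains: for `φ` a cochain of `D`, the value of `F^* φ` at
`(a_n, …, a_1)` is the element of `Hom_{C_full}(X_0, X_n)` that `F_full` sends to
`φ(F(a_n), …, F(a_1))`. -/
noncomputable def pullback (hF : F.IsFullyFaithful) (n : ℕ) : D.Coch n →ₗ[k] C.Coch n where
  toFun φ X := (fullEquiv hF (X.obj 0) (X.obj (Fin.last n))).symm.toLinearMap.compMultilinearMap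
    (MultilinearMap.compLinearMap (φ (F.mapSeq X))
      (fun l : Fin n => (F.map : C.Hom (X.obj l.castSucc) (X.obj l.succ) →ₗ[k] _)))
  map_add' φ ψ := by
    funext X; ext a
    exact map_add (fullEquiv hF (X.obj 0) (X.obj (Fin.last n))).symm _ _
  map_smul' r φ := by
    funext X; ext a
    exact map_smul (fullEquiv hF (X.obj 0) (X.obj (Fin.last n))).symm _ _

theorem mapFull_pullback (hF : F.IsFullyFaithful) {n : ℕ} (φ : D.Coch n) (X : C.TrSeq n)
    (a : X.Str) : F.mapFull (pullback hF n φ X a) = φ (F.mapSeq X) (F.mapStr X a) :=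
  (fullEquiv hF (X.obj 0) (X.obj (Fin.last n))).apply_symm_apply _

theorem pullback_mem (hF : F.IsFullyFaithful) {n : ℕ} {p : G} {φ : D.Coch n}
    (hφ : φ ∈ CC D.toNonunitalGradedPrecat n p) :
    pullback hF n φ ∈ CC C.toNonunitalGradedPrecat n p := by
  intro X a d ha
  refine mem_of_mapFull_mem hF ?_
  rw [mapFull_pullback]
  exact hφ (F.mapSeq X) (F.mapStr X a) d
    fun l => F.map_mem (X.tr_two l.castSucc_lt_succ) (ha l)

theorem pullback_transport [Parity G] (hF : F.IsFullyFaithful) (p : G) {m n : ℕ}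
    (f : Fin (m + 1) ↪o Fin (n + 1)) (φ : D.Coch m) :
    pullback hF n (transport p f φ) = transport p f (pullback hF m φ) := by
  funext X
  ext a
  refine (mapFull_bijective hF _ _).1 ?_
  rw [mapFull_pullback]
  have h₁ := prod_mapStr (F := F) X a 0 (f 0) (Fin.zero_le _)
  have h₂ := prod_mapStr (F := F) X (X.twistStr p a) (f (Fin.last m)) (Fin.last n) (Fin.le_last _)
  have h₃ := mapFull_pullback hF φ (X.comap f) (X.comapStr f a)
  rw [← twistStr_mapStr] at h₂
  rw [← comapStr_mapStr] at h₃
  change Full.comp₃ ((F.mapSeq X).prod (F.mapStr X a) 0 (f 0))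
    (φ ((F.mapSeq X).comap f) ((F.mapSeq X).comapStr f (F.mapStr X a)))
    ((F.mapSeq X).prod ((F.mapSeq X).twistStr p (F.mapStr X a)) (f (Fin.last m)) (Fin.last n)) =
    F.mapFull (Full.comp₃ (X.prod a 0 (f 0)) (pullback hF m φ (X.comap f) (X.comapStr f a))
      (X.prod (X.twistStr p a) (f (Fin.last m)) (Fin.last n)))
  rw [h₁, h₂]
  refine Eq.trans ?_ (mapFull_comp₃ ..).symm
  exact congrArg (fun x => Full.comp₃ _ x _) h₃.symm

theorem pullback_hochschildD [Parity G] (hF : F.IsFullyFaithful) (p : G) (n : ℕ) (φ : D.Coch n) :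
    pullback hF (n + 1) (hochschildD p n φ) = hochschildD p n (pullback hF n φ) := by
  simp only [hochschildD, LinearMap.sum_apply, LinearMap.smul_apply, map_sum, map_zsmul,
    pullback_transport]

/-- The morphism of complexes `F^* : CC^{•,p}(D) → CC^{•,p}(C)` that is induced by a fully faithful
functor `F : C → D`. -/
noncomputable def pullbackHom [Parity G] (hF : F.IsFullyFaithful) (p : G) :
    hochschildComplex D.toNonunitalGradedPrecat p ⟶ hochschildComplex C.toNonunitalGradedPrecat p :=
  CochainComplex.ofHom
    (fun n => ModuleCat.ofHom ((pullback hF n).restrict fun _ h => pullback_mem hF h))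
    (fun n => by
      rw [hochschildComplex_d, hochschildComplex_d]
      ext φ : 2
      exact Subtype.ext (pullback_hochschildD hF p n φ.1).symm)

end GradedPrecat.PrecatFunctor

end

/-! The theorem is an instance of the comparison theorem for projective resolutions. For a functor
`F : C → D`, let `Bar F n A B` be the direct sum, over the transversal sequences `(X_0, …, X_n)` of
`C`, of `D_full(A, F X_0) ⊗ C(X_0, X_1) ⊗ … ⊗ C(X_{n-1}, X_n) ⊗ D_full(F X_n, B)`. These spaces form
a complex of graded `D_full`-bimodules, augmented over the diagonal bimodule `D_full`.

If `F` is fully faithful, the cochains in `CC^{n,p}(C)` are the same as the degree-zero bimodule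
morphisms from `Bar F n` to `twistedBimod D p`, which is `D_full` shifted by `p` with the Koszul
sign put on the right action (`Bar.eval_cochain`, `Bar.eval_injective`). Under this identification
the Hochschild differential is precomposition with the bar differential (`Bar.eval_hochschildD`),
and `F^*` is precomposition with the inclusion of `Bar F` into `Bar (refl D)` (`Bar.eval_pullback`).

Each `Bar F n` is projective, because it is freely generated by graded vector spaces over a field
(`exists_hom_lift`). If `F` is an equivalence, the augmented complex is exact (`exists_aug_eq`,
`Bar.exists_d_zero_eq`, `Bar.exists_d_eq`). Indeed, a given chain involves only finitely many
transversal sequences, so there is an object `A'` that can be put in front of all of them and for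
which `F A'` is isomorphic to `A` in `D_full` (`exists_transversal`). Inserting `A'` is the usual
contraction of a bar complex. It need not be defined on the whole complex, since one object need not
be transversal to everything, but exactness only requires it for one chain at a time.

Hence `Bar F` and `Bar (refl D)` are projective resolutions of the same bimodule, and the inclusion
between them is a homotopy equivalence of complexes of bimodules (`exists_homotopyEquiv`).
Precomposing cochains with the homotopy inverse and with the homotopies gives surjectivity and
injectivity of `F^*` on cohomology. -/

section

variable {k : Type w} [Field k] {G : Type t} [AddCommGroup G] [DecidableEq G]

/-! ### The sign automorphism of the localized category -/

namespace NonunitalGradedPrecat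

variable {C : NonunitalGradedPrecat.{u, v, w, t} k G}

/-- Quasi-isomorphisms have degree zero, so their sign is trivial. This allows the sign automorphism
to extend to `C_full` by fixing the formal inverses. -/
theorem twist_of_isQuasiIso [Parity G] (p : G) {X Y : C.Ob} {s : C.Hom X Y}
    (hs : C.IsQuasiIso s) : twist p X Y s = s := by
  rw [twist_of_mem p hs.mem, koszulSign_zero, one_smul]

/-- The sign `(-1) ^ (p * deg)` on formal expressions. -/
noncomputable def twistExpr [Parity G] (p : G) : ∀ {X Y : C.Ob}, C.Expr X Y → C.Expr X Y
  | _, _, .of h f => .of h (twist p _ _ f)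
  | _, _, .inv s hs => .inv s hs
  | _, _, .id X => .id X
  | _, _, .comp a b => .comp (twistExpr p a) (twistExpr p b)
  | _, _, .zero X Y => .zero X Y
  | _, _, .add a b => .add (twistExpr p a) (twistExpr p b)
  | _, _, .smul r a => .smul r (twistExpr p a)

/-- The sign is linear, multiplicative on transversal triples and trivial on quasi-isomorphisms;
these are the properties that the relations of the localization test. -/
theorem twistExpr_rel [Parity G] (p : G) {X Y : C.Ob} {a b : C.Expr X Y} (h : C.Rel a b) :
    C.Rel (twistExpr p a) (twistExpr p b) := by
  induction h with
  | add_comm => exact .add_comm ..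
  | add_assoc => exact .add_assoc ..
  | zero_add => exact .zero_add ..
  | neg_add => exact .neg_add ..
  | smul_add => exact .smul_add ..
  | add_smul => exact .add_smul ..
  | mul_smul => exact .mul_smul ..
  | one_smul => exact .one_smul ..
  | id_comp => exact .id_comp ..
  | comp_id => exact .comp_id ..
  | assoc => exact .assoc ..
  | add_comp => exact .add_comp ..
  | comp_add => exact .comp_add ..
  | smul_comp => exact .smul_comp ..
  | comp_smul => exact .comp_smul ..
  | of_add h f g => rw [twistExpr, map_add]; exact .of_add ..
  | of_smul h r f => rw [twistExpr, map_smul]; exact .of_smul ..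
  | of_comp h h₁ h₂ h₃ f g => rw [twistExpr, twist_comp p h]; exact .of_comp h ..
  | of_inv s hs => simp only [twistExpr, twist_of_isQuasiIso p hs]; exact .of_inv ..
  | inv_of s hs => simp only [twistExpr, twist_of_isQuasiIso p hs]; exact .inv_of ..
  | congr_comp_left b _ ih => exact .congr_comp_left _ ih
  | congr_comp_right a _ ih => exact .congr_comp_right _ ih
  | congr_add_left b _ ih => exact .congr_add_left _ ih
  | congr_add_right a _ ih => exact .congr_add_right _ ih
  | congr_smul r _ ih => exact .congr_smul _ ih

theorem isHomog_twistExpr [Parity G] (p : G) {X Y : C.Ob} {a : C.Expr X Y} {g : G}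
    (h : C.IsHomog a g) : C.IsHomog (twistExpr p a) g := by
  induction h with
  | of h hf => exact .of h (twist_mem p hf)
  | inv => exact .inv ..
  | id => exact .id _
  | comp _ _ ih ih' => exact .comp ih ih'
  | zero => exact .zero ..
  | add _ _ ih ih' => exact .add ih ih'
  | smul r _ ih => exact .smul r ih

theorem twist_zero [Parity G] {X Y : C.Ob} (f : C.Hom X Y) : twist (0 : G) X Y f = f := by
  induction f using hom_induction with
  | h₀ => simp
  | h₂ f₁ f₂ h₁ h₂ => simp [h₁, h₂]
  | h₁ g f hf => rw [twist_of_mem 0 hf]; simp [koszulSign]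

theorem twistExpr_zero [Parity G] {X Y : C.Ob} (a : C.Expr X Y) : twistExpr (0 : G) a = a := by
  induction a with
  | of h f => rw [twistExpr, twist_zero]
  | inv => rfl
  | id => rfl
  | comp a b ha hb => rw [twistExpr, ha, hb]
  | zero => rfl
  | add a b ha hb => rw [twistExpr, ha, hb]
  | smul r a ha => rw [twistExpr, ha]

namespace Full

/-- The sign `(-1) ^ (p * deg)` on the morphisms of `C_full`. -/
noncomputable def twist [Parity G] (p : G) {X Y : C.Ob} : C.Full X Y →ₗ[k] C.Full X Y where
  toFun := Quot.map (twistExpr p) (fun _ _ h => twistExpr_rel p h)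
  map_add' := by rintro ⟨a⟩ ⟨b⟩; rfl
  map_smul' := by rintro r ⟨a⟩; rfl

theorem twist_id [Parity G] (p : G) (X : C.Ob) : twist p (id X) = id X := rfl

theorem twist_comp [Parity G] (p : G) {X Y Z : C.Ob} (a : C.Full X Y) (b : C.Full Y Z) :
    twist p (comp a b) = comp (twist p a) (twist p b) := by
  obtain ⟨a⟩ := a; obtain ⟨b⟩ := b; rfl

/-- For `p = 0` the twisted bimodule is therefore the plain diagonal bimodule, which is the target
of the augmentation. -/
theorem twist_zero [Parity G] {X Y : C.Ob} (a : C.Full X Y) : twist (0 : G) a = a := by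
  obtain ⟨a⟩ := a
  exact congrArg (Quot.mk _) (twistExpr_zero a)

theorem twist_mem [Parity G] (p : G) {X Y : C.Ob} {a : C.Full X Y} {g : G} (h : a ∈ gr X Y g) :
    twist p a ∈ gr X Y g := by
  obtain ⟨a, ha, rfl⟩ := h
  exact ⟨_, isHomog_twistExpr p ha, rfl⟩

end Full

/-- In `transport` the sign sits on the individual morphisms of a string. Here it is moved to their
composite in `C_full`, which is where the right action of `twistedBimod` produces it. -/
theorem TrSeq.twist_prod [Parity G] (p : G) {n : ℕ} (X : C.TrSeq n) (a : X.Str)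
    {i j : Fin (n + 1)} (h : i ≤ j) :
    Full.twist p (X.prod a i j) = X.prod (X.twistStr p a) i j := by
  obtain rfl | h := h.eq_or_lt
  · rw [prod_self, prod_self, Full.twist_id]
  · rw [prod_of_lt _ _ h, prod_of_lt _ _ h, seg_twistStr]; rfl

end NonunitalGradedPrecat

/-! ### Functors, signs and degrees; graded bimodules over `D_full` -/

namespace GradedPrecat

open NonunitalGradedPrecat

theorem PrecatFunctor.mapFull_twist [Parity G] {C D : GradedPrecat.{u, v, w, t} k G}
    (F : PrecatFunctor C D) (p : G) {X Y : C.Ob} (a : C.Full X Y) :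
    F.mapFull (Full.twist p a) = Full.twist p (F.mapFull a) := by
  obtain ⟨e⟩ := a
  refine congrArg (Quot.mk _) ?_
  clear * -
  induction e with
  | of h f => simp only [mapExpr, twistExpr]; rw [twist_map p h]
  | inv => rfl
  | id => rfl
  | comp a b ha hb => simp only [mapExpr, twistExpr, ha, hb]
  | zero => rfl
  | add a b ha hb => simp only [mapExpr, twistExpr, ha, hb]
  | smul r a ha => simp only [mapExpr, twistExpr, ha]

theorem PrecatFunctor.mapFull_mem {C D : GradedPrecat.{u, v, w, t} k G}
    (F : PrecatFunctor C D) {X Y : C.Ob} {a : C.Full X Y} {g : G} (h : a ∈ Full.gr X Y g) :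
    F.mapFull a ∈ Full.gr (F.obj X) (F.obj Y) g := by
  obtain ⟨a, ha, rfl⟩ := h
  refine ⟨F.mapExpr a, ?_, rfl⟩
  induction ha with
  | of h hf => exact .of (F.tr h) (F.map_mem h hf)
  | inv => exact .inv ..
  | id => exact .id _
  | comp _ _ ih ih' => exact .comp ih ih'
  | zero => exact .zero ..
  | add _ _ ih ih' => exact .add ih ih'
  | smul r _ ih => exact .smul r ih

/-- Graded bimodules over `D_full`. -/
structure Bimod (D : GradedPrecat.{u, v, w, t} k G) where
  /-- the underlying vector spaces -/
  carrier : D.Ob → D.Ob → Type (max u v w)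
  [addCommGroup : ∀ A B, AddCommGroup (carrier A B)]
  [module : ∀ A B, Module k (carrier A B)]
  /-- the two-sided action -/
  act : ∀ {A' A B B' : D.Ob}, D.Full A' A → D.Full B B' → carrier A B →ₗ[k] carrier A' B'
  -- Additivity and homogeneity are joined in one axiom with two scalars, to match the relations
  -- `Cell.IsComb` of the bar construction.
  act_left : ∀ {A' A B B' : D.Ob} (r s : k) (a a' : D.Full A' A) (b : D.Full B B')
    (x : carrier A B), act (r • a + s • a') b x = r • act a b x + s • act a' b x
  act_right : ∀ {A' A B B' : D.Ob} (r s : k) (a : D.Full A' A) (b b' : D.Full B B')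
    (x : carrier A B), act a (r • b + s • b') x = r • act a b x + s • act a b' x
  act_act : ∀ {A'' A' A B B' B'' : D.Ob} (a' : D.Full A'' A') (a : D.Full A' A) (b : D.Full B B')
    (b' : D.Full B' B'') (x : carrier A B),
    act a' b' (act a b x) = act (Full.comp a' a) (Full.comp b b') x
  act_id : ∀ {A B : D.Ob} (x : carrier A B), act (Full.id A) (Full.id B) x = x
  /-- the homogeneous components -/
  gr : ∀ A B, G → Submodule k (carrier A B)
  act_mem : ∀ {A' A B B' : D.Ob} {g h i : G} {a : D.Full A' A} {b : D.Full B B'}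
    {x : carrier A B}, a ∈ Full.gr A' A g → b ∈ Full.gr B B' h → x ∈ gr A B i →
    act a b x ∈ gr A' B' (g + i + h)

attribute [instance] Bimod.addCommGroup Bimod.module

/-- Morphisms of graded bimodules, of degree zero. -/
structure Bimod.Hom {D : GradedPrecat.{u, v, w, t} k G} (M N : Bimod D) where
  /-- the underlying linear maps -/
  app : ∀ {A B : D.Ob}, M.carrier A B →ₗ[k] N.carrier A B
  app_act : ∀ {A' A B B' : D.Ob} (a : D.Full A' A) (b : D.Full B B') (x : M.carrier A B),
    app (M.act a b x) = N.act a b (app x)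
  app_mem : ∀ {A B : D.Ob} {g : G} {x : M.carrier A B}, x ∈ M.gr A B g → app x ∈ N.gr A B g

namespace Bimod.Hom

variable {D : GradedPrecat.{u, v, w, t} k G} {L M N : Bimod D}

/-- The identity. -/
noncomputable def id (M : Bimod D) : Hom M M where
  app := LinearMap.id
  app_act _ _ _ := rfl
  app_mem h := h

/-- Composition, in diagrammatic order. -/
noncomputable def comp (f : Hom L M) (g : Hom M N) : Hom L N where
  app := g.app ∘ₗ f.app
  app_act a b x := by simp [f.app_act, g.app_act]
  app_mem h := g.app_mem (f.app_mem h)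

/-- The difference of two morphisms. -/
noncomputable def sub (f g : Hom M N) : Hom M N where
  app := f.app - g.app
  app_act a b x := by simp [f.app_act, g.app_act]
  app_mem h := sub_mem (f.app_mem h) (g.app_mem h)

end Bimod.Hom

/-- The bimodule `D_full`, shifted by `p` and with the right action twisted by the sign
`(-1) ^ (p * deg)`. -/
noncomputable def twistedBimod [Parity G] (D : GradedPrecat.{u, v, w, t} k G) (p : G) : Bimod D where
  carrier A B := D.Full A B
  -- Only the right action carries the sign. Composition is diagrammatic, so the morphism `a_{n+1}`,
  -- whose term in the Hochschild differential has the sign `(-1)^{p deg a_{n+1}}`, acts on the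
  -- right.
  act a b :=
    { toFun := fun x => Full.comp₃ a x (Full.twist p b)
      map_add' := fun x y => Full.comp₃_add_mid ..
      map_smul' := fun r x => Full.comp₃_smul_mid .. }
  act_left r s a a' b x := Full.comp₃_left ..
  act_right r s a b b' x := by
    change Full.comp₃ a x (Full.twist p (r • b + s • b')) = _
    rw [map_add, map_smul, map_smul]
    exact Full.comp₃_right ..
  act_act a' a b b' x := by
    change Full.comp₃ a' (Full.comp₃ a x (Full.twist p b)) (Full.twist p b') = Full.comp₃ _ _ _
    rw [Full.comp₃_comp₃, Full.twist_comp]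
  act_id x := by
    change Full.comp (Full.id _) (Full.comp x (Full.id _)) = x
    rw [Full.id_comp, Full.comp_id]
  -- With this shift, cochains of degree `p` become bimodule morphisms of degree zero.
  gr A B g := Full.gr A B (p + g)
  act_mem {_ _ _ _ g h i a b x} ha hb hx := by
    have := Full.comp_mem ha (Full.comp_mem hx (Full.twist_mem p hb))
    have e : g + (p + i + h) = p + (g + i + h) := by abel
    rwa [e] at this

end GradedPrecat

/-! ### The bar construction, presented by cells modulo multilinearity -/

namespace GradedPrecat.PrecatFunctor

open NonunitalGradedPrecat

variable {C D : GradedPrecat.{u, v, w, t} k G} (F : PrecatFunctor C D)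

/-- Generators of the bar construction. -/
structure Cell (n : ℕ) (A B : D.Ob) where
  /-- the transversal sequence -/
  seq : C.TrSeq n
  /-- the coefficient on the left -/
  left : D.Full A (F.obj (seq.obj 0))
  /-- the string of morphisms -/
  str : seq.Str
  /-- the coefficient on the right -/
  right : D.Full (F.obj (seq.obj (Fin.last n))) B

/-- A cell is, in one of its entries, a linear combination of two others. -/
inductive Cell.IsComb {n : ℕ} {A B : D.Ob} (r s : k) :
    F.Cell n A B → F.Cell n A B → F.Cell n A B → Prop
  | left (X : C.TrSeq n) (x y : D.Full A (F.obj (X.obj 0))) (a : X.Str)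
      (z : D.Full (F.obj (X.obj (Fin.last n))) B) :
      IsComb r s ⟨X, r • x + s • y, a, z⟩ ⟨X, x, a, z⟩ ⟨X, y, a, z⟩
  | str (X : C.TrSeq n) (x : D.Full A (F.obj (X.obj 0))) {l : Fin n} {a b c : X.Str}
      (H : TrSeq.IsComb l r s a b c) (z : D.Full (F.obj (X.obj (Fin.last n))) B) :
      IsComb r s ⟨X, x, a, z⟩ ⟨X, x, b, z⟩ ⟨X, x, c, z⟩
  | right (X : C.TrSeq n) (x : D.Full A (F.obj (X.obj 0))) (a : X.Str)
      (y z : D.Full (F.obj (X.obj (Fin.last n))) B) :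
      IsComb r s ⟨X, x, a, r • y + s • z⟩ ⟨X, x, a, y⟩ ⟨X, x, a, z⟩

/-- The relations of the bar construction. -/
noncomputable def barRel (n : ℕ) (A B : D.Ob) : Submodule k (F.Cell n A B →₀ k) :=
  Submodule.span k {x | ∃ (r s : k) (c c₁ c₂ : F.Cell n A B), Cell.IsComb F r s c c₁ c₂ ∧
    x = Finsupp.single c 1 - (r • Finsupp.single c₁ 1 + s • Finsupp.single c₂ 1)}

/-- The bar construction: the direct sum, over the transversal sequences `(X_0, …, X_n)` of `C`, of
`Hom_{D_full}(A, F(X_0)) ⊗ Hom_C(X_0, X_1) ⊗ … ⊗ Hom_C(X_{n-1}, X_n) ⊗ Hom_{D_full}(F(X_n), B)`. -/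
abbrev Bar (n : ℕ) (A B : D.Ob) : Type (max u v w) := (F.Cell n A B →₀ k) ⧸ F.barRel n A B

namespace Bar

variable {F} {n : ℕ} {A B : D.Ob}

/-- The class of a cell. -/
noncomputable def mk (c : F.Cell n A B) : F.Bar n A B :=
  (F.barRel n A B).mkQ (Finsupp.single c 1)

theorem mk_comb {r s : k} {c c₁ c₂ : F.Cell n A B} (h : Cell.IsComb F r s c c₁ c₂) :
    mk c = r • mk c₁ + s • mk c₂ := by
  unfold mk
  rw [← map_smul, ← map_smul, ← map_add, ← sub_eq_zero, ← map_sub]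
  exact (Submodule.Quotient.mk_eq_zero _).2 (Submodule.subset_span ⟨r, s, c, c₁, c₂, h, rfl⟩)

variable {V : Type*} [AddCommGroup V] [Module k V]

/-- The universal property of the bar construction. -/
noncomputable def lift (φ : F.Cell n A B → V)
    (h : ∀ {r s : k} {c c₁ c₂ : F.Cell n A B}, Cell.IsComb F r s c c₁ c₂ →
      φ c = r • φ c₁ + s • φ c₂) : F.Bar n A B →ₗ[k] V :=
  (F.barRel n A B).liftQ (Finsupp.linearCombination k φ) <| Submodule.span_le.2 <| by
    rintro _ ⟨r, s, c, c₁, c₂, hc, rfl⟩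
    simp [h hc]

theorem lift_mk (φ : F.Cell n A B → V)
    (h : ∀ {r s : k} {c c₁ c₂ : F.Cell n A B}, Cell.IsComb F r s c c₁ c₂ →
      φ c = r • φ c₁ + s • φ c₂) (c : F.Cell n A B) : lift φ h (mk c) = φ c := by
  refine (Submodule.liftQ_apply _ _ _).trans ?_
  simp

theorem span_mk : Submodule.span k (Set.range (mk : F.Cell n A B → F.Bar n A B)) = ⊤ := by
  have : Set.range (mk : F.Cell n A B → F.Bar n A B) =
      (F.barRel n A B).mkQ '' Set.range (fun c => Finsupp.single c (1 : k)) := by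
    rw [← Set.range_comp]; rfl
  rw [this, Submodule.span_image]
  have h : Submodule.span k (Set.range fun c : F.Cell n A B => Finsupp.single c (1 : k)) = ⊤ := by
    have := (Finsupp.basisSingleOne (R := k) (ι := F.Cell n A B)).span_eq
    simpa using this
  rw [h, Submodule.map_top, Submodule.range_mkQ]

theorem hom_ext {f g : F.Bar n A B →ₗ[k] V} (h : ∀ c, f (mk c) = g (mk c)) : f = g :=
  LinearMap.ext_on_range span_mk h

end Bar

variable {F} in
/-- The action on cells. -/
def Cell.act {n : ℕ} {A' A B B' : D.Ob} (a : D.Full A' A) (b : D.Full B B') (c : F.Cell n A B) :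
    F.Cell n A' B' := ⟨c.seq, Full.comp a c.left, c.str, Full.comp c.right b⟩

variable {F} in
theorem Cell.IsComb.act {n : ℕ} {A' A B B' : D.Ob} (a : D.Full A' A) (b : D.Full B B') {r s : k}
    {c c₁ c₂ : F.Cell n A B} (h : Cell.IsComb F r s c c₁ c₂) :
    Cell.IsComb F r s (c.act a b) (c₁.act a b) (c₂.act a b) := by
  cases h with
  | left X x y a' z =>
    simp only [Cell.act, map_add, map_smul]; exact .left ..
  | str X x H z => exact .str _ _ H _
  | right X x a' y z =>
    simp only [Cell.act, map_add, map_smul, LinearMap.add_apply, LinearMap.smul_apply]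
    exact .right ..

variable {F} in
/-- Cells all of whose entries are homogeneous, of total degree `g`. -/
def Cell.IsHomog {n : ℕ} {A B : D.Ob} (c : F.Cell n A B) (g : G) : Prop :=
  -- The degrees are recorded by a potential: `e i` is the total degree of everything to the left of
  -- `X_i`. Composites of consecutive entries then have the difference of two values of `e` as their
  -- degree.
  ∃ e : Fin (n + 1) → G, c.left ∈ Full.gr _ _ (e 0) ∧
    (∀ l : Fin n, c.str l ∈ C.gr _ _ (e l.succ - e l.castSucc)) ∧
    c.right ∈ Full.gr _ _ (g - e (Fin.last n))

variable {F} in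
/-- The two-sided action on the bar construction. -/
noncomputable def Bar.act {n : ℕ} {A' A B B' : D.Ob} (a : D.Full A' A) (b : D.Full B B') :
    F.Bar n A B →ₗ[k] F.Bar n A' B' :=
  Bar.lift (fun c => Bar.mk (c.act a b)) fun h => Bar.mk_comb (h.act a b)

variable {F} in
theorem Bar.act_mk {n : ℕ} {A' A B B' : D.Ob} (a : D.Full A' A) (b : D.Full B B')
    (c : F.Cell n A B) : Bar.act a b (Bar.mk c) = Bar.mk (c.act a b) :=
  Bar.lift_mk _ (fun h => Bar.mk_comb (h.act a b)) c

/-- The homogeneous components of the bar construction. -/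
noncomputable def Bar.gr (n : ℕ) (A B : D.Ob) (g : G) : Submodule k (F.Bar n A B) :=
  Submodule.span k {x | ∃ c : F.Cell n A B, c.IsHomog g ∧ Bar.mk c = x}

variable {F} in
theorem Bar.mk_mem_gr {n : ℕ} {A B : D.Ob} {c : F.Cell n A B} {g : G} (h : c.IsHomog g) :
    Bar.mk c ∈ Bar.gr F n A B g :=
  Submodule.subset_span ⟨c, h, rfl⟩

variable {F} in
theorem Bar.map_gr_le {n : ℕ} {A B : D.Ob} {V : Type*} [AddCommGroup V] [Module k V]
    (f : F.Bar n A B →ₗ[k] V) (W : Submodule k V) {g : G}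
    (h : ∀ c : F.Cell n A B, c.IsHomog g → f (Bar.mk c) ∈ W) {x : F.Bar n A B}
    (hx : x ∈ Bar.gr F n A B g) : f x ∈ W := by
  have : Bar.gr F n A B g ≤ W.comap f := Submodule.span_le.2 <| by
    rintro _ ⟨c, hc, rfl⟩
    exact h c hc
  exact this hx

/-- The bar construction as a graded bimodule. -/
noncomputable def barBimod (n : ℕ) : Bimod D where
  carrier := F.Bar n
  act a b := Bar.act a b
  act_left {A' A B B'} r s a a' b x := by
    have : (Bar.act (r • a + s • a') b : F.Bar n A B →ₗ[k] _) =
        r • Bar.act a b + s • Bar.act a' b := Bar.hom_ext fun c => by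
      simp only [LinearMap.add_apply, LinearMap.smul_apply, Bar.act_mk]
      refine Bar.mk_comb ?_
      simp only [Cell.act, map_add, map_smul, LinearMap.add_apply, LinearMap.smul_apply]
      exact .left ..
    exact LinearMap.congr_fun this x
  act_right {A' A B B'} r s a b b' x := by
    have : (Bar.act a (r • b + s • b') : F.Bar n A B →ₗ[k] _) =
        r • Bar.act a b + s • Bar.act a b' := Bar.hom_ext fun c => by
      simp only [LinearMap.add_apply, LinearMap.smul_apply, Bar.act_mk]
      refine Bar.mk_comb ?_
      simp only [Cell.act, map_add, map_smul]
      exact .right ..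
    exact LinearMap.congr_fun this x
  act_act {A'' A' A B B' B''} a' a b b' x := by
    have : (Bar.act a' b' ∘ₗ Bar.act a b : F.Bar n A B →ₗ[k] _) =
        Bar.act (Full.comp a' a) (Full.comp b b') := Bar.hom_ext fun c => by
      simp only [LinearMap.comp_apply, Bar.act_mk, Cell.act, Full.assoc]
    exact LinearMap.congr_fun this x
  act_id {A B} x := by
    have : (Bar.act (Full.id A) (Full.id B) : F.Bar n A B →ₗ[k] _) = LinearMap.id :=
      Bar.hom_ext fun c => by
        simp only [LinearMap.id_apply, Bar.act_mk, Cell.act, Full.id_comp, Full.comp_id]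
    exact LinearMap.congr_fun this x
  gr A B g := Bar.gr F n A B g
  act_mem {A' A B B' g h i a b x} ha hb hx := by
    refine Bar.map_gr_le (Bar.act a b) (Bar.gr F n A' B' (g + i + h)) ?_ hx
    rintro c ⟨e, h₁, h₂, h₃⟩
    rw [Bar.act_mk]
    -- A left factor of degree `g` shifts the whole potential by `g` and leaves its differences
    -- unchanged.
    refine Bar.mk_mem_gr ⟨fun l => g + e l, Full.comp_mem ha h₁, fun l => ?_, ?_⟩
    · rw [add_sub_add_left_eq_sub]; exact h₂ l
    · have := Full.comp_mem h₃ hb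
      have e' : i - e (Fin.last n) + h = g + i + h - (g + e (Fin.last n)) := by abel
      rwa [e'] at this

end GradedPrecat.PrecatFunctor

/-! ### Faces, the bar differential, and morphisms out of the bar construction -/

namespace GradedPrecat.PrecatFunctor

open NonunitalGradedPrecat

variable {C D : GradedPrecat.{u, v, w, t} k G} {F : PrecatFunctor C D}

/-- The face of a cell along a strictly increasing map of indices. -/
def Cell.face {m n : ℕ} {A B : D.Ob} (f : Fin (m + 1) ↪o Fin (n + 1)) (c : F.Cell n A B) :
    F.Cell m A B where
  seq := c.seq.comap f
  left := Full.comp c.left (F.mapFull (c.seq.prod c.str 0 (f 0)))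
  str := c.seq.comapStr f c.str
  right := Full.comp (F.mapFull (c.seq.prod c.str (f (Fin.last m)) (Fin.last n))) c.right

theorem Cell.ext_of_seq {n : ℕ} {A B : D.Ob} {X : C.TrSeq n} {x x' : D.Full A (F.obj (X.obj 0))}
    {a a' : X.Str} {z z' : D.Full (F.obj (X.obj (Fin.last n))) B} (hx : x = x') (ha : a = a')
    (hz : z = z') : (⟨X, x, a, z⟩ : F.Cell n A B) = ⟨X, x', a', z'⟩ := by
  rw [hx, ha, hz]

/-- A varying entry `l` of the string is absorbed by exactly one entry of the face: by the left
coefficient if it lies before `f 0`, by the right coefficient if it lies after `f (Fin.last m)`, and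
otherwise by the composite between two consecutive values of `f`. The three cases are treated
separately. -/
theorem Cell.IsComb.face {m n : ℕ} {A B : D.Ob} (f : Fin (m + 1) ↪o Fin (n + 1)) {r s : k}
    {c c₁ c₂ : F.Cell n A B} (h : Cell.IsComb F r s c c₁ c₂) :
    Cell.IsComb F r s (c.face f) (c₁.face f) (c₂.face f) := by
  cases h with
  | left X x y a z =>
    simp only [Cell.face, map_add, map_smul, LinearMap.add_apply, LinearMap.smul_apply]
    exact .left ..
  | right X x a y z => simp only [Cell.face, map_add, map_smul]; exact .right ..
  | @str X x l a b c H z =>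
    have hf : f 0 ≤ f (Fin.last m) := f.monotone (Fin.zero_le _)
    unfold Cell.face
    dsimp only
    by_cases h₁ : f 0 ≤ l.castSucc
    · have e₁ : X.prod a 0 (f 0) = X.prod b 0 (f 0) := TrSeq.prod_congr _ _ _ _ _ fun o _ ho =>
        H.left o fun e => by subst e; exact absurd (ho.trans h₁) (not_le.2 o.castSucc_lt_succ)
      have e₂ : X.prod a 0 (f 0) = X.prod c 0 (f 0) := TrSeq.prod_congr _ _ _ _ _ fun o _ ho =>
        H.right o fun e => by subst e; exact absurd (ho.trans h₁) (not_le.2 o.castSucc_lt_succ)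
      rw [← e₁, ← e₂]
      by_cases h₂ : l.succ ≤ f (Fin.last m)
      · obtain ⟨l', h₃, h₄⟩ := TrSeq.exists_between f l h₁ h₂
        have e₃ : X.prod a (f (Fin.last m)) (Fin.last n) = X.prod b (f (Fin.last m)) (Fin.last n) :=
          TrSeq.prod_congr _ _ _ _ _ fun o ho _ =>
            H.left o fun e => by subst e; exact absurd (h₂.trans ho) (not_le.2 o.castSucc_lt_succ)
        have e₄ : X.prod a (f (Fin.last m)) (Fin.last n) = X.prod c (f (Fin.last m)) (Fin.last n) :=
          TrSeq.prod_congr _ _ _ _ _ fun o ho _ =>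
            H.right o fun e => by subst e; exact absurd (h₂.trans ho) (not_le.2 o.castSucc_lt_succ)
        rw [← e₃, ← e₄]
        exact .str _ _ (H.comapStr f l' h₃ h₄) _
      · have h₂' : f (Fin.last m) ≤ l.castSucc := Fin.le_castSucc_iff.2 (not_le.1 h₂)
        have e₃ : X.comapStr f a = X.comapStr f b := by
          funext q
          refine TrSeq.seg_congr _ _ _ _ _ _ fun o _ ho => H.left o fun e => ?_
          subst e
          exact h₂ (ho.trans (f.monotone (Fin.le_last _)))
        have e₄ : X.comapStr f a = X.comapStr f c := by
          funext q
          refine TrSeq.seg_congr _ _ _ _ _ _ fun o _ ho => H.right o fun e => ?_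
          subst e
          exact h₂ (ho.trans (f.monotone (Fin.le_last _)))
        rw [← e₃, ← e₄, H.prod _ _ h₂' (Fin.le_last _)]
        simp only [map_add, map_smul, LinearMap.add_apply, LinearMap.smul_apply]
        exact .right ..
    · have h₁' : l.succ ≤ f 0 := by
        rw [Fin.le_def, Fin.val_succ]; rw [Fin.le_def, Fin.val_castSucc] at h₁; omega
      have e₁ : X.comapStr f a = X.comapStr f b := by
        funext q
        refine TrSeq.seg_congr _ _ _ _ _ _ fun o ho _ => H.left o fun e => ?_
        subst e
        exact h₁ ((f.monotone (Fin.zero_le _)).trans ho)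
      have e₂ : X.comapStr f a = X.comapStr f c := by
        funext q
        refine TrSeq.seg_congr _ _ _ _ _ _ fun o ho _ => H.right o fun e => ?_
        subst e
        exact h₁ ((f.monotone (Fin.zero_le _)).trans ho)
      have e₃ : X.prod a (f (Fin.last m)) (Fin.last n) = X.prod b (f (Fin.last m)) (Fin.last n) :=
        TrSeq.prod_congr _ _ _ _ _ fun o ho _ =>
          H.left o fun e => by subst e; exact h₁ (hf.trans ho)
      have e₄ : X.prod a (f (Fin.last m)) (Fin.last n) = X.prod c (f (Fin.last m)) (Fin.last n) :=
        TrSeq.prod_congr _ _ _ _ _ fun o ho _ =>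
          H.right o fun e => by subst e; exact h₁ (hf.trans ho)
      rw [← e₁, ← e₂, ← e₃, ← e₄]
      have e : Full.comp x (F.mapFull (X.prod a 0 (f 0))) =
          r • Full.comp x (F.mapFull (X.prod b 0 (f 0))) +
            s • Full.comp x (F.mapFull (X.prod c 0 (f 0))) := by
        rw [H.prod _ _ (Fin.zero_le _) h₁', map_add, map_smul, map_smul, map_add, map_smul,
          map_smul]
      exact (congrArg (fun q => Cell.IsComb F r s q _ _)
        (Cell.ext_of_seq (X := X.comap f) e rfl rfl)).mpr (.left ..)

/-- Contravariant functoriality in the map of indices. It reduces the simplicial identities for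
faces to identities between injections of finite ordinals. -/
theorem Cell.face_face {o m n : ℕ} {A B : D.Ob} (f : Fin (o + 1) ↪o Fin (m + 1))
    (g : Fin (m + 1) ↪o Fin (n + 1)) (c : F.Cell n A B) :
    (c.face g).face f = c.face (f.trans g) := by
  obtain ⟨X, x, a, z⟩ := c
  have h₁ : (X.comap g).prod (X.comapStr g a) 0 (f 0) = X.prod a (g 0) (g (f 0)) :=
    TrSeq.prod_comapStr _ _ _ _ _ (Fin.zero_le _)
  have h₂ : (X.comap g).prod (X.comapStr g a) (f (Fin.last o)) (Fin.last m) =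
      X.prod a (g (f (Fin.last o))) (g (Fin.last m)) :=
    TrSeq.prod_comapStr _ _ _ _ _ (Fin.le_last _)
  have h₃ : Full.comp (X.prod a (g (f (Fin.last o))) (g (Fin.last m)))
      (X.prod a (g (Fin.last m)) (Fin.last n)) = X.prod a (g (f (Fin.last o))) (Fin.last n) :=
    TrSeq.comp_prod _ _ (g.monotone (Fin.le_last _)) (Fin.le_last _)
  have h₄ : Full.comp (X.prod a 0 (g 0)) (X.prod a (g 0) (g (f 0))) = X.prod a 0 (g (f 0)) :=
    TrSeq.comp_prod _ _ (Fin.zero_le _) (g.monotone (Fin.zero_le _))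
  refine Cell.ext_of_seq (X := X.comap (f.trans g)) ?_ (TrSeq.comapStr_trans f g X a) ?_
  · change Full.comp (Full.comp x (F.mapFull (X.prod a 0 (g 0))))
      (F.mapFull ((X.comap g).prod (X.comapStr g a) 0 (f 0))) =
      Full.comp x (F.mapFull (X.prod a 0 (g (f 0))))
    rw [h₁, ← h₄, mapFull_comp, Full.assoc]
    rfl
  · change Full.comp (F.mapFull ((X.comap g).prod (X.comapStr g a) (f (Fin.last o)) (Fin.last m)))
      (Full.comp (F.mapFull (X.prod a (g (Fin.last m)) (Fin.last n))) z) =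
      Full.comp (F.mapFull (X.prod a (g (f (Fin.last o))) (Fin.last n))) z
    rw [h₂, ← h₃, mapFull_comp, Full.assoc]
    rfl

theorem Cell.IsHomog.face {m n : ℕ} {A B : D.Ob} (f : Fin (m + 1) ↪o Fin (n + 1))
    {c : F.Cell n A B} {g : G} (h : c.IsHomog g) : (c.face f).IsHomog g := by
  obtain ⟨e, h₁, h₂, h₃⟩ := h
  refine ⟨fun i => e (f i), ?_, fun l => TrSeq.seg_mem c.seq c.str e h₂ _ _ _, ?_⟩
  · have := Full.comp_mem h₁
      (F.mapFull_mem (TrSeq.prod_mem c.seq c.str e h₂ 0 (f 0) (Fin.zero_le _)))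
    rwa [add_sub_cancel] at this
  · have := Full.comp_mem (F.mapFull_mem (TrSeq.prod_mem c.seq c.str e h₂ (f (Fin.last m))
      (Fin.last n) (Fin.le_last _))) h₃
    have e' : e (Fin.last n) - e (f (Fin.last m)) + (g - e (Fin.last n)) =
      g - e (f (Fin.last m)) := by abel
    rwa [e'] at this

/-- A face multiplies the coefficients on their inner side and the bimodule action on their outer
side, so the two commute by associativity. -/
theorem Cell.face_act {m n : ℕ} {A' A B B' : D.Ob} (f : Fin (m + 1) ↪o Fin (n + 1))
    (a : D.Full A' A) (b : D.Full B B') (c : F.Cell n A B) :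
    (c.act a b).face f = (c.face f).act a b :=
  Cell.ext_of_seq (X := c.seq.comap f) (Full.assoc _ _ _) rfl (Full.assoc _ _ _).symm

/-- The face maps of the bar construction. -/
noncomputable def Bar.face {m n : ℕ} {A B : D.Ob} (f : Fin (m + 1) ↪o Fin (n + 1)) :
    F.Bar n A B →ₗ[k] F.Bar m A B :=
  Bar.lift (fun c => Bar.mk (c.face f)) fun h => Bar.mk_comb (h.face f)

theorem Bar.face_mk {m n : ℕ} {A B : D.Ob} (f : Fin (m + 1) ↪o Fin (n + 1)) (c : F.Cell n A B) :
    Bar.face f (Bar.mk c) = Bar.mk (c.face f) :=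
  Bar.lift_mk _ (fun h => Bar.mk_comb (h.face f)) c

theorem Bar.face_face {o m n : ℕ} {A B : D.Ob} (f : Fin (o + 1) ↪o Fin (m + 1))
    (g : Fin (m + 1) ↪o Fin (n + 1)) (x : F.Bar n A B) :
    Bar.face f (Bar.face g x) = Bar.face (f.trans g) x := by
  have : Bar.face f ∘ₗ Bar.face g = (Bar.face (f.trans g) : F.Bar n A B →ₗ[k] _) :=
    Bar.hom_ext fun c => by
      rw [LinearMap.comp_apply, Bar.face_mk, Bar.face_mk, Bar.face_mk, Cell.face_face]
  exact LinearMap.congr_fun this x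

theorem Bar.face_act {m n : ℕ} {A' A B B' : D.Ob} (f : Fin (m + 1) ↪o Fin (n + 1))
    (a : D.Full A' A) (b : D.Full B B') (x : F.Bar n A B) :
    Bar.face f (Bar.act a b x) = Bar.act a b (Bar.face f x) := by
  have : Bar.face f ∘ₗ Bar.act a b = Bar.act a b ∘ₗ (Bar.face f : F.Bar n A B →ₗ[k] _) :=
    Bar.hom_ext fun c => by
      simp only [LinearMap.comp_apply, Bar.face_mk, Bar.act_mk, Cell.face_act]
  exact LinearMap.congr_fun this x

theorem Bar.face_mem {m n : ℕ} {A B : D.Ob} (f : Fin (m + 1) ↪o Fin (n + 1)) {g : G}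
    {x : F.Bar n A B} (hx : x ∈ Bar.gr F n A B g) : Bar.face f x ∈ Bar.gr F m A B g :=
  Bar.map_gr_le _ _ (fun c hc => by rw [Bar.face_mk]; exact Bar.mk_mem_gr (hc.face f)) hx

/-- The differential of the bar construction. -/
noncomputable def Bar.d (n : ℕ) {A B : D.Ob} : F.Bar (n + 1) A B →ₗ[k] F.Bar n A B :=
  ∑ i : Fin (n + 2), (-1 : ℤ) ^ (n + (i : ℕ)) • Bar.face (Fin.succAboveOrderEmb i)

theorem succAbove_trans_succAbove {n : ℕ} (i j : Fin (n + 2)) (hij : i ≤ j) :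
    (Fin.succAboveOrderEmb i).trans (Fin.succAboveOrderEmb j.succ) =
      (Fin.succAboveOrderEmb j).trans (Fin.succAboveOrderEmb i.castSucc) := by
  ext l
  simp only [RelEmbedding.coe_trans, Function.comp_apply, Fin.succAboveOrderEmb_apply,
    Fin.succAbove, Fin.lt_def, Fin.le_def] at *
  split_ifs <;> simp_all <;> omega

theorem Bar.d_d (n : ℕ) {A B : D.Ob} (x : F.Bar (n + 2) A B) :
    Bar.d n (Bar.d (n + 1) x) = 0 := by
  simp only [Bar.d, LinearMap.sum_apply, LinearMap.smul_apply, map_sum, map_zsmul,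
    Bar.face_face, Finset.smul_sum]
  rw [Finset.sum_comm, ← Finset.sum_product']
  let P := Fin (n + 2) × Fin (n + 3)
  let S : Finset P := {ij : P | (ij.2 : ℕ) ≤ (ij.1 : ℕ)}
  rw [Finset.univ_product_univ, ← Finset.sum_add_sum_compl S, ← eq_neg_iff_add_eq_zero,
    ← Finset.sum_neg_distrib]
  -- The terms with `j ≤ i` are matched with the remaining ones by `(i, j) ↦ (j, i + 1)`. Matched
  -- terms belong to the same composite injection, by `succAbove_trans_succAbove`, and have opposite
  -- signs.
  let φ' : ∀ ij : P, ij ∈ S → P := fun ij hij =>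
    (Fin.castLT ij.2 (lt_of_le_of_lt (Finset.mem_filter.mp hij).right (Fin.is_lt ij.1)), ij.1.succ)
  apply Finset.sum_bij φ'
  · intro ij hij
    simp_rw [S, φ', Finset.compl_filter, Finset.mem_filter_univ, Fin.val_succ,
      Fin.val_castLT] at hij ⊢
    lia
  · rintro ⟨i, j⟩ hij ⟨i', j'⟩ hij' h
    have h₁ : (j : ℕ) = j' := congrArg (fun x : P => (x.1 : ℕ)) h
    have h₂ : i = i' := Fin.succ_injective _ (congrArg (fun x : P => x.2) h)
    exact Prod.ext h₂ (Fin.ext h₁)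
  · rintro ⟨i, j⟩ hij'
    simp_rw [S, Finset.compl_filter, Finset.mem_filter_univ, not_le] at hij'
    refine ⟨(j.pred ?_, i.castSucc), ?_, ?_⟩
    · rintro rfl
      simp only [Fin.val_zero, not_lt_zero] at hij'
    · simpa [S] using! Nat.le_sub_one_of_lt hij'
    · simp only [φ', Fin.castLT_castSucc, Fin.succ_pred]
  · rintro ⟨i, j⟩ hij
    have hji : (j : ℕ) ≤ i := by simpa [S] using! hij
    simp only [φ', Fin.val_succ, Fin.val_castLT]
    rw [succAbove_trans_succAbove _ _ (by rw [Fin.le_def]; exact hji), Fin.castSucc_castLT,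
      smul_smul, smul_smul, ← neg_smul]
    congr 1
    ring

theorem Bar.d_act (n : ℕ) {A' A B B' : D.Ob} (a : D.Full A' A) (b : D.Full B B')
    (x : F.Bar (n + 1) A B) : Bar.d n (Bar.act a b x) = Bar.act a b (Bar.d n x) := by
  simp only [Bar.d, LinearMap.sum_apply, LinearMap.smul_apply, Bar.face_act, map_sum, map_zsmul]

theorem Bar.d_mem (n : ℕ) {A B : D.Ob} {g : G} {x : F.Bar (n + 1) A B}
    (hx : x ∈ Bar.gr F (n + 1) A B g) : Bar.d n x ∈ Bar.gr F n A B g := by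
  rw [Bar.d, LinearMap.sum_apply]
  exact sum_mem fun i _ => zsmul_mem (Bar.face_mem _ hx) _

/-- The differential of the bar construction as a morphism of bimodules. -/
noncomputable def barD (F : PrecatFunctor C D) (n : ℕ) :
    Bimod.Hom (F.barBimod (n + 1)) (F.barBimod n) where
  app {A B} := (Bar.d n : F.Bar (n + 1) A B →ₗ[k] F.Bar n A B)
  app_act a b x := Bar.d_act n a b x
  app_mem h := Bar.d_mem n h

/-- Values of a morphism of bimodules on the generators of the bar construction. -/
structure GenMap (F : PrecatFunctor C D) (n : ℕ) (M : Bimod D) where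
  /-- the values -/
  val : ∀ X : C.TrSeq n, MultilinearMap k (fun l : Fin n => C.Hom (X.obj l.castSucc) (X.obj l.succ))
    (M.carrier (F.obj (X.obj 0)) (F.obj (X.obj (Fin.last n))))
  val_mem : ∀ (X : C.TrSeq n) (a : X.Str) (d : Fin n → G),
    (∀ l, a l ∈ C.gr (X.obj l.castSucc) (X.obj l.succ) (d l)) → val X a ∈ M.gr _ _ (∑ l, d l)

/-- Values on strings extend to cells by the bimodule action; this is the multilinearity that makes
the extension descend to the quotient. -/
theorem GenMap.comb {n : ℕ} {M : Bimod D} (s : GenMap F n M) {A B : D.Ob} {x y : k}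
    {c c₁ c₂ : F.Cell n A B} (h : Cell.IsComb F x y c c₁ c₂) :
    M.act c.left c.right (s.val c.seq c.str) = x • M.act c₁.left c₁.right (s.val c₁.seq c₁.str) +
      y • M.act c₂.left c₂.right (s.val c₂.seq c₂.str) := by
  cases h with
  | left => exact M.act_left ..
  | right => exact M.act_right ..
  | str X x H z => dsimp only; rw [H.apply (s.val X), map_add, map_smul, map_smul]

/-- The morphism of bimodules with given values on the generators. -/
noncomputable def GenMap.hom {n : ℕ} {M : Bimod D} (s : GenMap F n M) :
    Bimod.Hom (F.barBimod n) M where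
  app {A B} := (Bar.lift (fun c => M.act c.left c.right (s.val c.seq c.str)) s.comb :
    F.Bar n A B →ₗ[k] M.carrier A B)
  app_act {A' A B B'} a b x := by
    have : Bar.lift (fun c => M.act c.left c.right (s.val c.seq c.str)) s.comb ∘ₗ Bar.act a b =
        M.act a b ∘ₗ (Bar.lift (fun c => M.act c.left c.right (s.val c.seq c.str)) s.comb :
          F.Bar n A B →ₗ[k] M.carrier A B) := Bar.hom_ext fun c => by
      rw [LinearMap.comp_apply, LinearMap.comp_apply, Bar.act_mk, Bar.lift_mk, Bar.lift_mk,
        M.act_act]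
      rfl
    exact LinearMap.congr_fun this x
  app_mem {A B g x} h := by
    refine Bar.map_gr_le _ _ ?_ h
    rintro c ⟨e, h₁, h₂, h₃⟩
    rw [Bar.lift_mk]
    have := M.act_mem h₁ h₃ (s.val_mem c.seq c.str _ h₂)
    rw [sum_fin_sub] at this
    have e' : e 0 + (e (Fin.last n) - e 0) + (g - e (Fin.last n)) = g := by abel
    rwa [e'] at this

theorem GenMap.hom_mk {n : ℕ} {M : Bimod D} (s : GenMap F n M) {A B : D.Ob} (c : F.Cell n A B) :
    s.hom.app (Bar.mk c) = M.act c.left c.right (s.val c.seq c.str) :=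
  Bar.lift_mk _ s.comb c

end GradedPrecat.PrecatFunctor

/-! ### Putting an object in front of a transversal sequence -/

namespace NonunitalGradedPrecat.TrSeq

variable {C : NonunitalGradedPrecat.{u, v, w, t} k G} {n : ℕ}

/-- The sequence that consists of one object. -/
def single (A : C.Ob) : C.TrSeq 0 where
  obj _ := A
  tr := by simpa using C.tr_singleton A

/-- The sequence `(A, X_0, …, X_n)`. -/
def cons (A : C.Ob) (X : C.TrSeq n) (h : C.Tr (A :: List.ofFn X.obj)) : C.TrSeq (n + 1) where
  -- Matching on the numerical value of the index makes the entries reduce by computation, so that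
  -- dropping `A` returns `X` definitionally. The statement of `comapStr_succ_consStr` relies on
  -- this.
  obj
    | ⟨0, _⟩ => A
    | ⟨i + 1, hi⟩ => X.obj ⟨i, Nat.lt_of_succ_lt_succ hi⟩
  tr := by rw [List.ofFn_succ]; exact h

theorem tr_cons {A : C.Ob} {X : C.TrSeq n} (h : C.Tr (A :: List.ofFn X.obj)) :
    C.Tr [A, X.obj 0] :=
  (X.cons A h).tr_two (i := 0) (j := Fin.succ 0) (Fin.succ_pos 0)

/-- The string `(b, a_1, …, a_n)`. -/
def consStr {A : C.Ob} {X : C.TrSeq n} (h : C.Tr (A :: List.ofFn X.obj)) (b : C.Hom A (X.obj 0))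
    (a : X.Str) : (X.cons A h).Str
  | ⟨0, _⟩ => b
  | ⟨i + 1, hi⟩ => a ⟨i, Nat.lt_of_succ_lt_succ hi⟩

variable {A : C.Ob} {X : C.TrSeq n} (h : C.Tr (A :: List.ofFn X.obj)) (b : C.Hom A (X.obj 0))
  (a : X.Str)

theorem comapStr_succ_consStr :
    (X.cons A h).comapStr (Fin.succOrderEmb (n + 1)) (consStr h b a) = a := by
  funext l
  exact seg_castSucc_succ (X.cons A h) (consStr h b a) l.succ

theorem seg_consStr_succ (i j : Fin (n + 1)) (hij : i < j) :
    (X.cons A h).seg (consStr h b a) i.succ j.succ (Fin.succ_lt_succ_iff.2 hij) =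
      X.seg a i j hij := by
  have := seg_comapStr (Fin.succOrderEmb (n + 1)) (X.cons A h) (consStr h b a) i j hij
  rw [comapStr_succ_consStr] at this
  exact this.symm

theorem prod_consStr_succ (i j : Fin (n + 1)) (hij : i ≤ j) :
    (X.cons A h).prod (consStr h b a) i.succ j.succ = X.prod a i j := by
  have := prod_comapStr (Fin.succOrderEmb (n + 1)) (X.cons A h) (consStr h b a) i j hij
  rw [comapStr_succ_consStr] at this
  exact this.symm

theorem prod_consStr_zero_one :
    (X.cons A h).prod (consStr h b a) 0 (Fin.succ 0) = Full.of (tr_cons h) b := by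
  rw [prod_of_lt _ _ (Fin.succ_pos 0)]
  exact congrArg (Full.of (tr_cons h)) (seg_castSucc_succ (X.cons A h) (consStr h b a) 0)

theorem prod_consStr_zero_succ (j : Fin (n + 1)) :
    (X.cons A h).prod (consStr h b a) 0 j.succ =
      Full.comp (Full.of (tr_cons h) b) (X.prod a 0 j) := by
  rw [← comp_prod (X.cons A h) (consStr h b a) (Fin.succ_pos 0).le
    (Fin.succ_le_succ_iff.2 (Fin.zero_le j)), prod_consStr_zero_one, prod_consStr_succ]
  · rfl
  · exact Fin.zero_le j

theorem IsComb.consStr {l : Fin n} {r s : k} {a a₁ a₂ : X.Str} (H : IsComb l r s a a₁ a₂) :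
    IsComb l.succ r s (consStr h b a) (consStr h b a₁) (consStr h b a₂) where
  left
    | ⟨0, _⟩, _ => rfl
    | ⟨i + 1, hi⟩, hl => H.left ⟨i, Nat.lt_of_succ_lt_succ hi⟩ fun e => hl (by rw [← e]; rfl)
  right
    | ⟨0, _⟩, _ => rfl
    | ⟨i + 1, hi⟩, hl => H.right ⟨i, Nat.lt_of_succ_lt_succ hi⟩ fun e => hl (by rw [← e]; rfl)
  comb := H.comb

theorem isComb_consStr_zero (r s : k) (b₁ b₂ : C.Hom A (X.obj 0)) :
    IsComb (0 : Fin (n + 1)) r s (consStr h (r • b₁ + s • b₂) a) (consStr h b₁ a)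
      (consStr h b₂ a) where
  left
    | ⟨0, _⟩, hl => absurd rfl hl
    | ⟨_ + 1, _⟩, _ => rfl
  right
    | ⟨0, _⟩, hl => absurd rfl hl
    | ⟨_ + 1, _⟩, _ => rfl
  comb := rfl

/-- The extension by `0 ↦ 0` of a strictly increasing map of indices. -/
def liftEmb {m n : ℕ} (f : Fin (m + 1) ↪o Fin (n + 1)) : Fin (m + 2) ↪o Fin (n + 2) :=
  OrderEmbedding.ofStrictMono
    (fun
      | ⟨0, _⟩ => 0
      | ⟨i + 1, hi⟩ => (f ⟨i, Nat.lt_of_succ_lt_succ hi⟩).succ) <| by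
    rintro ⟨i, hi⟩ ⟨j, hj⟩ hij
    rcases i with _ | i <;> rcases j with _ | j
    · exact absurd hij (lt_irrefl _)
    · exact Fin.succ_pos _
    · exact absurd hij (Nat.not_lt_zero _)
    · exact Fin.succ_lt_succ_iff.2 (f.lt_iff_lt.2 (Nat.lt_of_succ_lt_succ hij))

/-- All faces of `(A, X_0, …, X_n)` except the one that drops `A` are faces of `X` with `A` kept in
front. This is the combinatorial source of the contraction identity. -/
theorem liftEmb_succAbove (i : Fin (n + 2)) :
    liftEmb (Fin.succAboveOrderEmb i) = Fin.succAboveOrderEmb i.succ := by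
  ext j
  refine Fin.cases ?_ (fun j => ?_) j
  · rw [Fin.succAboveOrderEmb_apply, Fin.succ_succAbove_zero]; rfl
  · rw [Fin.succAboveOrderEmb_apply, Fin.succ_succAbove_succ]; rfl

theorem succAboveOrderEmb_zero (n : ℕ) :
    (Fin.succAboveOrderEmb 0 : Fin n ↪o Fin (n + 1)) = Fin.succOrderEmb n := by
  ext j
  rw [Fin.succAboveOrderEmb_apply, Fin.succAbove_zero]; rfl

/-- The inclusion of the first index. -/
def zeroEmb (n : ℕ) : Fin 1 ↪o Fin (n + 1) :=
  OrderEmbedding.ofStrictMono (fun _ => 0) fun i j h => absurd h (by omega)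

theorem succAboveOrderEmb_one : (Fin.succAboveOrderEmb 1 : Fin 1 ↪o Fin 2) = zeroEmb 1 := by
  ext j
  obtain rfl := Subsingleton.elim j 0
  rfl

end NonunitalGradedPrecat.TrSeq

/-! ### Exactness of the augmented bar complex -/

namespace GradedPrecat.PrecatFunctor

open NonunitalGradedPrecat

variable {C D : GradedPrecat.{u, v, w, t} k G} {F : PrecatFunctor C D}

/-- Needed when two sequences of objects agree only after a case distinction on the index, so that
the coefficients and morphisms of the two cells have different types on their face. -/
theorem Cell.ext_heq {n : ℕ} {A B : D.Ob} {c c' : F.Cell n A B}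
    (h : ∀ i, c.seq.obj i = c'.seq.obj i) (h₁ : HEq c.left c'.left)
    (h₂ : ∀ l, HEq (c.str l) (c'.str l)) (h₃ : HEq c.right c'.right) : c = c' := by
  obtain ⟨⟨X, hX⟩, x, a, z⟩ := c
  obtain ⟨⟨Y, hY⟩, y, b, z'⟩ := c'
  obtain rfl : X = Y := funext h
  obtain rfl := eq_of_heq h₁
  obtain rfl : a = b := funext fun l => eq_of_heq (h₂ l)
  obtain rfl := eq_of_heq h₃
  rfl

/-- The isomorphism `Hom_C(X, Y) → Hom_{D_full}(F(X), F(Y))` for transversal pairs. -/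
noncomputable def homEquiv (hF : F.IsFullyFaithful) {X Y : C.Ob} (h : C.Tr [X, Y]) :
    C.Hom X Y ≃ₗ[k] D.Full (F.obj X) (F.obj Y) :=
  LinearEquiv.ofBijective (F.mapFull ∘ₗ Full.of h)
    ((mapFull_bijective hF X Y).comp (of_bijective h))

theorem mapFull_of_homEquiv_symm (hF : F.IsFullyFaithful) {X Y : C.Ob} (h : C.Tr [X, Y])
    (x : D.Full (F.obj X) (F.obj Y)) : F.mapFull (Full.of h ((homEquiv hF h).symm x)) = x :=
  (homEquiv hF h).apply_symm_apply x

/-- Both maps composing `homEquiv`, the localization map on a transversal pair and `F_full`, reflect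
degrees. -/
theorem homEquiv_symm_mem (hF : F.IsFullyFaithful) {X Y : C.Ob} (h : C.Tr [X, Y]) {g : G}
    {x : D.Full (F.obj X) (F.obj Y)} (hx : x ∈ Full.gr (F.obj X) (F.obj Y) g) :
    (homEquiv hF h).symm x ∈ C.gr X Y g := by
  refine mem_of_of_mem h (mem_of_mapFull_mem hF ?_)
  rwa [mapFull_of_homEquiv_symm]

section Contraction

variable (hF : F.IsFullyFaithful) {n : ℕ} {A B : D.Ob} {A' : C.Ob} (x : D.Full (F.obj A') A)
  (y : D.Full A (F.obj A'))

/-- Insertion of an object in front of a cell. -/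
noncomputable def Cell.cons (c : F.Cell n A B) (h : C.Tr (A' :: List.ofFn c.seq.obj)) :
    F.Cell (n + 1) A B where
  seq := c.seq.cons A' h
  left := y
  -- The composite `F A' → A → F X_0` in `D_full` comes from a unique morphism `A' → X_0` of `C`,
  -- because the pair is transversal and `F` is fully faithful. This is the new first entry of the
  -- string.
  str := TrSeq.consStr h ((homEquiv hF (TrSeq.tr_cons h)).symm (Full.comp x c.left)) c.str
  right := c.right

/-- Dropping `A'` again multiplies `y` with the new morphism, whose image is `x` followed by the old
left coefficient; the retraction `A → F A' → A` is the identity. -/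
theorem Cell.face_cons (hxy : Full.comp y x = Full.id A) (c : F.Cell n A B)
    (h : C.Tr (A' :: List.ofFn c.seq.obj)) :
    (c.cons hF x y h).face (Fin.succOrderEmb (n + 1)) = c := by
  obtain ⟨X, u, a, z⟩ := c
  refine Cell.ext_of_seq (X := X) ?_ (TrSeq.comapStr_succ_consStr h _ a) ?_
  · refine (congrArg (fun q => Full.comp y (F.mapFull q))
      (TrSeq.prod_consStr_zero_one h _ a)).trans ?_
    refine (congrArg (Full.comp y) (mapFull_of_homEquiv_symm hF _ _)).trans ?_
    refine (Full.assoc _ _ _).symm.trans ?_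
    rw [hxy]
    exact Full.id_comp u
  · refine (congrArg (fun q => Full.comp (F.mapFull q) z)
      (TrSeq.prod_self (X.cons A' h) _ (Fin.last (n + 1)))).trans ?_
    exact Full.id_comp z

theorem tr_cons_comap {m : ℕ} (f : Fin (m + 1) ↪o Fin (n + 1)) {X : C.TrSeq n}
    (h : C.Tr (A' :: List.ofFn X.obj)) : C.Tr (A' :: List.ofFn (X.comap f).obj) := by
  have := ((X.cons A' h).comap (TrSeq.liftEmb f)).tr
  rwa [List.ofFn_succ] at this

/-- These faces keep `A'` and its coefficient `y`. Only the new first morphism is affected: it is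
composed with the morphisms up to `X_{f 0}`, which agrees with inserting `A'` after these have been
absorbed into the left coefficient. -/
theorem Cell.face_liftEmb_cons {m : ℕ} (f : Fin (m + 1) ↪o Fin (n + 1)) (c : F.Cell n A B)
    (h : C.Tr (A' :: List.ofFn c.seq.obj)) :
    (c.cons hF x y h).face (TrSeq.liftEmb f) = (c.face f).cons hF x y (tr_cons_comap f h) := by
  obtain ⟨X, u, a, z⟩ := c
  refine Cell.ext_heq ?_ ?_ ?_ ?_
  · rintro ⟨_ | i, hi⟩ <;> rfl
  · refine heq_of_eq ?_
    refine (congrArg (fun q => Full.comp y (F.mapFull q))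
      (TrSeq.prod_self (X.cons A' h) _ 0)).trans ?_
    exact Full.comp_id y
  · rintro ⟨_ | i, hi⟩
    · refine heq_of_eq ?_
      -- The two candidates for the first morphism are compared after passing to `D_full`, where
      -- both are `x` followed by the same product.
      refine (homEquiv hF (TrSeq.tr_cons (tr_cons_comap f h))).injective ?_
      refine Eq.trans ?_ ((homEquiv hF (TrSeq.tr_cons (tr_cons_comap f h))).apply_symm_apply _).symm
      have e := TrSeq.prod_consStr_zero_succ h
        ((homEquiv hF (TrSeq.tr_cons h)).symm (Full.comp x u)) a (f 0)
      rw [TrSeq.prod_of_lt _ _ (Fin.succ_pos _)] at e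
      refine (congrArg F.mapFull e).trans ?_
      refine (F.mapFull_comp _ _).trans ?_
      refine (congrArg (fun q => Full.comp q _) (mapFull_of_homEquiv_symm hF _ _)).trans ?_
      exact Full.assoc _ _ _
    · exact heq_of_eq (TrSeq.seg_consStr_succ h _ a _ _ _)
  · refine heq_of_eq ?_
    exact congrArg (fun q => Full.comp (F.mapFull q) z)
      (TrSeq.prod_consStr_succ h _ a (f (Fin.last m)) (Fin.last n) (Fin.le_last _))

theorem Cell.IsHomog.cons {g : G} (hx : x ∈ Full.gr _ _ (0 : G)) (hy : y ∈ Full.gr _ _ (0 : G))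
    {c : F.Cell n A B} (hc : c.IsHomog g) (h : C.Tr (A' :: List.ofFn c.seq.obj)) :
    (c.cons hF x y h).IsHomog g := by
  obtain ⟨e, h₁, h₂, h₃⟩ := hc
  -- The new left coefficient `y` has degree zero, so the potential is extended by `0` in front; the
  -- new morphism then has degree `e 0`.
  refine ⟨fun | ⟨0, _⟩ => 0 | ⟨i + 1, hi⟩ => e ⟨i, Nat.lt_of_succ_lt_succ hi⟩, hy, ?_, h₃⟩
  rintro ⟨_ | i, hi⟩
  · refine homEquiv_symm_mem hF _ ?_
    have := Full.comp_mem hx h₁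
    have e' : 0 + e 0 = e 0 - 0 := by abel
    rwa [e'] at this
  · exact h₂ ⟨i, Nat.lt_of_succ_lt_succ hi⟩

open Classical in
/-- The contraction on cells. -/
noncomputable def Cell.contraction (c : F.Cell n A B) : F.Bar (n + 1) A B :=
  -- The value zero on the other cells is a default that makes the map total. The contraction
  -- identities concern cells transversal to `A'`, and this condition is inherited by their faces.
  if h : C.Tr (A' :: List.ofFn c.seq.obj) then Bar.mk (c.cons hF x y h) else 0

/-- The three cells of a relation have the same underlying sequence, hence fall into the same branch
of the definition. A linear change of the left coefficient turns into a linear change of the first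
morphism of the new string. -/
theorem Cell.contraction_comb {r s : k} {c c₁ c₂ : F.Cell n A B}
    (hc : Cell.IsComb F r s c c₁ c₂) :
    c.contraction hF x y = r • c₁.contraction hF x y + s • c₂.contraction hF x y := by
  cases hc with
  | left X u u' a z =>
    unfold Cell.contraction
    dsimp only
    split_ifs with h
    · refine Bar.mk_comb ?_
      simp only [Cell.cons, map_add, map_smul]
      exact .str _ _ (TrSeq.isComb_consStr_zero h a _ _ _ _) _
    · simp
  | str X u H z =>
    unfold Cell.contraction
    dsimp only
    split_ifs with h
    · exact Bar.mk_comb (.str _ _ (H.consStr h _) _)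
    · simp
  | right X u a z z' =>
    unfold Cell.contraction
    dsimp only
    split_ifs with h
    · exact Bar.mk_comb (.right _ _ _ _ _)
    · simp

/-- The contraction of the part of the bar construction that is transversal to `A'`. -/
noncomputable def Bar.contraction : F.Bar n A B →ₗ[k] F.Bar (n + 1) A B :=
  Bar.lift (fun c => c.contraction hF x y) (Cell.contraction_comb hF x y)

theorem Bar.contraction_mk (c : F.Cell n A B) (h : C.Tr (A' :: List.ofFn c.seq.obj)) :
    Bar.contraction hF x y (Bar.mk c) = Bar.mk (c.cons hF x y h) :=
  (Bar.lift_mk _ (Cell.contraction_comb hF x y) c).trans (dif_pos h)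

theorem Bar.contraction_mem {g : G} (hx : x ∈ Full.gr _ _ (0 : G)) (hy : y ∈ Full.gr _ _ (0 : G))
    {z : F.Bar n A B} (hz : z ∈ Bar.gr F n A B g) :
    Bar.contraction hF x y z ∈ Bar.gr F (n + 1) A B g := by
  refine Bar.map_gr_le _ _ (fun c hc => ?_) hz
  by_cases h : C.Tr (A' :: List.ofFn c.seq.obj)
  · rw [Bar.contraction_mk hF x y c h]
    exact Bar.mk_mem_gr (hc.cons hF x y hx hy h)
  · have : Bar.contraction hF x y (Bar.mk c) = 0 :=
      (Bar.lift_mk _ (Cell.contraction_comb hF x y) c).trans (dif_neg h)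
    rw [this]
    exact zero_mem _

/-- The face of index `0` returns the cell, with sign `(-1)^{n+1}`. The face of index `i + 1` is the
contraction of the face of index `i`, and the signs agree because the exponents `(n + 1) + (i + 1)`
and `n + i` differ by two. -/
theorem Bar.d_contraction_mk (hxy : Full.comp y x = Full.id A) (c : F.Cell (n + 1) A B)
    (h : C.Tr (A' :: List.ofFn c.seq.obj)) :
    Bar.d (n + 1) (Bar.contraction hF x y (Bar.mk c)) =
      (-1 : ℤ) ^ (n + 1) • Bar.mk c + Bar.contraction hF x y (Bar.d n (Bar.mk c)) := by
  rw [Bar.contraction_mk hF x y c h]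
  simp only [Bar.d, LinearMap.sum_apply, LinearMap.smul_apply, map_sum, map_zsmul, Bar.face_mk]
  rw [Fin.sum_univ_succ, TrSeq.succAboveOrderEmb_zero, Cell.face_cons hF x y hxy, Fin.val_zero,
    add_zero]
  congr 1
  refine Finset.sum_congr rfl fun i _ => ?_
  rw [← TrSeq.liftEmb_succAbove, Cell.face_liftEmb_cons,
    Bar.contraction_mk hF x y _ (tr_cons_comap _ h), Fin.val_succ]
  congr 1
  ring

/-- The insertion of an object in degree zero. -/
noncomputable def Bar.section₀ : D.Full A B →ₗ[k] F.Bar 0 A B where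
  toFun z := Bar.mk ⟨.single A', y, fun l => l.elim0, Full.comp x z⟩
  map_add' z z' := by
    have e : Full.comp x (z + z') = (1 : k) • Full.comp x z + (1 : k) • Full.comp x z' := by
      rw [one_smul, one_smul, map_add]
    refine (congrArg Bar.mk (Cell.ext_of_seq (X := .single A') rfl rfl e)).trans
      ((Bar.mk_comb (.right (r := (1 : k)) (s := (1 : k)) (.single A') y (fun l => l.elim0)
        (Full.comp x z) (Full.comp x z'))).trans ?_)
    rw [one_smul, one_smul]
  map_smul' r z := by
    have e : Full.comp x (r • z) = r • Full.comp x z + (0 : k) • Full.comp x z := by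
      rw [zero_smul, add_zero, map_smul]
    refine (congrArg Bar.mk (Cell.ext_of_seq (X := .single A') rfl rfl e)).trans
      ((Bar.mk_comb (.right (r := r) (s := (0 : k)) (.single A') y (fun l => l.elim0)
        (Full.comp x z) (Full.comp x z))).trans ?_)
    rw [zero_smul, add_zero]; rfl

/-- In degree zero the second face drops `X_0` and keeps only `A'`, so the whole cell is multiplied
into the right coefficient. Thus the contraction is a homotopy from the identity to the section of
the augmentation. -/
theorem Bar.d_contraction_mk_zero (hxy : Full.comp y x = Full.id A) (c : F.Cell 0 A B)
    (h : C.Tr (A' :: List.ofFn c.seq.obj)) :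
    Bar.d 0 (Bar.contraction hF x y (Bar.mk c)) =
      Bar.mk c - Bar.section₀ (F := F) x y (Full.comp c.left c.right) := by
  rw [Bar.contraction_mk hF x y c h, Bar.d, Fin.sum_univ_two]
  simp only [LinearMap.add_apply, LinearMap.smul_apply, Bar.face_mk]
  rw [TrSeq.succAboveOrderEmb_zero, Cell.face_cons hF x y hxy, TrSeq.succAboveOrderEmb_one,
    sub_eq_add_neg]
  have : (c.cons hF x y h).face (TrSeq.zeroEmb 1) =
      ⟨.single A', y, fun l => l.elim0, Full.comp x (Full.comp c.left c.right)⟩ := by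
    obtain ⟨X, u, a, z⟩ := c
    refine Cell.ext_of_seq (X := .single A') ?_ (funext fun l => l.elim0) ?_
    · refine (congrArg (fun q => Full.comp y (F.mapFull q))
        (TrSeq.prod_self (X.cons A' h) _ 0)).trans ?_
      exact Full.comp_id y
    · refine (congrArg (fun q => Full.comp (F.mapFull q) z)
        (TrSeq.prod_consStr_zero_one h _ a)).trans ?_
      refine (congrArg (fun q => Full.comp q z) (mapFull_of_homEquiv_symm hF _ _)).trans ?_
      exact Full.assoc _ _ _
  rw [this]
  simp [Bar.section₀]

end Contraction

/-- Quasi-isomorphic objects are isomorphic in `C_full`. -/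
theorem exists_full_iso {X Y : D.Ob}
    (h : Relation.EqvGen (fun A B : D.Ob => ∃ s : D.Hom A B, D.IsQuasiIso s) X Y) :
    ∃ (x : D.Full X Y) (y : D.Full Y X), x ∈ Full.gr _ _ (0 : G) ∧ y ∈ Full.gr _ _ (0 : G) ∧
      Full.comp x y = Full.id X ∧ Full.comp y x = Full.id Y := by
  induction h with
  | rel X Y h =>
    obtain ⟨s, hs⟩ := h
    exact ⟨Full.of hs.tr s, Full.inv s hs, Full.of_mem _ hs.mem, ⟨_, .inv s hs, rfl⟩,
      Full.of_inv s hs, Full.inv_of s hs⟩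
  | refl X =>
    exact ⟨Full.id X, Full.id X, Full.id_mem X, Full.id_mem X, Full.id_comp _, Full.id_comp _⟩
  | symm X Y _ ih =>
    obtain ⟨x, y, hx, hy, h, h'⟩ := ih
    exact ⟨y, x, hy, hx, h', h⟩
  | trans X Y Z _ _ ih ih' =>
    obtain ⟨x, y, hx, hy, h₁, h₂⟩ := ih
    obtain ⟨x', y', hx', hy', h₁', h₂'⟩ := ih'
    refine ⟨Full.comp x x', Full.comp y' y, ?_, ?_, ?_, ?_⟩
    · simpa using Full.comp_mem hx hx'
    · simpa using Full.comp_mem hy' hy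
    · rw [Full.assoc, ← Full.assoc x', h₁', Full.id_comp, h₁]
    · rw [Full.assoc, ← Full.assoc y, h₂, Full.id_comp, h₂']

/-- Essential surjectivity supplies `X` with `F X` isomorphic to `A` in `D_full`. The extension
property in `C` replaces `X` by a quasi-isomorphic object in general position with respect to `S`,
and `F` preserves this quasi-isomorphism. This is the only place where essential surjectivity
enters. -/
theorem exists_transversal (hF : F.IsEquivalence) (A : D.Ob) (S : List (List C.Ob))
    (hS : ∀ L ∈ S, L ≠ [] ∧ C.Tr L) :
    ∃ (A' : C.Ob) (x : D.Full (F.obj A') A) (y : D.Full A (F.obj A')),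
      x ∈ Full.gr _ _ (0 : G) ∧ y ∈ Full.gr _ _ (0 : G) ∧ Full.comp y x = Full.id A ∧
      ∀ L ∈ S, C.Tr (A' :: L) := by
  obtain ⟨X, hX⟩ := hF.exists_quasiIso A
  obtain ⟨Z, s, hs, hZ⟩ := Ev.exists (P := fun Z => ∀ L ∈ S, C.Tr (Z :: L))
    ⟨S, hS, fun _ h => h⟩ X
  obtain ⟨x, y, hx, hy, -, h⟩ := exists_full_iso
    (.trans _ _ _ (.rel _ _ ⟨F.map s, F.map_isQuasiIso hs⟩) hX)
  exact ⟨Z, x, y, hx, hy, h, hZ⟩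

/-- Finiteness of the sum is what makes the extension property applicable, as it treats only
finitely many sequences at once. -/
theorem Bar.exists_cells {n : ℕ} {A B : D.Ob} {g : G} {z : F.Bar n A B}
    (hz : z ∈ Bar.gr F n A B g) : ∃ (N : ℕ) (r : Fin N → k) (c : Fin N → F.Cell n A B),
      z = ∑ i, r i • Bar.mk (c i) := by
  obtain ⟨N, r, c, rfl⟩ := Submodule.mem_span_set'.1 hz
  choose c' _ hc' using fun i => (c i).2
  exact ⟨N, r, c', by simp only [hc']⟩

/-- The object `A'`, and with it the contraction, is chosen for the cells of the given cycle `z`.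
The contraction identity holds for each of these cells, hence for `z`, and its second term vanishes
because `z` is a cycle. -/
theorem Bar.exists_d_eq (hF : F.IsEquivalence) {n : ℕ} {A B : D.Ob} {g : G}
    {z : F.Bar (n + 1) A B} (hz : z ∈ Bar.gr F (n + 1) A B g) (hd : Bar.d n z = 0) :
    ∃ y ∈ Bar.gr F (n + 2) A B g, Bar.d (n + 1) y = z := by
  obtain ⟨N, r, c, e⟩ := Bar.exists_cells hz
  obtain ⟨A', x, y, hx, hy, hxy, hS⟩ := exists_transversal hF A
    (List.ofFn fun i => List.ofFn (c i).seq.obj) (by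
      intro L hL
      obtain ⟨i, rfl⟩ := (List.mem_ofFn' _ _).1 hL
      exact ⟨by simp, (c i).seq.tr⟩)
  have key : Bar.d (n + 1) (Bar.contraction hF.isFullyFaithful x y z) =
      (-1 : ℤ) ^ (n + 1) • z + Bar.contraction hF.isFullyFaithful x y (Bar.d n z) := by
    rw [e]
    simp only [map_sum, map_smul, Finset.smul_sum, ← Finset.sum_add_distrib]
    refine Finset.sum_congr rfl fun i _ => ?_
    rw [Bar.d_contraction_mk _ _ _ hxy _ (hS _ ((List.mem_ofFn' _ _).2 ⟨i, rfl⟩)), smul_add,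
      smul_comm]
  rw [hd, map_zero, add_zero] at key
  -- The sign cancels the one in front of `z` in the contraction identity.
  refine ⟨(-1 : ℤ) ^ (n + 1) • Bar.contraction hF.isFullyFaithful x y z,
    zsmul_mem (Bar.contraction_mem _ _ _ hx hy hz) _, ?_⟩
  rw [map_zsmul, key, smul_smul, ← mul_pow]
  simp

/-- The values of the augmentation on the generators. -/
noncomputable def augGenMap [Parity G] (F : PrecatFunctor C D) : GenMap F 0 (twistedBimod D 0) where
  val X := MultilinearMap.constOfIsEmpty k _ (Full.id (F.obj (X.obj 0)))
  val_mem X a d _ := by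
    change Full.id (F.obj (X.obj 0)) ∈ Full.gr _ _ (0 + ∑ l, d l)
    simpa using Full.id_mem (F.obj (X.obj 0))

/-- The augmentation of the bar construction. -/
noncomputable def aug [Parity G] (F : PrecatFunctor C D) :
    Bimod.Hom (F.barBimod 0) (twistedBimod D 0) := F.augGenMap.hom

/-- The augmentation as a linear map. -/
noncomputable def Bar.aug [Parity G] {A B : D.Ob} : F.Bar 0 A B →ₗ[k] D.Full A B := F.aug.app

theorem Bar.aug_mk [Parity G] {A B : D.Ob} (c : F.Cell 0 A B) :
    Bar.aug (Bar.mk c) = Full.comp c.left c.right := by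
  refine (GenMap.hom_mk F.augGenMap c).trans ?_
  change Full.comp c.left (Full.comp (Full.id _) (Full.twist 0 c.right)) = _
  rw [Full.twist_zero]
  exact congrArg (Full.comp c.left) (Full.id_comp c.right)

/-- Both faces of a cell of length one augment to the product of its three entries, and they enter
the differential with opposite signs. -/
theorem Bar.aug_d [Parity G] {A B : D.Ob} (z : F.Bar 1 A B) : Bar.aug (Bar.d 0 z) = 0 := by
  have face (f : Fin 1 ↪o Fin 2) (c : F.Cell 1 A B) : Bar.aug (Bar.face f (Bar.mk c)) =
      Full.comp c.left (Full.comp (F.mapFull (c.seq.prod c.str 0 (Fin.last 1))) c.right) := by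
    rw [Bar.face_mk]
    refine (Bar.aug_mk _).trans ?_
    rw [← TrSeq.comp_prod c.seq c.str (Fin.zero_le (f 0)) (Fin.le_last (f 0)), mapFull_comp,
      Full.assoc]
    exact Full.assoc _ _ _
  have : Bar.aug ∘ₗ (Bar.d 0 : F.Bar 1 A B →ₗ[k] _) = 0 := Bar.hom_ext fun c => by
    rw [LinearMap.comp_apply, Bar.d, Fin.sum_univ_two, LinearMap.add_apply, map_add,
      LinearMap.smul_apply, LinearMap.smul_apply, map_zsmul, map_zsmul]
    rw [face, face]
    simp
  exact LinearMap.congr_fun this z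

/-- Surjectivity needs no transversality: `z` factors as `A → F A' → A → B`, and the section places
`y` on the left and `x` followed by `z` on the right. -/
theorem exists_aug_eq [Parity G] (hF : F.IsEquivalence) {A B : D.Ob} {g : G}
    {z : (twistedBimod D (0 : G)).carrier A B} (hz : z ∈ (twistedBimod D (0 : G)).gr A B g) :
    ∃ y ∈ (F.barBimod 0).gr A B g, F.aug.app y = z := by
  obtain ⟨A', x, y, hx, hy, hxy, -⟩ := exists_transversal hF A [] (by simp)
  refine ⟨Bar.section₀ (F := F) x y z, Bar.mk_mem_gr ⟨fun _ => 0, hy, fun l => l.elim0, ?_⟩, ?_⟩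
  · have := Full.comp_mem hx hz
    rwa [zero_add, zero_add, ← sub_zero g] at this
  · refine (Bar.aug_mk _).trans ?_
    refine (Full.assoc _ _ _).symm.trans ?_
    exact (congrArg (fun q => Full.comp q z) hxy).trans (Full.id_comp z)

/-- As in higher degrees, except that the homotopy starts from the identity minus the section
composed with the augmentation. On the kernel of the augmentation the second term disappears. -/
theorem Bar.exists_d_zero_eq [Parity G] (hF : F.IsEquivalence) {A B : D.Ob} {g : G}
    {z : F.Bar 0 A B} (hz : z ∈ Bar.gr F 0 A B g) (ha : Bar.aug z = 0) :
    ∃ y ∈ Bar.gr F 1 A B g, Bar.d 0 y = z := by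
  obtain ⟨N, r, c, e⟩ := Bar.exists_cells hz
  obtain ⟨A', x, y, hx, hy, hxy, hS⟩ := exists_transversal hF A
    (List.ofFn fun i => List.ofFn (c i).seq.obj) (by
      intro L hL
      obtain ⟨i, rfl⟩ := (List.mem_ofFn' _ _).1 hL
      exact ⟨by simp, (c i).seq.tr⟩)
  have key : Bar.d 0 (Bar.contraction hF.isFullyFaithful x y z) =
      z - Bar.section₀ (F := F) x y (Bar.aug z) := by
    rw [e]
    simp only [map_sum, map_smul, ← Finset.sum_sub_distrib]
    refine Finset.sum_congr rfl fun i _ => ?_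
    rw [Bar.d_contraction_mk_zero _ _ _ hxy _ (hS _ ((List.mem_ofFn' _ _).2 ⟨i, rfl⟩)), smul_sub]
    rw [Bar.aug_mk]
  refine ⟨_, Bar.contraction_mem _ _ _ hx hy hz, key.trans ?_⟩
  rw [ha, map_zero, sub_zero]

end GradedPrecat.PrecatFunctor

/-! ### Recursive choices and lifting of graded multilinear maps -/

/-- Dependent choice with an invariant. In the recursions of homological algebra below, `P` is the
condition under which the next lift exists and `R` is the equation that this lift satisfies. -/
theorem exists_seq_of_step {α : ℕ → Type*} (P : ∀ n, α n → Prop)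
    (R : ∀ n, α n → α (n + 1) → Prop) (a₀ : α 0) (h₀ : P 0 a₀)
    (step : ∀ n a, P n a → ∃ a', P (n + 1) a' ∧ R n a a') :
    ∃ a : ∀ n, α n, a 0 = a₀ ∧ ∀ n, R n (a n) (a (n + 1)) := by
  choose f hf hR using step
  let s : ∀ n, {a : α n // P n a} :=
    fun n => Nat.rec ⟨a₀, h₀⟩ (fun n a => ⟨f n a.1 a.2, hf n a.1 a.2⟩) n
  exact ⟨fun n => (s n).1, rfl, fun n => hR n (s n).1 (s n).2⟩

/-- A multilinear map on direct sums is given by its restrictions to summands. -/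
theorem MultilinearMap.exists_of_summands {ι : Type*} [DecidableEq ι] {n : ℕ}
    {A : Fin n → ι → Type*}
    [∀ l g, AddCommGroup (A l g)] [∀ l g, Module k (A l g)] {V : Type*} [AddCommGroup V]
    [Module k V] (s : ∀ d : Fin n → ι, MultilinearMap k (fun l => A l (d l)) V) :
    ∃ s' : MultilinearMap k (fun l => DirectSum ι (A l)) V, ∀ (d : Fin n → ι) (x : ∀ l, A l (d l)),
      s' (fun l => DirectSum.lof k ι (A l) (d l) (x l)) = s d x := by
  refine ⟨MultilinearMap.fromDirectSumEquiv s, fun d x => ?_⟩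
  exact MultilinearMap.fromDirectSumEquiv_lof s d x

/-- Multilinear maps of graded vector spaces lift along linear maps. -/
theorem MultilinearMap.exists_graded_lift {n : ℕ} {M : Fin n → Type*} [∀ l, AddCommGroup (M l)]
    [∀ l, Module k (M l)] {A : ∀ l, G → Submodule k (M l)}
    (hA : ∀ l, DirectSum.IsInternal (A l)) {V W : Type*} [AddCommGroup V] [Module k V]
    [AddCommGroup W] [Module k W] (π : V →ₗ[k] W) (B : G → Submodule k V)
    (f : MultilinearMap k M W) (h : ∀ (a : ∀ l, M l) (d : Fin n → G), (∀ l, a l ∈ A l (d l)) →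
      ∃ y ∈ B (∑ l, d l), π y = f a) :
    ∃ s : MultilinearMap k M V, (∀ a, π (s a) = f a) ∧
      ∀ (a : ∀ l, M l) (d : Fin n → G), (∀ l, a l ∈ A l (d l)) → s a ∈ B (∑ l, d l) := by
  have key (d : Fin n → G) : ∃ s : MultilinearMap k (fun l => A l (d l)) V,
      (∀ a, π (s a) = f fun l => a l) ∧ ∀ a, s a ∈ B (∑ l, d l) := by
    -- For a fixed multidegree, `π` is restricted to the component in which the lift must lie. The
    -- hypothesis `h` says that `f` takes its values in the range of this restriction.
    let π' : B (∑ l, d l) →ₗ[k] W := π ∘ₗ (B (∑ l, d l)).subtype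
    let f' : MultilinearMap k (fun l => A l (d l)) (LinearMap.range π') :=
      (f.compLinearMap fun l => (A l (d l)).subtype).codRestrict (LinearMap.range π') fun a => by
        obtain ⟨y, hy, e⟩ := h (fun l => a l) d fun l => (a l).2
        exact ⟨⟨y, hy⟩, e⟩
    -- Over a field the tensor product of the homogeneous components is projective, so the linear
    -- map that represents `f'` lifts along the surjection onto the range.
    obtain ⟨s, hs⟩ := Module.projective_lifting_property π'.rangeRestrict (PiTensorProduct.lift f')
      π'.surjective_rangeRestrict
    refine ⟨((B (∑ l, d l)).subtype ∘ₗ s).compMultilinearMap (PiTensorProduct.tprod k),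
      fun a => ?_, fun a => (s (PiTensorProduct.tprod k a)).2⟩
    have := congrArg Subtype.val (LinearMap.congr_fun hs (PiTensorProduct.tprod k a))
    rw [PiTensorProduct.lift.tprod] at this
    exact this
  choose s hs hsB using key
  -- The lifts for the various multidegrees are independent of one another and are glued along the
  -- direct sum decompositions.
  obtain ⟨s', hs'⟩ :=
    exists_of_summands (k := k) (A := fun l g => A l g) s
  let e (l : Fin n) := LinearEquiv.ofBijective (DirectSum.coeLinearMap (A l)) (hA l)
  have he (l : Fin n) (g : G) (x : A l g) :
      (e l).symm x = DirectSum.lof k G (fun g => A l g) g x := by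
    rw [LinearEquiv.symm_apply_eq]
    exact (DirectSum.coeLinearMap_lof (A l) g x).symm
  refine ⟨s'.compLinearMap fun l => (e l).symm.toLinearMap, fun a => ?_, fun a d ha => ?_⟩
  · have : π.compMultilinearMap s' = f.compLinearMap fun l => (e l).toLinearMap := by
      refine MultilinearMap.directSum_ext fun d => ?_
      ext x
      simp only [MultilinearMap.compLinearMap_apply, LinearMap.compMultilinearMap_apply]
      rw [hs', hs]
      congr 1
      funext l
      exact (DirectSum.coeLinearMap_lof (A l) (d l) (x l)).symm
    have := congrArg (fun q => q fun l => (e l).symm (a l)) this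
    simpa using this
  · have : (s'.compLinearMap fun l => (e l).symm.toLinearMap) a = s d fun l => ⟨a l, ha l⟩ := by
      rw [← hs']
      simp only [MultilinearMap.compLinearMap_apply]
      congr 1
      funext l
      exact he l (d l) ⟨a l, ha l⟩
    rw [this]
    exact hsB d _

/-! ### Projectivity of the bar construction and the comparison theorem -/

namespace GradedPrecat.PrecatFunctor

open NonunitalGradedPrecat

variable {C C' D : GradedPrecat.{u, v, w, t} k G} {F : PrecatFunctor C D} {F' : PrecatFunctor C' D}

variable (F) in
/-- The generator of the bar construction that belongs to a string. -/
def Cell.gen {n : ℕ} (X : C.TrSeq n) (a : X.Str) :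
    F.Cell n (F.obj (X.obj 0)) (F.obj (X.obj (Fin.last n))) := ⟨X, Full.id _, a, Full.id _⟩

/-- Every cell is a translate of a generator, so a bimodule morphism out of the bar construction is
determined by its values on the generators. -/
theorem Cell.gen_act {n : ℕ} {A B : D.Ob} (c : F.Cell n A B) :
    (Cell.gen F c.seq c.str).act c.left c.right = c :=
  Cell.ext_of_seq (X := c.seq) (Full.comp_id _) rfl (Full.id_comp _)

theorem Cell.isHomog_gen {n : ℕ} (X : C.TrSeq n) (a : X.Str) (d : Fin n → G)
    (h : ∀ l, a l ∈ C.gr (X.obj l.castSucc) (X.obj l.succ) (d l)) :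
    (Cell.gen F X a).IsHomog (∑ l, d l) := by
  obtain ⟨e, he⟩ := exists_partialSum d
  -- The left coefficient is an identity, of degree zero, so the potential is normalized to vanish
  -- at the first object.
  refine ⟨fun l => e l - e 0, ?_, fun l => ?_, ?_⟩
  · beta_reduce
    rw [sub_self]
    exact Full.id_mem _
  · rw [sub_sub_sub_cancel_right, ← he]
    exact h l
  · simp only [he, sum_fin_sub, sub_self]
    exact Full.id_mem _

variable (F) in
/-- The generators of the bar construction depend linearly on the entries of the string. -/
noncomputable def Bar.gen {n : ℕ} (X : C.TrSeq n) :
    MultilinearMap k (fun l : Fin n => C.Hom (X.obj l.castSucc) (X.obj l.succ))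
      (F.Bar n (F.obj (X.obj 0)) (F.obj (X.obj (Fin.last n)))) where
  toFun a := Bar.mk (Cell.gen F X a)
  map_update_add' a l x y := by
    rename_i inst
    obtain rfl := Subsingleton.elim inst (instDecidableEqFin n)
    refine (Bar.mk_comb (.str (r := (1 : k)) (s := (1 : k)) (b := Function.update a l x)
      (c := Function.update a l y) X (Full.id _) (l := l) ⟨fun q hq => by simp [hq],
        fun q hq => by simp [hq], by simp⟩ (Full.id _))).trans ?_
    rw [one_smul, one_smul]
    rfl
  map_update_smul' a l r x := by
    rename_i inst
    obtain rfl := Subsingleton.elim inst (instDecidableEqFin n)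
    refine (Bar.mk_comb (.str (r := r) (s := (0 : k)) (b := Function.update a l x)
      (c := Function.update a l x) X (Full.id _) (l := l) ⟨fun q hq => by simp [hq],
        fun q hq => by simp [hq], by simp⟩ (Full.id _))).trans ?_
    rw [zero_smul, add_zero]
    rfl

theorem hom_app_mk {n : ℕ} {M : Bimod D} (f : Bimod.Hom (F.barBimod n) M) {A B : D.Ob}
    (c : F.Cell n A B) :
    f.app (Bar.mk c) = M.act c.left c.right (f.app (Bar.mk (Cell.gen F c.seq c.str))) := by
  refine Eq.trans (congrArg f.app (Eq.symm ?_)) (f.app_act c.left c.right _)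
  exact (Bar.act_mk _ _ _).trans (congrArg Bar.mk (Cell.gen_act c))

theorem hom_app_eq {n : ℕ} {M : Bimod D} (f f' : Bimod.Hom (F.barBimod n) M)
    (h : ∀ (X : C.TrSeq n) (a : X.Str),
      f.app (Bar.mk (Cell.gen F X a)) = f'.app (Bar.mk (Cell.gen F X a))) {A B : D.Ob}
    (z : F.Bar n A B) : f.app z = f'.app z := by
  have : (f.app : F.Bar n A B →ₗ[k] M.carrier A B) = f'.app := Bar.hom_ext fun c => by
    refine (hom_app_mk f c).trans ?_
    rw [h]
    exact (hom_app_mk f' c).symm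
  exact LinearMap.congr_fun this z

/-- The bar construction consists of projective bimodules. -/
theorem exists_hom_lift {n : ℕ} {M N : Bimod D} (π : Bimod.Hom M N)
    (x : Bimod.Hom (F.barBimod n) N) (h : ∀ {A B : D.Ob} {g : G} (z : F.Bar n A B),
      z ∈ Bar.gr F n A B g → ∃ y ∈ M.gr A B g, π.app y = x.app z) :
    ∃ y : Bimod.Hom (F.barBimod n) M, ∀ {A B : D.Ob} (z : F.Bar n A B),
      π.app (y.app z) = x.app z := by
  -- Lifts are chosen only on the strings of each sequence, where the problem is one about graded
  -- vector spaces. The bimodule action extends them to all cells, and `hom_app_eq` reduces the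
  -- verification to generators.
  have key (X : C.TrSeq n) := MultilinearMap.exists_graded_lift
    (fun l : Fin n => C.isInternal (X.obj l.castSucc) (X.obj l.succ)) π.app
    (M.gr (F.obj (X.obj 0)) (F.obj (X.obj (Fin.last n))))
    (LinearMap.compMultilinearMap (x.app : F.Bar n _ _ →ₗ[k] _) (Bar.gen F X))
    (fun a d ha => h _ (Bar.mk_mem_gr (Cell.isHomog_gen X a d ha)))
  choose s hs hm using key
  let s' : GenMap F n M := ⟨s, hm⟩
  refine ⟨s'.hom, fun z => hom_app_eq (s'.hom.comp π) x (fun X a => ?_) z⟩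
  refine Eq.trans ?_ (hs X a)
  refine congrArg π.app ((GenMap.hom_mk s' _).trans ?_)
  exact M.act_id _

/-- Comparison: bar constructions map to each other. -/
theorem exists_comparison [Parity G] (F : PrecatFunctor C D) (hF' : F'.IsEquivalence) :
    ∃ f : ∀ n, Bimod.Hom (F.barBimod n) (F'.barBimod n),
      (∀ {A B : D.Ob} (z : F.Bar 0 A B), F'.aug.app ((f 0).app z) = F.aug.app z) ∧
      ∀ (n : ℕ) {A B : D.Ob} (z : F.Bar (n + 1) A B),
        (F'.barD n).app ((f (n + 1)).app z) = (f n).app ((F.barD n).app z) := by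
  -- The augmentation of `F'` is surjective on homogeneous elements, which starts the recursion.
  obtain ⟨f₀, hf₀⟩ := exists_hom_lift F'.aug F.aug fun z hz => exists_aug_eq hF' (F.aug.app_mem hz)
  refine Exists.elim (exists_seq_of_step
    (α := fun n => Bimod.Hom (F.barBimod n) (F'.barBimod n))
    -- The invariant: the morphism sends boundaries of homogeneous chains to boundaries. This is the
    -- hypothesis of `exists_hom_lift` for the next stage.
    (fun n f => ∀ {A B : D.Ob} {g : G} (z : F.Bar (n + 1) A B), z ∈ Bar.gr F (n + 1) A B g →
      ∃ y ∈ Bar.gr F' (n + 1) A B g, Bar.d n y = f.app (Bar.d n z))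
    (fun n f f' => ∀ {A B : D.Ob} (z : F.Bar (n + 1) A B),
        (F'.barD n).app (f'.app z) = f.app ((F.barD n).app z)) f₀ ?_ ?_) ?_
  · intro A B g z hz
    refine Bar.exists_d_zero_eq hF' (f₀.app_mem (Bar.d_mem 0 hz)) ?_
    exact (hf₀ (Bar.d 0 z)).trans (Bar.aug_d z)
  · intro n f hf
    obtain ⟨f', hf'⟩ := exists_hom_lift (F'.barD n) ((F.barD n).comp f) hf
    refine ⟨f', fun z hz => ?_, hf'⟩
    -- By exactness it suffices that the image of a boundary under `f'` is a cycle; this follows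
    -- from the equation for `f'` and `d ∘ d = 0`.
    refine Bar.exists_d_eq hF' (f'.app_mem (Bar.d_mem (n + 1) hz)) ?_
    refine (hf' (Bar.d (n + 1) z)).trans ?_
    change f.app (Bar.d n (Bar.d (n + 1) z)) = 0
    rw [Bar.d_d]
    exact map_zero f.app
  · rintro f ⟨rfl, hf⟩
    exact ⟨f, hf₀, hf⟩

/-- Morphisms between bar constructions that induce zero on augmentations are null-homotopic. -/
theorem exists_homotopy [Parity G] (hF' : F'.IsEquivalence)
    (f : ∀ n, Bimod.Hom (F.barBimod n) (F'.barBimod n))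
    (h₀ : ∀ {A B : D.Ob} (z : F.Bar 0 A B), F'.aug.app ((f 0).app z) = 0)
    (hf : ∀ (n : ℕ) {A B : D.Ob} (z : F.Bar (n + 1) A B),
        (F'.barD n).app ((f (n + 1)).app z) = (f n).app ((F.barD n).app z)) :
    ∃ h : ∀ n, Bimod.Hom (F.barBimod n) (F'.barBimod (n + 1)),
      (∀ {A B : D.Ob} (z : F.Bar 0 A B), (F'.barD 0).app ((h 0).app z) = (f 0).app z) ∧
      ∀ (n : ℕ) {A B : D.Ob} (z : F.Bar (n + 1) A B),
        (F'.barD (n + 1)).app ((h (n + 1)).app z) =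
          (f (n + 1)).app z - (h n).app ((F.barD n).app z) := by
  obtain ⟨s₀, hs₀⟩ := exists_hom_lift (F'.barD 0) (f 0) fun z hz =>
    Bar.exists_d_zero_eq hF' ((f 0).app_mem hz) (h₀ z)
  refine Exists.elim (exists_seq_of_step
    (α := fun n => Bimod.Hom (F.barBimod n) (F'.barBimod (n + 1)))
    -- The invariant `d s_n d = f_n d` says that `f_{n+1} - s_n d` takes its values in cycles; its
    -- lift along the bar differential is the next stage of the homotopy.
    (fun n s => ∀ {A B : D.Ob} (z : F.Bar (n + 1) A B),
      (F'.barD n).app (s.app ((F.barD n).app z)) = (f n).app ((F.barD n).app z))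
    (fun n s s' => ∀ {A B : D.Ob} (z : F.Bar (n + 1) A B),
      (F'.barD (n + 1)).app (s'.app z) = (f (n + 1)).app z - s.app ((F.barD n).app z)) s₀ ?_ ?_) ?_
  · intro A B z
    exact hs₀ (Bar.d 0 z)
  · intro n s hs
    obtain ⟨s', hs'⟩ := exists_hom_lift (F'.barD (n + 1)) ((f (n + 1)).sub ((F.barD n).comp s))
      fun z hz => Bar.exists_d_eq hF' (((f (n + 1)).sub ((F.barD n).comp s)).app_mem hz) <| by
        refine (map_sub (F'.barD n).app _ _).trans ?_
        exact sub_eq_zero.2 ((hf n z).trans (hs z).symm)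
    refine ⟨s', fun z => ?_, hs'⟩
    refine (hs' (Bar.d (n + 1) z)).trans ?_
    refine sub_eq_self.2 ?_
    change s.app (Bar.d n (Bar.d (n + 1) z)) = 0
    rw [Bar.d_d]
    exact map_zero s.app
  · rintro s ⟨rfl, hs⟩
    exact ⟨s, hs₀, hs⟩

end GradedPrecat.PrecatFunctor

/-! ### Isomorphisms on homology in terms of elements -/

open CategoryTheory in
/-- An elementwise criterion for a morphism of complexes of modules to induce an isomorphism on
homology. -/
theorem isIso_homologyMap_of_elements {R : Type*} [Ring R] {ι : Type*} {c : ComplexShape ι}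
    {K L : HomologicalComplex (ModuleCat R) c} (φ : K ⟶ L) {i₀ i i₁ : ι}
    (h₀ : c.prev i = i₀) (h₁ : c.next i = i₁)
    (surj : ∀ y : L.X i, L.d i i₁ y = 0 →
      ∃ x : K.X i, K.d i i₁ x = 0 ∧ ∃ z : L.X i₀, L.d i₀ i z = φ.f i x - y)
    (inj : ∀ x : K.X i, K.d i i₁ x = 0 → (∃ z : L.X i₀, L.d i₀ i z = φ.f i x) →
      ∃ z : K.X i₀, K.d i₀ i z = x) :
    IsIso (HomologicalComplex.homologyMap φ i) := by
  have iCycles_injective (M : HomologicalComplex (ModuleCat R) c) :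
      Function.Injective (M.iCycles i) := (ModuleCat.mono_iff_injective _).1 inferInstance
  have π_surjective (M : HomologicalComplex (ModuleCat R) c) :
      Function.Surjective (M.homologyπ i) := (ModuleCat.epi_iff_surjective _).1 inferInstance
  have d_iCycles (M : HomologicalComplex (ModuleCat R) c) (x : M.cycles i) :
      M.d i i₁ (M.iCycles i x) = 0 :=
    ConcreteCategory.congr_hom (M.iCycles_d i i₁) x
  have exists_cycle (M : HomologicalComplex (ModuleCat R) c) (x : M.X i) (hx : M.d i i₁ x = 0) :
      ∃ y, M.iCycles i y = x :=
    (ShortComplex.moduleCat_exact_iff _).1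
      (ShortComplex.exact_of_f_is_kernel (.mk _ _ (M.iCycles_d i i₁)) (M.cyclesIsKernel i i₁ h₁))
      x hx
  have iCycles_toCycles (M : HomologicalComplex (ModuleCat R) c) (x : M.X i₀) :
      M.iCycles i (M.toCycles i₀ i x) = M.d i₀ i x :=
    ConcreteCategory.congr_hom (M.toCycles_i i₀ i) x
  have π_toCycles (M : HomologicalComplex (ModuleCat R) c) (x : M.X i₀) :
      M.homologyπ i (M.toCycles i₀ i x) = 0 :=
    ConcreteCategory.congr_hom (M.toCycles_comp_homologyπ i₀ i) x
  have exists_boundary (M : HomologicalComplex (ModuleCat R) c) (x : M.cycles i)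
      (hx : M.homologyπ i x = 0) : ∃ y, M.toCycles i₀ i y = x :=
    (ShortComplex.moduleCat_exact_iff _).1
      (ShortComplex.exact_of_g_is_cokernel (.mk _ _ (M.toCycles_comp_homologyπ i₀ i))
        (M.homologyIsCokernel i₀ i h₀)) x hx
  have naturality (x : K.cycles i) : HomologicalComplex.homologyMap φ i (K.homologyπ i x) =
      L.homologyπ i (HomologicalComplex.cyclesMap φ i x) :=
    ConcreteCategory.congr_hom (HomologicalComplex.homologyπ_naturality φ i) x
  have cyclesMap_i (x : K.cycles i) : L.iCycles i (HomologicalComplex.cyclesMap φ i x) =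
      φ.f i (K.iCycles i x) :=
    ConcreteCategory.congr_hom (HomologicalComplex.cyclesMap_i φ i) x
  refine (ConcreteCategory.isIso_iff_bijective _).2 ⟨?_, fun y => ?_⟩
  · refine (injective_iff_map_eq_zero (HomologicalComplex.homologyMap φ i).hom).2 fun x hx => ?_
    obtain ⟨x, rfl⟩ := π_surjective K x
    obtain ⟨z, hz⟩ := exists_boundary L _ ((naturality x).symm.trans hx)
    obtain ⟨w, hw⟩ := inj (K.iCycles i x) (d_iCycles K x)
      ⟨z, by rw [← cyclesMap_i, ← hz, iCycles_toCycles]⟩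
    have : x = K.toCycles i₀ i w := iCycles_injective K (by rw [iCycles_toCycles, hw])
    rw [this, π_toCycles]
  · obtain ⟨y, rfl⟩ := π_surjective L y
    obtain ⟨x, hx, z, hz⟩ := surj (L.iCycles i y) (d_iCycles L y)
    obtain ⟨x, rfl⟩ := exists_cycle K x hx
    refine ⟨K.homologyπ i x, ?_⟩
    have : HomologicalComplex.cyclesMap φ i x = L.toCycles i₀ i z + y :=
      iCycles_injective L (by rw [map_add, iCycles_toCycles, hz, cyclesMap_i, sub_add_cancel])
    rw [naturality, this, map_add, π_toCycles, zero_add]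

/-! ### Cochains as bimodule morphisms, and the bar construction of `D` -/

namespace GradedPrecat.PrecatFunctor

open NonunitalGradedPrecat

variable {C D : GradedPrecat.{u, v, w, t} k G} {F : PrecatFunctor C D}

variable (D) in
/-- The identity functor. -/
def refl : PrecatFunctor D D where
  obj X := X
  tr h := by simpa using h
  map := LinearMap.id
  map_mem _ _ _ h := h
  map_comp _ _ _ := rfl
  map_isQuasiIso h := h

variable (D) in
theorem isEquivalence_refl : (refl D).IsEquivalence where
  isFullyFaithful _ _ _ := Function.bijective_id
  exists_quasiIso Y := ⟨Y, .refl Y⟩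

theorem mapFull_refl {X Y : D.Ob} (a : D.Full X Y) : (refl D).mapFull a = a := by
  obtain ⟨e⟩ := a
  refine congrArg (Quot.mk _) ?_
  clear * -
  induction e with
  | of h f => rfl
  | inv => rfl
  | id => rfl
  | comp a b ha hb => exact congrArg₂ Expr.comp ha hb
  | zero => rfl
  | add a b ha hb => exact congrArg₂ Expr.add ha hb
  | smul r a ha => exact congrArg (Expr.smul r) ha

section Cochains

variable [Parity G] {n : ℕ} {p : G}

variable (F) in
/-- The morphism of bimodules that belongs to a cochain. -/
noncomputable def evalHom (φ : CC C.toNonunitalGradedPrecat n p) :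
    Bimod.Hom (F.barBimod n) (twistedBimod D p) :=
  GenMap.hom
    { val := fun X => (F.mapFull : C.Full (X.obj 0) (X.obj (Fin.last n)) →ₗ[k]
        D.Full _ _).compMultilinearMap (φ.1 X)
      val_mem := fun X a d ha => F.mapFull_mem (φ.2 X a d ha) }

variable (F) in
/-- The evaluation of a cochain on the bar construction. -/
noncomputable def Bar.eval (φ : CC C.toNonunitalGradedPrecat n p) {A B : D.Ob} :
    F.Bar n A B →ₗ[k] D.Full A B := (F.evalHom φ).app

theorem Bar.eval_mk (φ : CC C.toNonunitalGradedPrecat n p) {A B : D.Ob} (c : F.Cell n A B) :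
    Bar.eval F φ (Bar.mk c) =
      Full.comp₃ c.left (F.mapFull (φ.1 c.seq c.str)) (Full.twist p c.right) :=
  GenMap.hom_mk _ c

/-- The sign of `transport` appears as the twist of the right factor, so the value is the one that
`twistedBimod` assigns to the face along `f`. -/
theorem mapFull_transport {m : ℕ} (f : Fin (m + 1) ↪o Fin (n + 1)) (φ : C.Coch m) (X : C.TrSeq n)
    (a : X.Str) : F.mapFull (transport p f φ X a) =
      Full.comp₃ (F.mapFull (X.prod a 0 (f 0))) (F.mapFull (φ (X.comap f) (X.comapStr f a)))
        (Full.twist p (F.mapFull (X.prod a (f (Fin.last m)) (Fin.last n)))) := by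
  have h := F.mapFull_twist p (X.prod a (f (Fin.last m)) (Fin.last n))
  rw [TrSeq.twist_prod p X a (Fin.le_last _)] at h
  refine (mapFull_comp₃ F (X.prod a 0 (f 0)) _ _).trans ?_
  exact congrArg (Full.comp₃ _ _) h

/-- The summand of index `i` of the Hochschild differential is evaluation on the face of index `i`,
with the same sign on both sides. Multiplicativity of the twist merges the sign of `transport` with
that of the right coefficient. -/
theorem Bar.eval_hochschildD (φ : CC C.toNonunitalGradedPrecat n p) {A B : D.Ob}
    (z : F.Bar (n + 1) A B) :
    Bar.eval F ⟨hochschildD p n φ.1, hochschildD_mem φ.2⟩ z = Bar.eval F φ (Bar.d n z) := by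
  have : Bar.eval F ⟨hochschildD p n φ.1, hochschildD_mem φ.2⟩ =
      Bar.eval F φ ∘ₗ (Bar.d n : F.Bar (n + 1) A B →ₗ[k] _) := Bar.hom_ext fun c => by
    rw [Bar.eval_mk, LinearMap.comp_apply, Bar.d, LinearMap.sum_apply, map_sum]
    have e : hochschildD p n φ.1 c.seq c.str = ∑ i : Fin (n + 2), (-1 : ℤ) ^ (n + (i : ℕ)) •
        transport p (Fin.succAboveOrderEmb i) φ.1 c.seq c.str := by
      simp only [hochschildD, LinearMap.sum_apply, LinearMap.smul_apply, Finset.sum_apply,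
        sum_apply, Pi.smul_apply, smul_apply]
    change Full.comp₃ c.left (F.mapFull (hochschildD p n φ.1 c.seq c.str)) _ = _
    rw [e]
    simp only [Full.comp₃, map_sum, LinearMap.sum_apply, map_zsmul, LinearMap.smul_apply]
    refine Finset.sum_congr rfl fun i _ => congrArg _ ?_
    rw [Bar.face_mk]
    refine Eq.trans ?_ (Bar.eval_mk φ _).symm
    refine (congrArg (fun x => Full.comp₃ c.left x (Full.twist p c.right))
      (mapFull_transport _ _ _ _)).trans ?_
    refine (Full.comp₃_comp₃ ..).trans ?_
    exact congrArg (Full.comp₃ _ _) (Full.twist_comp p _ _).symm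
  exact LinearMap.congr_fun this z

/-- The cochain that belongs to a morphism of bimodules. -/
noncomputable def cochain (hF : F.IsFullyFaithful)
    (θ : Bimod.Hom (F.barBimod n) (twistedBimod D p)) : CC C.toNonunitalGradedPrecat n p where
  val X := ((fullEquiv hF (X.obj 0) (X.obj (Fin.last n))).symm.toLinearMap ∘ₗ
    (θ.app : F.Bar n _ _ →ₗ[k] D.Full _ _)).compMultilinearMap (Bar.gen F X)
  property X a d ha := by
    refine mem_of_mapFull_mem hF ?_
    have := θ.app_mem (Bar.mk_mem_gr (Cell.isHomog_gen X a d ha))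
    exact (congrArg (· ∈ Full.gr _ _ (p + ∑ l, d l))
      ((fullEquiv hF (X.obj 0) (X.obj (Fin.last n))).apply_symm_apply _)).mpr this

theorem Bar.eval_gen (φ : CC C.toNonunitalGradedPrecat n p) (X : C.TrSeq n) (a : X.Str) :
    Bar.eval F φ (Bar.mk (Cell.gen F X a)) = F.mapFull (φ.1 X a) :=
  (Bar.eval_mk φ _).trans ((Full.id_comp _).trans (Full.comp_id _))

/-- Together with `Bar.eval_injective`, this identifies the cochains of length `n` and degree `p`
with the bimodule morphisms from `Bar F n` to `twistedBimod D p`. -/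
theorem Bar.eval_cochain (hF : F.IsFullyFaithful)
    (θ : Bimod.Hom (F.barBimod n) (twistedBimod D p)) {A B : D.Ob} (z : F.Bar n A B) :
    Bar.eval F (cochain hF θ) z = θ.app z :=
  hom_app_eq (F.evalHom (cochain hF θ)) θ (fun X a => (Bar.eval_gen _ X a).trans
    ((fullEquiv hF (X.obj 0) (X.obj (Fin.last n))).apply_symm_apply _)) z

theorem Bar.eval_injective (hF : F.IsFullyFaithful) {φ ψ : CC C.toNonunitalGradedPrecat n p}
    (h : ∀ {A B : D.Ob} (z : F.Bar n A B), Bar.eval F φ z = Bar.eval F ψ z) : φ = ψ := by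
  refine Subtype.ext (funext fun X => MultilinearMap.ext fun a => (mapFull_bijective hF _ _).1 ?_)
  rw [← Bar.eval_gen, ← Bar.eval_gen, h]

theorem Bar.eval_sub (φ ψ : CC C.toNonunitalGradedPrecat n p) {A B : D.Ob} (z : F.Bar n A B) :
    Bar.eval F (φ - ψ) z = Bar.eval F φ z - Bar.eval F ψ z := by
  have : (Bar.eval F (φ - ψ) : F.Bar n A B →ₗ[k] _) = Bar.eval F φ - Bar.eval F ψ :=
    Bar.hom_ext fun c => by
      rw [LinearMap.sub_apply, Bar.eval_mk, Bar.eval_mk, Bar.eval_mk]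
      change Full.comp₃ _ (F.mapFull (φ.1 c.seq c.str - ψ.1 c.seq c.str)) _ = _
      simp only [Full.comp₃, map_sub, LinearMap.sub_apply]
  exact LinearMap.congr_fun this z

theorem Bar.eval_zero {A B : D.Ob} (z : F.Bar n A B) :
    Bar.eval F (0 : CC C.toNonunitalGradedPrecat n p) z = 0 := by
  rw [← sub_self (0 : CC C.toNonunitalGradedPrecat n p), Bar.eval_sub, sub_self]

end Cochains

/-- The image of a cell in the bar construction of `D`. -/
def Cell.incl {n : ℕ} {A B : D.Ob} (c : F.Cell n A B) : (refl D).Cell n A B :=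
  ⟨F.mapSeq c.seq, c.left, F.mapStr c.seq c.str, c.right⟩

variable (F) in
/-- The morphism from the bar construction of `F` to the bar construction of `D`. -/
noncomputable def barIncl (n : ℕ) : Bimod.Hom (F.barBimod n) ((refl D).barBimod n) :=
  GenMap.hom
    { val := fun X => ((Bar.gen (refl D) (F.mapSeq X)).compLinearMap
        (fun l : Fin n => (F.map : C.Hom (X.obj l.castSucc) (X.obj l.succ) →ₗ[k] _)) :)
      val_mem := fun X a d ha => Bar.mk_mem_gr (Cell.isHomog_gen (F := refl D) (F.mapSeq X)
        (F.mapStr X a) d fun l => F.map_mem (X.tr_two l.castSucc_lt_succ) (ha l)) }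

/-- The morphism from the bar construction of `F` to the bar construction of `D`, as a linear
map. -/
noncomputable def Bar.incl {n : ℕ} {A B : D.Ob} : F.Bar n A B →ₗ[k] (refl D).Bar n A B :=
  (F.barIncl n).app

theorem Bar.incl_mk {n : ℕ} {A B : D.Ob} (c : F.Cell n A B) :
    Bar.incl (Bar.mk c) = Bar.mk c.incl := by
  refine (GenMap.hom_mk _ c).trans ?_
  refine (Bar.act_mk c.left c.right (Cell.gen (refl D) (F.mapSeq c.seq)
    (F.mapStr c.seq c.str))).trans ?_
  exact congrArg Bar.mk (Cell.gen_act c.incl)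

theorem Cell.face_incl {m n : ℕ} {A B : D.Ob} (f : Fin (m + 1) ↪o Fin (n + 1))
    (c : F.Cell n A B) : c.incl.face f = (c.face f).incl := by
  refine Cell.ext_of_seq (F := refl D) (X := F.mapSeq (c.seq.comap f)) ?_
    (comapStr_mapStr f c.seq c.str) ?_
  · exact congrArg (Full.comp c.left)
      ((mapFull_refl _).trans (prod_mapStr c.seq c.str 0 (f 0) (Fin.zero_le _)))
  · exact congrArg (fun x => Full.comp x c.right)
      ((mapFull_refl _).trans (prod_mapStr c.seq c.str (f (Fin.last m)) (Fin.last n)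
        (Fin.le_last _)))

theorem Bar.d_incl {n : ℕ} {A B : D.Ob} (z : F.Bar (n + 1) A B) :
    Bar.d n (Bar.incl z) = Bar.incl (Bar.d n z) := by
  have : Bar.d n ∘ₗ Bar.incl = Bar.incl ∘ₗ (Bar.d n : F.Bar (n + 1) A B →ₗ[k] _) :=
    Bar.hom_ext fun c => by
      simp only [LinearMap.comp_apply, Bar.incl_mk, Bar.d, LinearMap.sum_apply,
        LinearMap.smul_apply, map_sum, map_zsmul, Bar.face_mk, Cell.face_incl]
  exact LinearMap.congr_fun this z

theorem Bar.aug_incl [Parity G] {A B : D.Ob} (z : F.Bar 0 A B) :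
    Bar.aug (Bar.incl z) = Bar.aug z := by
  have : Bar.aug ∘ₗ Bar.incl = (Bar.aug : F.Bar 0 A B →ₗ[k] _) := Bar.hom_ext fun c => by
    rw [LinearMap.comp_apply, Bar.incl_mk, Bar.aug_mk, Bar.aug_mk]
    rfl
  exact LinearMap.congr_fun this z

/-- The inverse of `F_full` in the definition of `F^*` cancels against the `F_full` in the
evaluation on `Bar F`. Hence `F^*` becomes precomposition with the inclusion of bar constructions.
-/
theorem Bar.eval_pullback [Parity G] (hF : F.IsFullyFaithful) {n : ℕ} {p : G}
    (ψ : CC D.toNonunitalGradedPrecat n p) {A B : D.Ob} (z : F.Bar n A B) :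
    Bar.eval F ⟨pullback hF n ψ.1, pullback_mem hF ψ.2⟩ z = Bar.eval (refl D) ψ (Bar.incl z) := by
  have : Bar.eval F ⟨pullback hF n ψ.1, pullback_mem hF ψ.2⟩ =
      Bar.eval (refl D) ψ ∘ₗ (Bar.incl : F.Bar n A B →ₗ[k] _) := Bar.hom_ext fun c => by
    rw [LinearMap.comp_apply, Bar.incl_mk, Bar.eval_mk, Bar.eval_mk]
    refine congrArg (fun x => Full.comp₃ c.left x (Full.twist p c.right)) ?_
    exact (mapFull_pullback hF ψ.1 c.seq c.str).trans (mapFull_refl _).symm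
  exact LinearMap.congr_fun this z

end GradedPrecat.PrecatFunctor

/-! ### The homotopy equivalence of bar constructions and its effect on cocycles -/

namespace GradedPrecat.PrecatFunctor

open NonunitalGradedPrecat

variable {C D : GradedPrecat.{u, v, w, t} k G} {F : PrecatFunctor C D} [Parity G]

/-- A morphism between bar constructions as a linear map. -/
noncomputable def Bar.map {C' : GradedPrecat.{u, v, w, t} k G} {F' : PrecatFunctor C' D} {m n : ℕ}
    (f : Bimod.Hom (F.barBimod m) (F'.barBimod n)) {A B : D.Ob} :
    F.Bar m A B →ₗ[k] F'.Bar n A B := f.app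

/-- The bar construction of an equivalence is homotopy equivalent to the bar construction of its
target. -/
theorem exists_homotopyEquiv (hF : F.IsEquivalence) :
    ∃ (g : ∀ n, Bimod.Hom ((refl D).barBimod n) (F.barBimod n))
      (h : ∀ n, Bimod.Hom (F.barBimod n) (F.barBimod (n + 1)))
      (h' : ∀ n, Bimod.Hom ((refl D).barBimod n) ((refl D).barBimod (n + 1))),
      (∀ (n : ℕ) {A B : D.Ob} (z : (refl D).Bar (n + 1) A B),
        Bar.d n (Bar.map (g (n + 1)) z) = Bar.map (g n) (Bar.d n z)) ∧
      (∀ {A B : D.Ob} (z : F.Bar 0 A B),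
        Bar.d 0 (Bar.map (h 0) z) = Bar.map (g 0) (Bar.incl z) - z) ∧
      (∀ (n : ℕ) {A B : D.Ob} (z : F.Bar (n + 1) A B), Bar.d (n + 1) (Bar.map (h (n + 1)) z) =
        Bar.map (g (n + 1)) (Bar.incl z) - z - Bar.map (h n) (Bar.d n z)) ∧
      (∀ {A B : D.Ob} (z : (refl D).Bar 0 A B),
        Bar.d 0 (Bar.map (h' 0) z) = Bar.incl (Bar.map (g 0) z) - z) ∧
      ∀ (n : ℕ) {A B : D.Ob} (z : (refl D).Bar (n + 1) A B), Bar.d (n + 1) (Bar.map (h' (n + 1)) z) =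
        Bar.incl (Bar.map (g (n + 1)) z) - z - Bar.map (h' n) (Bar.d n z) := by
  -- The homotopy inverse exists because `Bar (refl D)` is projective and `Bar F` is exact.
  obtain ⟨g, hg₀, hg⟩ := exists_comparison (refl D) hF
  -- Both `g` and the inclusion respect the augmentations, so each composite minus the identity
  -- augments to zero and is null-homotopic.
  obtain ⟨h, hh₀, hh⟩ := exists_homotopy hF
    (fun n => ((F.barIncl n).comp (g n)).sub (Bimod.Hom.id _))
    (fun z => (map_sub F.aug.app _ _).trans
      (sub_eq_zero.2 ((hg₀ (Bar.incl z)).trans (Bar.aug_incl z))))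
    (fun n {A B} z => by
      refine (map_sub (F.barD n).app _ _).trans ?_
      refine congrArg (fun x => x - Bar.d n z) ?_
      refine (hg n (Bar.incl z)).trans ?_
      exact congrArg (g n).app (Bar.d_incl z))
  obtain ⟨h', hh₀', hh'⟩ := exists_homotopy (isEquivalence_refl D)
    (fun n => ((g n).comp (F.barIncl n)).sub (Bimod.Hom.id _))
    (fun z => (map_sub (refl D).aug.app _ _).trans
      (sub_eq_zero.2 ((Bar.aug_incl ((g 0).app z)).trans (hg₀ z))))
    (fun n {A B} z => by
      refine (map_sub ((refl D).barD n).app _ _).trans ?_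
      refine congrArg (fun x => x - Bar.d n z) ?_
      refine (Bar.d_incl ((g (n + 1)).app z)).trans ?_
      exact congrArg Bar.incl (hg n z))
  exact ⟨g, h, h', hg, hh₀, hh, hh₀', hh'⟩

/-- The differential of the Hochschild complex, applied to a cochain. -/
noncomputable def cochainD {p : G} {n : ℕ} (φ : CC C.toNonunitalGradedPrecat n p) :
    CC C.toNonunitalGradedPrecat (n + 1) p := ⟨hochschildD p n φ.1, hochschildD_mem φ.2⟩

theorem hochschildComplex_d_apply {p : G} {n : ℕ} (φ : CC C.toNonunitalGradedPrecat n p) :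
    (hochschildComplex C.toNonunitalGradedPrecat p).d n (n + 1) φ = cochainD φ := by
  rw [hochschildComplex_d]
  rfl

/-- A cocycle, regarded as a morphism on the bar complex, kills boundaries. -/
theorem Bar.eval_d_eq_zero {p : G} {n : ℕ} {φ : CC C.toNonunitalGradedPrecat n p}
    (hφ : cochainD φ = 0) {A B : D.Ob} (z : F.Bar (n + 1) A B) :
    Bar.eval F φ (Bar.d n z) = 0 := by
  rw [← Bar.eval_hochschildD]
  change Bar.eval F (cochainD φ) z = 0
  rw [hφ, Bar.eval_zero]

/-- The pullback of a cochain. -/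
noncomputable def pullbackCC (hF : F.IsFullyFaithful) {n : ℕ} {p : G}
    (ψ : CC D.toNonunitalGradedPrecat n p) : CC C.toNonunitalGradedPrecat n p :=
  ⟨pullback hF n ψ.1, pullback_mem hF ψ.2⟩

/-- Surjectivity on cohomology. Take `ψ = φ ∘ g`; then `F^* ψ - φ = φ ∘ (g ∘ incl - 1) = φ ∘ (d h +
h d) = (φ ∘ h) ∘ d`, since `φ ∘ d = 0`. So the difference is the coboundary of `φ ∘ h`. In degree
zero the term `h d` is absent and the two cochains coincide. -/
theorem exists_pullback_sub_eq (hF : F.IsEquivalence) {n : ℕ} {p : G}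
    (φ : CC C.toNonunitalGradedPrecat n p) (hφ : cochainD φ = 0) :
    ∃ ψ : CC D.toNonunitalGradedPrecat n p, cochainD ψ = 0 ∧
      match n with
      | 0 => pullbackCC hF.isFullyFaithful ψ = φ
      | _ + 1 => ∃ χ, cochainD χ = pullbackCC hF.isFullyFaithful ψ - φ := by
  obtain ⟨g, h, h', hg, hh₀, hh, hh₀', hh'⟩ := exists_homotopyEquiv hF
  have hE := (isEquivalence_refl D).isFullyFaithful
  have hψ {A B : D.Ob} (z : (refl D).Bar n A B) :
      Bar.eval (refl D) (cochain hE ((g n).comp (F.evalHom φ))) z =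
        Bar.eval F φ (Bar.map (g n) z) := Bar.eval_cochain hE _ z
  refine ⟨cochain hE ((g n).comp (F.evalHom φ)), Bar.eval_injective hE fun z => ?_, ?_⟩
  · refine (Bar.eval_hochschildD _ z).trans ?_
    rw [hψ, Bar.eval_zero, ← hg]
    exact Bar.eval_d_eq_zero hφ _
  · cases n with
    | zero =>
      refine Bar.eval_injective hF.isFullyFaithful fun z => ?_
      refine (Bar.eval_pullback _ _ z).trans ((hψ _).trans ?_)
      refine sub_eq_zero.1 ((map_sub (Bar.eval F φ) _ _).symm.trans ?_)
      rw [← hh₀]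
      exact Bar.eval_d_eq_zero hφ _
    | succ n =>
      refine ⟨cochain hF.isFullyFaithful ((h n).comp (F.evalHom φ)),
        Bar.eval_injective hF.isFullyFaithful fun z => ?_⟩
      refine (Bar.eval_hochschildD _ z).trans ((Bar.eval_cochain _ _ _).trans ?_)
      rw [Bar.eval_sub]
      refine Eq.trans ?_ (congrArg (fun x => x - Bar.eval F φ z)
        ((Bar.eval_pullback _ _ z).trans (hψ _))).symm
      refine Eq.trans ?_ (map_sub (Bar.eval F φ) _ _)
      refine (sub_eq_zero.1 ((map_sub (Bar.eval F φ) _ _).symm.trans ?_)).symm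
      refine (congrArg (Bar.eval F φ) (hh n z).symm).trans ?_
      exact Bar.eval_d_eq_zero hφ _

/-- Injectivity in degree zero. There `incl ∘ g - 1 = d h'`, which the cocycle `ψ` kills, so `ψ = ψ
∘ incl ∘ g = (F^* ψ) ∘ g = 0`. -/
theorem eq_zero_of_pullback_eq_zero (hF : F.IsEquivalence) {p : G}
    (ψ : CC D.toNonunitalGradedPrecat 0 p) (hψ : cochainD ψ = 0)
    (h : pullbackCC hF.isFullyFaithful ψ = 0) : ψ = 0 := by
  obtain ⟨g, -, h', hg, -, -, hh₀', -⟩ := exists_homotopyEquiv hF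
  refine Bar.eval_injective (isEquivalence_refl D).isFullyFaithful fun z => ?_
  have e₁ : Bar.eval (refl D) ψ (Bar.incl (Bar.map (g 0) z) - z) = 0 := by
    rw [← hh₀']
    exact Bar.eval_d_eq_zero hψ _
  have e₂ : Bar.eval (refl D) ψ (Bar.incl (Bar.map (g 0) z)) = 0 := by
    refine (Bar.eval_pullback hF.isFullyFaithful ψ _).symm.trans ?_
    refine (congrArg (fun q => Bar.eval F q (Bar.map (g 0) z)) h).trans ?_
    exact Bar.eval_zero _
  rw [map_sub, e₂, zero_sub, neg_eq_zero] at e₁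
  rw [e₁, Bar.eval_zero]

/-- Injectivity in positive degrees. The primitive is `χ = φ ∘ g - ψ ∘ h'`. Indeed `φ ∘ g ∘ d = φ ∘
d ∘ g = (F^* ψ) ∘ g = ψ ∘ incl ∘ g`, and `ψ ∘ (incl ∘ g - 1 - h' d) = ψ ∘ d ∘ h' = 0`, whence `χ ∘ d
= ψ`. -/
theorem exists_d_eq_of_pullback_eq_d (hF : F.IsEquivalence) {n : ℕ} {p : G}
    (ψ : CC D.toNonunitalGradedPrecat (n + 1) p) (hψ : cochainD ψ = 0)
    (φ : CC C.toNonunitalGradedPrecat n p) (h : cochainD φ = pullbackCC hF.isFullyFaithful ψ) :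
    ∃ χ, cochainD χ = ψ := by
  obtain ⟨g, -, h', hg, -, -, -, hh'⟩ := exists_homotopyEquiv hF
  have hE := (isEquivalence_refl D).isFullyFaithful
  refine ⟨cochain hE (((g n).comp (F.evalHom φ)).sub ((h' n).comp ((refl D).evalHom ψ))),
    Bar.eval_injective hE fun z => ?_⟩
  refine (Bar.eval_hochschildD _ z).trans ((Bar.eval_cochain _ _ _).trans ?_)
  change Bar.eval F φ (Bar.map (g n) (Bar.d n z)) -
    Bar.eval (refl D) ψ (Bar.map (h' n) (Bar.d n z)) = Bar.eval (refl D) ψ z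
  have e₁ : Bar.eval (refl D) ψ
      (Bar.incl (Bar.map (g (n + 1)) z) - z - Bar.map (h' n) (Bar.d n z)) = 0 := by
    rw [← hh']
    exact Bar.eval_d_eq_zero hψ _
  have e₂ : Bar.eval (refl D) ψ (Bar.incl (Bar.map (g (n + 1)) z)) =
      Bar.eval F φ (Bar.map (g n) (Bar.d n z)) := by
    refine (Bar.eval_pullback hF.isFullyFaithful ψ _).symm.trans ?_
    refine (congrArg (fun q => Bar.eval F q (Bar.map (g (n + 1)) z)) h.symm).trans ?_
    refine (Bar.eval_hochschildD φ _).trans ?_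
    rw [hg]
  rw [← e₂]
  refine sub_eq_zero.1 (Eq.trans ?_ e₁)
  rw [map_sub, map_sub]
  abel

end GradedPrecat.PrecatFunctor

end

/-- Degree zero is separate because nothing maps into it: `ComplexShape.prev` takes the value `0` at
`0` by convention, the corresponding differential is zero, and equality in cohomology is equality of
cocycles. -/
theorem mainTheorem2 {k : Type w} [Field k] {G : Type t} [AddCommGroup G] [DecidableEq G] [Parity G]
    {C D : GradedPrecat.{u, v, w, t} k G} (F : GradedPrecat.PrecatFunctor C D)
    (hF : F.IsEquivalence) (i : ℕ) (j : G) :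
    CategoryTheory.IsIso (HomologicalComplex.homologyMap
      (GradedPrecat.PrecatFunctor.pullbackHom hF.isFullyFaithful j) i) := by
  cases i with
  | zero =>
    refine isIso_homologyMap_of_elements _ (i₁ := 1) CochainComplex.prev_nat_zero
      (CochainComplex.next ℕ 0) (fun φ hφ => ?_) (fun ψ hψ hb => ?_)
    · obtain ⟨ψ, hψ, e⟩ := GradedPrecat.PrecatFunctor.exists_pullback_sub_eq hF (p := j) φ
        ((GradedPrecat.PrecatFunctor.hochschildComplex_d_apply (p := j) φ).symm.trans hφ)
      refine ⟨ψ, (GradedPrecat.PrecatFunctor.hochschildComplex_d_apply ψ).trans hψ, 0, ?_⟩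
      rw [map_zero]
      exact (sub_eq_zero.2 e).symm
    · refine ⟨0, ?_⟩
      rw [map_zero]
      obtain ⟨z, hz⟩ := hb
      -- The component of the differential from degree `0` to itself is zero, so the pullback of `ψ`
      -- is zero and not merely a coboundary.
      rw [HomologicalComplex.shape _ _ _ (by simp)] at hz
      exact (GradedPrecat.PrecatFunctor.eq_zero_of_pullback_eq_zero hF (p := j) ψ
        ((GradedPrecat.PrecatFunctor.hochschildComplex_d_apply (p := j) ψ).symm.trans hψ)
        hz.symm).symm
  | succ i =>
    refine isIso_homologyMap_of_elements _ (i₁ := i + 1 + 1) (CochainComplex.prev_nat_succ i)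
      (CochainComplex.next ℕ (i + 1)) (fun φ hφ => ?_) (fun ψ hψ hb => ?_)
    · obtain ⟨ψ, hψ, χ, e⟩ := GradedPrecat.PrecatFunctor.exists_pullback_sub_eq hF (p := j) φ
        ((GradedPrecat.PrecatFunctor.hochschildComplex_d_apply (p := j) φ).symm.trans hφ)
      exact ⟨ψ, (GradedPrecat.PrecatFunctor.hochschildComplex_d_apply ψ).trans hψ, χ,
        (GradedPrecat.PrecatFunctor.hochschildComplex_d_apply χ).trans e⟩
    · obtain ⟨φ, hφ⟩ := hb
      obtain ⟨χ, e⟩ := GradedPrecat.PrecatFunctor.exists_d_eq_of_pullback_eq_d hF (p := j) ψ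
        ((GradedPrecat.PrecatFunctor.hochschildComplex_d_apply (p := j) ψ).symm.trans hψ) φ
        ((GradedPrecat.PrecatFunctor.hochschildComplex_d_apply (p := j) φ).symm.trans hφ)
      exact ⟨χ, (GradedPrecat.PrecatFunctor.hochschildComplex_d_apply χ).trans e⟩
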